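/- \textbf{Conventions.} All $\Lambda$-rings are torsion-free. A torsion-free $\Lambda$-ring structure on a commutative ring $A$ is the same as a family of ring endomorphisms (Adams operations) $\Psi^n$, $n\ge 1$, with $\Psi^1=\mathrm{id}$, $\Psi^{mn}=\Psi^m\circ\Psi^n$ and $\Psi^p(a)\equiv a^p \bmod p$ for all primes $p$; morphisms are ring homomorphisms commuting with all $\Psi^n$; an element $x$ has rank $1$ if $\Psi^n(x)=x^n$ for all $n$. For a $\Lambda$-ring $R$, the ring $R[q]$ carries the $\Lambda$-structure over $R$ for which $q$ has rank $1$; then $\Psi^n(q-1)=q^n-1$, so $B/(q-1)$ is again a $\Lambda$-ring for every flat $\Lambda$-ring $B$ over $R[q]$. For a flat morphism $R\to A$ of $\Lambda$-rings, let $\mathrm{Strat}^q_{A/R}$ be the category of flat $\Lambda$-rings $B$ over $R[q]$ equipped with a morphism $A\to B/(q-1)$ of $\Lambda$-rings over $R$ which admits some lift to a morphism $A\to B$ of $\Lambda$-rings over $R$ (the lift is not part of the data); morphisms $B\to B'$ are morphisms of $\Lambda$-rings over $R[q]$ compatible with the maps from $A$ to $B/(q-1)$ and $B'/(q-1)$.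 Let $\mathrm{qDR}(A/R)$ be the cochain complex of $R[q]$-modules given by the homotopy limit of the functor $B\mapsto B$ on $\mathrm{Strat}^q_{A/R}$. For $d\ge 0$, the $q$-de Rham (Aomoto--Jackson) complex $q\text{-}\Omega^\bullet_{R[x_1,\dots,x_d]/R}$ has terms $\Omega^n_{R[x_1,\dots,x_d]/R}[q]$ and $R[q]$-linear differential $$\nabla_q(f\,dx_I)=\sum_i \frac{f(x_1,\dots,qx_i,\dots,x_d)-f(x_1,\dots,x_d)}{(q-1)x_i}\,dx_i\wedge dx_I .$$ For a complex $K$ of modules without $(q-1)$-torsion, $\eta_{(q-1)}K$ is the subcomplex of $K[\tfrac1{q-1}]$ with $(\eta_{(q-1)}K)^i=\{x\in (q-1)^iK^i : dx\in (q-1)^{i+1}K^{i+1}\}$; the derived d\'ecalage $\mathbf{L}\eta_{(q-1)}K$ is $\eta_{(q-1)}P$ for a resolution $P\to K$ by a complex without $(q-1)$-torsion. \textbf{Theorem.} Let $R$ be a (torsion-free) $\Lambda$-ring, let $d\ge 0$, and give $R[x_1,\dots,x_d]$ the $\Lambda$-ring structure over $R$ for which the $x_i$ have rank $1$. Then there are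 zigzags of $R[q]$-linear quasi-isomorphisms $$\mathrm{qDR}(R[x_1,\dots,x_d]/R)\simeq\bigl(\Omega^*_{R[x_1,\dots,x_d]/R}[q],\,(q-1)\nabla_q\bigr),\qquad \mathbf{L}\eta_{(q-1)}\,\mathrm{qDR}(R[x_1,\dots,x_d]/R)\simeq q\text{-}\Omega^\bullet_{R[x_1,\dots,x_d]/R}.$$ -/

import Mathlib

open CategoryTheory Polynomial

universe u v w

/-! ### Torsion-free Λ-rings, through their Adams operations -/

/-- A torsion-free Λ-ring, given by its Adams operations: commuting ring endomorphisms `Ψ^n`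
(`n ≥ 1`) with `Ψ^1 = id`, `Ψ^{mn} = Ψ^m ∘ Ψ^n`, and `Ψ^p(a) ≡ a^p` modulo `p` for all primes
`p`. -/
class LambdaRing (A : Type u) [CommRing A] where
  /-- the Adams operations -/
  psi : ℕ+ →* (A →+* A)
  psi_prime : ∀ (p : ℕ+), (p : ℕ).Prime → ∀ a : A, ((p : ℕ) : A) ∣ psi p a - a ^ (p : ℕ)
  torsion_free : ∀ n : ℕ, n ≠ 0 → ∀ a : A, (n : A) * a = 0 → a = 0

open LambdaRing (psi)

/-- A morphism of Λ-rings is a ring homomorphism that commutes with all Adams operations. -/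
def IsLambdaHom {A : Type u} {B : Type v} [CommRing A] [LambdaRing A] [CommRing B] [LambdaRing B]
    (f : A →+* B) : Prop :=
  ∀ (n : ℕ+) (a : A), f (psi n a) = psi n (f a)

/-- An element `x` has rank one if `Ψ^n(x) = x^n` for all `n`. -/
def IsRankOne {A : Type u} [CommRing A] [LambdaRing A] (x : A) : Prop :=
  ∀ n : ℕ+, psi n x = x ^ (n : ℕ)

/-- `A` is a Λ-ring over the Λ-ring `R`: the structure map `R → A` is a morphism of Λ-rings. -/
class LambdaAlgebra (R : Type u) (A : Type v) [CommRing R] [LambdaRing R] [CommRing A]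
    [LambdaRing A] [Algebra R A] : Prop where
  isLambdaHom : IsLambdaHom (algebraMap R A)

section PolynomialRings

variable {R : Type u} [CommRing R] [LambdaRing R]

/-- The Λ-ring structure on `R[q]` for which `q` has rank one and `R → R[q]` is a morphism of
Λ-rings: `Ψ^n(∑ a_k q^k) = ∑ Ψ^n(a_k) q^{nk}`. -/
noncomputable instance Polynomial.instLambdaRing : LambdaRing R[X] where
  psi :=
    { toFun := fun n => Polynomial.eval₂RingHom (Polynomial.C.comp (psi n)) (X ^ (n : ℕ))
      map_one' := by ext <;> simp
      map_mul' := fun m n => by ext <;> simp [← pow_mul] }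
  psi_prime := fun p hp f => by
    have : Fact (p : ℕ).Prime := ⟨hp⟩
    induction f using Polynomial.induction_on' with
    | add f g hf hg =>
      obtain ⟨r, hr⟩ := exists_add_pow_prime_eq hp f g
      rw [map_add, hr]
      obtain ⟨s, hs⟩ := hf
      obtain ⟨t, ht⟩ := hg
      exact ⟨s + t - f * g * r, by linear_combination hs + ht⟩
    | monomial k a =>
      obtain ⟨s, hs⟩ := LambdaRing.psi_prime p hp a
      refine ⟨C s * X ^ (k * p), ?_⟩
      have h : psi p a = a ^ (p : ℕ) + p * s := by linear_combination hs
      simp [← C_mul_X_pow_eq_monomial, h, mul_pow, ← pow_mul, mul_comm (p : ℕ) k]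
      ring
  torsion_free := fun n hn f hf => by
    ext k
    refine LambdaRing.torsion_free n hn _ ?_
    have := congrArg (fun g => Polynomial.coeff g k) hf
    simpa only [Polynomial.coeff_natCast_mul, Polynomial.coeff_zero] using this

instance Polynomial.instLambdaAlgebra : LambdaAlgebra R R[X] where
  isLambdaHom := fun n a => by
    simp [psi]

theorem Polynomial.isRankOne_X : IsRankOne (X : R[X]) := fun n => by
  simp [psi]

/-- The Λ-ring structure on `R[x_i]` for which the `x_i` have rank one and `R → R[x_i]` is a
morphism of Λ-rings: `Ψ^n(∑ a_m x^m) = ∑ Ψ^n(a_m) x^{nm}`. -/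
noncomputable instance MvPolynomial.instLambdaRing {σ : Type v} :
    LambdaRing (MvPolynomial σ R) where
  psi :=
    { toFun := fun n => MvPolynomial.eval₂Hom (MvPolynomial.C.comp (psi n))
        (fun i => MvPolynomial.X i ^ (n : ℕ))
      map_one' := by ext <;> simp
      map_mul' := fun m n => by ext <;> simp [← pow_mul] }
  psi_prime := fun p hp f => by
    have : Fact (p : ℕ).Prime := ⟨hp⟩
    induction f using MvPolynomial.induction_on with
    | add f g hf hg =>
      obtain ⟨r, hr⟩ := exists_add_pow_prime_eq hp f g
      rw [map_add, hr]
      obtain ⟨s, hs⟩ := hf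
      obtain ⟨t, ht⟩ := hg
      exact ⟨s + t - f * g * r, by linear_combination hs + ht⟩
    | C a =>
      obtain ⟨s, hs⟩ := LambdaRing.psi_prime p hp a
      refine ⟨MvPolynomial.C s, ?_⟩
      have h : psi p a = a ^ (p : ℕ) + p * s := by linear_combination hs
      simp [h]
    | mul_X f i hf =>
      obtain ⟨s, hs⟩ := hf
      refine ⟨s * MvPolynomial.X i ^ (p : ℕ), ?_⟩
      simp only [MonoidHom.coe_mk, OneHom.coe_mk, map_mul, MvPolynomial.coe_eval₂Hom,
        MvPolynomial.eval₂_X] at hs ⊢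
      linear_combination MvPolynomial.X i ^ (p : ℕ) * hs
  torsion_free := fun n hn f hf => by
    ext k
    refine LambdaRing.torsion_free n hn _ ?_
    have := congrArg (fun g => MvPolynomial.coeff k g) hf
    simpa only [← map_natCast (MvPolynomial.C (σ := σ) (R := R)) n, MvPolynomial.coeff_C_mul,
      MvPolynomial.coeff_zero] using this

instance MvPolynomial.instLambdaAlgebra {σ : Type v} :
    LambdaAlgebra R (MvPolynomial σ R) where
  isLambdaHom := fun n a => by
    simp [psi, MvPolynomial.algebraMap_eq]

theorem MvPolynomial.isRankOne_X {σ : Type v} (i : σ) :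
    IsRankOne (MvPolynomial.X i : MvPolynomial σ R) := fun n => by
  simp [psi]

end PolynomialRings

/-! ### The category `Strat^q_{A/R}` -/

section Strat

variable (R : Type u) [CommRing R]

/-- The ideal `(q - 1)` of an `R[q]`-algebra `B`. -/
def qIdeal (B : Type u) [CommRing B] [Algebra R[X] B] : Ideal B :=
  Ideal.span {algebraMap R[X] B (X - 1)}

/-- A morphism of `R[q]`-algebras sends `(q - 1)` into `(q - 1)`. -/
theorem qIdeal_le_comap {B B' : Type u} [CommRing B] [Algebra R[X] B] [CommRing B']
    [Algebra R[X] B'] (f : B →ₐ[R[X]] B') :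
    qIdeal R B ≤ (qIdeal R B').comap (f : B →+* B') := by
  rw [qIdeal, Ideal.span_le, Set.singleton_subset_iff]
  simp [qIdeal]

variable [LambdaRing R]

/-- The Adams operations send `(q - 1)` into itself, as `Ψ^n(q - 1) = q^n - 1`. -/
theorem qIdeal_le_comap_psi (B : Type u) [CommRing B] [LambdaRing B] [Algebra R[X] B]
    [LambdaAlgebra R[X] B] (n : ℕ+) :
    qIdeal R B ≤ (qIdeal R B).comap (psi n : B →+* B) := by
  rw [qIdeal, Ideal.span_le, Set.singleton_subset_iff]
  have h : (X - 1 : R[X]) ∣ psi n (X - 1 : R[X]) := by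
    rw [map_sub, map_one, Polynomial.isRankOne_X n]
    exact sub_one_dvd_pow_sub_one _ _
  have h2 := map_dvd (algebraMap R[X] B) h
  rw [LambdaAlgebra.isLambdaHom n] at h2
  simpa [Ideal.mem_span_singleton] using h2

/-- The map `B/(q-1) → B'/(q-1)` induced by a morphism of `R[q]`-algebras. -/
noncomputable def qReduction {B B' : Type u} [CommRing B] [Algebra R[X] B] [CommRing B'] [Algebra R[X] B']
    (f : B →ₐ[R[X]] B') : B ⧸ qIdeal R B →+* B' ⧸ qIdeal R B' :=
  Ideal.quotientMap (qIdeal R B') (f : B →+* B') (qIdeal_le_comap R f)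

/-- The Adams operations of the Λ-ring `B/(q-1)`. -/
noncomputable def psiReduction (B : Type u) [CommRing B] [LambdaRing B] [Algebra R[X] B]
    [LambdaAlgebra R[X] B] (n : ℕ+) : B ⧸ qIdeal R B →+* B ⧸ qIdeal R B :=
  Ideal.quotientMap (qIdeal R B) (psi n : B →+* B) (qIdeal_le_comap_psi R B n)

variable (A : Type u) [CommRing A] [LambdaRing A] [Algebra R A]

/-- The objects of `Strat^q_{A/R}`: flat Λ-rings `B` over `R[q]` with a morphism
`A → B/(q-1)` of Λ-rings over `R` that admits a lift to a morphism `A → B` of Λ-rings over `R`.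
The lift is not part of the data. -/
structure Strat where
  /-- the underlying ring `B` -/
  carrier : Type u
  [commRing : CommRing carrier]
  [lambdaRing : LambdaRing carrier]
  [algebra : Algebra R[X] carrier]
  [lambdaAlgebra : LambdaAlgebra R[X] carrier]
  [flat : Module.Flat R[X] carrier]
  /-- the morphism `A → B/(q-1)` -/
  toQuotient : A →+* carrier ⧸ qIdeal R carrier
  toQuotient_algebraMap : ∀ r : R, toQuotient (algebraMap R A r) =
    Ideal.Quotient.mk (qIdeal R carrier) (algebraMap R[X] carrier (C r))
  toQuotient_psi : ∀ (n : ℕ+) (a : A),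
    toQuotient (psi n a) = psiReduction R carrier n (toQuotient a)
  exists_lift : ∃ g : A →+* carrier, IsLambdaHom g ∧
    (∀ r : R, g (algebraMap R A r) = algebraMap R[X] carrier (C r)) ∧
    (Ideal.Quotient.mk (qIdeal R carrier)).comp g = toQuotient

namespace Strat

attribute [instance] commRing lambdaRing algebra lambdaAlgebra flat

variable {R A}

/-- Morphisms in `Strat^q_{A/R}`: morphisms `B → B'` of Λ-rings over `R[q]` such that
`A → B/(q-1) → B'/(q-1)` is the given morphism `A → B'/(q-1)`. -/
@[ext]
structure Hom (B B' : Strat R A) where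
  /-- the underlying morphism of `R[q]`-algebras -/
  toAlgHom : B.carrier →ₐ[R[X]] B'.carrier
  isLambdaHom : IsLambdaHom (toAlgHom : B.carrier →+* B'.carrier)
  comp_toQuotient : (qReduction R toAlgHom).comp B.toQuotient = B'.toQuotient

noncomputable instance : Category (Strat R A) where
  Hom := Hom
  id B :=
    { toAlgHom := AlgHom.id _ _
      isLambdaHom := fun _ _ => rfl
      comp_toQuotient := by
        ext a
        obtain ⟨b, hb⟩ := Ideal.Quotient.mk_surjective (B.toQuotient a)
        simp [qReduction, ← hb] }
  comp {B B' B''} f g :=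
    { toAlgHom := g.toAlgHom.comp f.toAlgHom
      isLambdaHom := fun n b =>
        (congrArg g.toAlgHom (f.isLambdaHom n b)).trans (g.isLambdaHom n (f.toAlgHom b))
      comp_toQuotient := by
        rw [← g.comp_toQuotient, ← f.comp_toQuotient]
        ext a
        obtain ⟨b, hb⟩ := Ideal.Quotient.mk_surjective (B.toQuotient a)
        simp [qReduction, ← hb] }

variable (R A)

/-- The functor `B ↦ B` from `Strat^q_{A/R}` to `R[q]`-modules. -/
noncomputable def forgetToModule : Strat R A ⥤ ModuleCat.{u} R[X] where
  obj B := ModuleCat.of R[X] B.carrier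
  map f := ModuleCat.ofHom f.toAlgHom.toLinearMap

end Strat

end Strat

/-! ### Homotopy limits and `qDR` -/

section HomotopyLimit

variable {S : Type u} [CommRing S] {J : Type v} [Category.{w} J]

universe t

theorem map_homOfLE_trans {F : J ⥤ ModuleCat.{t} S} {n : ℕ} {σ : ComposableArrows J n}
    {i j k : Fin (n + 1)} (hij : i ≤ j) (hjk : j ≤ k) (s : F.obj (σ.obj i)) :
    (F.map (σ.map (homOfLE (hij.trans hjk)))).hom s =
      (F.map (σ.map (homOfLE hjk))).hom ((F.map (σ.map (homOfLE hij))).hom s) := by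
  rw [← homOfLE_comp hij hjk, σ.map_comp, F.map_comp]
  rfl

/-- The Bousfield–Kan cosimplicial replacement of a diagram of modules:
`[n] ↦ ∏_{j_0 → ⋯ → j_n} F(j_n)`, where `f : [n] → [m]` sends a family `s` to the family whose
entry at `σ = (j_0 → ⋯ → j_m)` is the image of `s(σ ∘ f) ∈ F(j_{f(n)})` under
`F(j_{f(n)}) → F(j_m)`. -/
def cosimplicialReplacement (F : J ⥤ ModuleCat.{t} S) :
    CosimplicialObject (ModuleCat.{max v w t} S) where
  obj n := ModuleCat.of S
    (∀ σ : ComposableArrows J n.len, F.obj (σ.obj (Fin.last n.len)))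
  map {n m} f := ModuleCat.ofHom
    (LinearMap.pi fun σ : ComposableArrows J m.len =>
      (F.map (σ.map (homOfLE (Fin.le_last (f.toOrderHom (Fin.last n.len)))))).hom ∘ₗ
        LinearMap.proj (R := S)
          (φ := fun τ : ComposableArrows J n.len => F.obj (τ.obj (Fin.last n.len)))
          (f.toOrderHom.monotone.functor ⋙ σ))
  map_id n := by
    ext s σ
    change (F.map (σ.map (𝟙 _))).hom (s σ) = s σ
    simp
  map_comp {n m k} f g := by
    ext s σ
    exact map_homOfLE_trans (F := F) (σ := σ)
      (g.toOrderHom.monotone (Fin.le_last (f.toOrderHom (Fin.last n.len))))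
      (Fin.le_last (g.toOrderHom (Fin.last m.len)))
      (s ((f ≫ g).toOrderHom.monotone.functor ⋙ σ))

/-- The homotopy limit, in cochain complexes of `S`-modules, of a diagram of `S`-modules placed in
degree zero: the total complex of the Bousfield–Kan cosimplicial replacement. -/
noncomputable def homotopyLimit (F : J ⥤ ModuleCat.{t} S) :
    CochainComplex (ModuleCat.{max v w t} S) ℤ :=
  ((AlgebraicTopology.alternatingCofaceMapComplex _).obj (cosimplicialReplacement F)).extend
    ComplexShape.embeddingUpNat

end HomotopyLimit

/-- `qDR(A/R)`: the homotopy limit of `B ↦ B` over `Strat^q_{A/R}`. As the category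
`Strat^q_{A/R}` is large, this is a complex of modules in the next universe. -/
noncomputable def qDR (R : Type u) [CommRing R] [LambdaRing R] (A : Type u) [CommRing A]
    [LambdaRing A] [Algebra R A] : CochainComplex (ModuleCat.{u + 1} R[X]) ℤ :=
  homotopyLimit (Strat.forgetToModule R A)

/-! ### The Aomoto–Jackson complex -/

section Jackson

variable (R : Type u) [CommRing R] (d : ℕ)

/-- The `q`-integer `[n]_q = 1 + q + ⋯ + q^{n-1}` in `R[q]`. -/
noncomputable def qInt (n : ℕ) : R[X] := ∑ j ∈ Finset.range n, X ^ j

/-- The partial Jackson derivative `∇_{q,i}` on `R[x_1,…,x_d][q] = R[q][x_1,…,x_d]`, the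
`R[q]`-linear map with `x^m ↦ [m_i]_q x^{m - e_i}`. -/
noncomputable def jacksonDeriv (i : Fin d) :
    MvPolynomial (Fin d) R[X] →ₗ[R[X]] MvPolynomial (Fin d) R[X] :=
  (MvPolynomial.basisMonomials (Fin d) R[X]).constr R[X] fun m =>
    MvPolynomial.monomial (m - Finsupp.single i 1) (qInt R (m i))

theorem jacksonDeriv_monomial (i : Fin d) (m : Fin d →₀ ℕ) (c : R[X]) :
    jacksonDeriv R d i (MvPolynomial.monomial m c) =
      MvPolynomial.monomial (m - Finsupp.single i 1) (c * qInt R (m i)) := by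
  have h : MvPolynomial.monomial m c = c • MvPolynomial.basisMonomials (Fin d) R[X] m := by
    simp [MvPolynomial.smul_monomial]
  rw [h, map_smul, jacksonDeriv, Module.Basis.constr_basis, MvPolynomial.smul_monomial,
    smul_eq_mul]

/-- The defining property of the Jackson derivative:
`(q - 1) x_i ∇_{q,i}(f) = f(x_1,…,q x_i,…,x_d) - f(x_1,…,x_d)`. -/
theorem jacksonDeriv_spec (i : Fin d) (f : MvPolynomial (Fin d) R[X]) :
    MvPolynomial.C (X - 1) * MvPolynomial.X i * jacksonDeriv R d i f =
      MvPolynomial.aeval (Function.update MvPolynomial.X i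
        (MvPolynomial.C X * MvPolynomial.X i) : Fin d → MvPolynomial (Fin d) R[X]) f - f := by
  induction f using MvPolynomial.induction_on' with
  | add f g hf hg =>
    rw [map_add, map_add, mul_add, hf, hg]
    ring
  | monomial m c =>
    have h : MvPolynomial.aeval (Function.update MvPolynomial.X i
        (MvPolynomial.C X * MvPolynomial.X i) : Fin d → MvPolynomial (Fin d) R[X])
        (MvPolynomial.monomial m c) = MvPolynomial.monomial m (c * X ^ m i) := by
      have h2 : ∀ j : Fin d, (Function.update MvPolynomial.X i
          (MvPolynomial.C X * MvPolynomial.X i) : Fin d → MvPolynomial (Fin d) R[X]) j ^ m j =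
          (if j = i then MvPolynomial.C X ^ m j else 1) * MvPolynomial.X j ^ m j := by
        intro j
        rcases eq_or_ne j i with rfl | hj
        · simp [mul_pow]
        · simp [hj]
      rw [MvPolynomial.aeval_monomial, Finsupp.prod_fintype _ _ (by simp),
        Finset.prod_congr rfl (fun j _ => h2 j), Finset.prod_mul_distrib,
        MvPolynomial.monomial_eq (s := m), Finsupp.prod_fintype _ _ (by simp)]
      simp [MvPolynomial.algebraMap_eq]
      ring
    rw [h, jacksonDeriv_monomial]
    have hq : (X - 1) * qInt R (m i) = X ^ m i - 1 := by
      rw [qInt, mul_comm, geom_sum_mul]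
    rcases Nat.eq_zero_or_pos (m i) with h0 | h0
    · simp [h0, qInt]
    · have hm : Finsupp.single i 1 + (m - Finsupp.single i 1) = m :=
        add_tsub_cancel_of_le (Finsupp.single_le_iff.2 h0)
      rw [MvPolynomial.X, MvPolynomial.C_mul_monomial, MvPolynomial.monomial_mul, hm,
        ← map_sub]
      congr 1
      linear_combination c * hq

theorem jacksonDeriv_comm (i j : Fin d) (f : MvPolynomial (Fin d) R[X]) :
    jacksonDeriv R d i (jacksonDeriv R d j f) = jacksonDeriv R d j (jacksonDeriv R d i f) := by
  induction f using MvPolynomial.induction_on' with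
  | add f g hf hg => simp only [map_add, hf, hg]
  | monomial m c =>
    rcases eq_or_ne i j with rfl | hij
    · rfl
    · simp only [jacksonDeriv_monomial]
      congr 1
      · rw [tsub_right_comm]
      · simp [hij, hij.symm]
        ring

/-- `Ω^n_{R[x_1,…,x_d]/R}[q]`, the free `R[x_1,…,x_d][q]`-module on the forms
`dx_I = dx_{i_1} ∧ ⋯ ∧ dx_{i_n}`, `I = {i_1 < ⋯ < i_n}`: the form `∑_I f_I dx_I` is the
family `(f_I)_I`. -/
abbrev JacksonForm (n : ℕ) : Type u :=
  {I : Finset (Fin d) // I.card = n} → MvPolynomial (Fin d) R[X]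

/-- The sign with `dx_i ∧ dx_{I ∖ i} = ± dx_I` for `i ∈ I`. -/
def wedgeSign (I : Finset (Fin d)) (i : Fin d) : ℤ :=
  (-1) ^ (I.filter (· < i)).card

/-- The differential `∇_q(f dx_I) = ∑_i ∇_{q,i}(f) dx_i ∧ dx_I`. -/
noncomputable def nablaq (n : ℕ) : JacksonForm R d n →ₗ[R[X]] JacksonForm R d (n + 1) :=
  LinearMap.pi fun I => ∑ i : I.1,
    wedgeSign d I.1 i • (jacksonDeriv R d i ∘ₗ
      LinearMap.proj (⟨I.1.erase i, by
        rw [Finset.card_erase_of_mem i.2, I.2, Nat.add_sub_cancel]⟩ :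
          {I : Finset (Fin d) // I.card = n}))

theorem wedgeSign_antisymm (I : Finset (Fin d)) {i j : Fin d} (hi : i ∈ I) (hj : j ∈ I)
    (hij : i ≠ j) : wedgeSign d I i * wedgeSign d (I.erase i) j =
      -(wedgeSign d I j * wedgeSign d (I.erase j) i) := by
  have key : ∀ {i j : Fin d}, i ∈ I → i < j → wedgeSign d I i * wedgeSign d (I.erase i) j =
      -(wedgeSign d I j * wedgeSign d (I.erase j) i) := by
    intro i j hi h
    have h1 : (I.erase i).filter (· < j) = (I.filter (· < j)).erase i := Finset.filter_erase ..
    have h2 : (I.erase j).filter (· < i) = I.filter (· < i) := by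
      ext k
      simp only [Finset.mem_filter, Finset.mem_erase]
      exact ⟨fun hk => ⟨hk.1.2, hk.2⟩, fun hk => ⟨⟨(hk.2.trans h).ne, hk.1⟩, hk.2⟩⟩
    have h3 : i ∈ I.filter (· < j) := Finset.mem_filter.2 ⟨hi, h⟩
    obtain ⟨c, hc⟩ : ∃ c, (I.filter (· < j)).card = c + 1 :=
      Nat.exists_eq_succ_of_ne_zero (Finset.card_ne_zero_of_mem h3)
    rw [wedgeSign, wedgeSign, wedgeSign, wedgeSign, h1, h2, Finset.card_erase_of_mem h3, hc,
      Nat.add_sub_cancel, pow_succ]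
    ring
  rcases lt_or_gt_of_ne hij with h | h
  · exact key hi h
  · rw [key hj h, neg_neg]

theorem nablaq_comp_nablaq (n : ℕ) : nablaq R d (n + 1) ∘ₗ nablaq R d n = 0 := by
  refine LinearMap.ext fun ω => funext fun J => ?_
  let ω' : Finset (Fin d) → MvPolynomial (Fin d) R[X] :=
    fun I => if h : I.card = n then ω ⟨I, h⟩ else 0
  have e1 : ∀ (I : Finset (Fin d)) (hI : I.card = n + 1), nablaq R d n ω ⟨I, hI⟩ =
      ∑ k ∈ I, wedgeSign d I k • jacksonDeriv R d k (ω' (I.erase k)) := by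
    intro I hI
    rw [← Finset.sum_coe_sort]
    simp only [nablaq, LinearMap.pi_apply, LinearMap.sum_apply, LinearMap.smul_apply,
      LinearMap.comp_apply, LinearMap.proj_apply]
    refine Finset.sum_congr rfl fun k _ => ?_
    have : (I.erase k).card = n := by
      rw [Finset.card_erase_of_mem k.2, hI, Nat.add_sub_cancel]
    simp only [ω', this, dif_pos]
  have e2 : nablaq R d (n + 1) (nablaq R d n ω) J = ∑ i ∈ J.1, ∑ k ∈ J.1.erase i,
      (wedgeSign d J.1 i * wedgeSign d (J.1.erase i) k) •
        jacksonDeriv R d i (jacksonDeriv R d k (ω' ((J.1.erase i).erase k))) := by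
    rw [← Finset.sum_coe_sort]
    simp only [nablaq, LinearMap.pi_apply, LinearMap.sum_apply, LinearMap.smul_apply,
      LinearMap.comp_apply, LinearMap.proj_apply]
    refine Finset.sum_congr rfl fun i _ => ?_
    have := e1 (J.1.erase i) (by
      rw [Finset.card_erase_of_mem i.2, J.2, Nat.add_sub_cancel])
    simp only [nablaq, LinearMap.pi_apply, LinearMap.sum_apply, LinearMap.smul_apply,
      LinearMap.comp_apply, LinearMap.proj_apply] at this
    rw [this, map_sum, Finset.smul_sum]
    simp only [map_zsmul, smul_smul]
  rw [LinearMap.comp_apply, e2, Finset.sum_sigma']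
  refine Finset.sum_involution (fun x _ => ⟨x.2, x.1⟩) ?_ ?_ ?_ ?_
  · rintro ⟨i, k⟩ h
    simp only [Finset.mem_sigma, Finset.mem_erase] at h
    rw [wedgeSign_antisymm d J.1 h.1 h.2.2 h.2.1.symm, jacksonDeriv_comm R d i k,
      Finset.erase_right_comm, neg_smul, neg_add_cancel]
  · rintro ⟨i, k⟩ h _ heq
    simp only [Finset.mem_sigma, Finset.mem_erase] at h
    exact h.2.1 (congrArg Sigma.fst heq)
  · rintro ⟨i, k⟩ h
    simp only [Finset.mem_sigma, Finset.mem_erase] at h ⊢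
    exact ⟨h.2.2, h.2.1.symm, h.1⟩
  · rintro ⟨i, k⟩ h
    rfl

/-- A cochain complex in non-negative degrees, as a complex indexed by `ℤ` in the next universe. -/
noncomputable def liftComplex {S : Type u} [CommRing S] (K : CochainComplex (ModuleCat.{u} S) ℕ) :
    CochainComplex (ModuleCat.{u + 1} S) ℤ :=
  (((ModuleCat.uliftFunctor.{u + 1, u} S).mapHomologicalComplex _).obj K).extend
    ComplexShape.embeddingUpNat

/-- The `q`-de Rham (Aomoto–Jackson) complex `q-Ω^•` of `R[x_1,…,x_d]` over `R`, with
differential `∇_q`. -/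
noncomputable def qOmega : CochainComplex (ModuleCat.{u + 1} R[X]) ℤ :=
  liftComplex (CochainComplex.of (fun n => ModuleCat.of R[X] (JacksonForm R d n))
    (fun n => ModuleCat.ofHom (nablaq R d n))
    (fun n => by rw [← ModuleCat.ofHom_comp, nablaq_comp_nablaq]; rfl))

/-- The complex `(Ω^*_{R[x_1,…,x_d]/R}[q], (q-1)∇_q)`. -/
noncomputable def qOmegaScaled : CochainComplex (ModuleCat.{u + 1} R[X]) ℤ :=
  liftComplex (CochainComplex.of (fun n => ModuleCat.of R[X] (JacksonForm R d n))
    (fun n => ModuleCat.ofHom ((X - 1 : R[X]) • nablaq R d n))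
    (fun n => by
      rw [← ModuleCat.ofHom_comp, LinearMap.comp_smul, LinearMap.smul_comp, nablaq_comp_nablaq,
        smul_zero, smul_zero]
      rfl))

end Jackson

/-! ### Zigzags of quasi-isomorphisms -/

/-- `K` and `L` are linked by a finite zigzag of `S`-linear quasi-isomorphisms. -/
def QuasiIsomorphic {S : Type u} [CommRing S] (K L : CochainComplex (ModuleCat.{v} S) ℤ) : Prop :=
  Relation.EqvGen (fun K L => ∃ f : K ⟶ L, QuasiIso f) K L

/-! ### Décalage -/

section Decalage

variable {S : Type u} [CommRing S] (f : S)

/-- The submodule `f^m M` of `M[1/f]`, for an integer `m`. -/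
def fPow (M : Type v) [AddCommGroup M] [Module S M] (m : ℤ) :
    Submodule S (LocalizedModule (Submonoid.powers f) M) where
  carrier := {x | ∃ y : M, f ^ (-m).toNat • x =
    f ^ m.toNat • LocalizedModule.mkLinearMap (Submonoid.powers f) M y}
  zero_mem' := ⟨0, by simp⟩
  add_mem' := by
    rintro x x' ⟨y, h⟩ ⟨y', h'⟩
    exact ⟨y + y', by rw [smul_add, h, h', map_add, smul_add]⟩
  smul_mem' := by
    rintro c x ⟨y, h⟩
    exact ⟨c • y, by rw [smul_comm, h, map_smul, smul_comm]⟩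

/-- The map `M[1/f] → N[1/f]` induced by a linear map `M → N`. -/
noncomputable def locMap {M N : Type v} [AddCommGroup M] [Module S M] [AddCommGroup N]
    [Module S N] (g : M →ₗ[S] N) : LocalizedModule (Submonoid.powers f) M →ₗ[S]
      LocalizedModule (Submonoid.powers f) N :=
  IsLocalizedModule.map (Submonoid.powers f)
    (LocalizedModule.mkLinearMap (Submonoid.powers f) M)
    (LocalizedModule.mkLinearMap (Submonoid.powers f) N) g

variable (K : CochainComplex (ModuleCat.{max u w} S) ℤ)

theorem locMap_d_d (i j k : ℤ) (x : LocalizedModule (Submonoid.powers f) (K.X i)) :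
    locMap f (K.d j k).hom (locMap f (K.d i j).hom x) = 0 := by
  have h : (K.d j k).hom ∘ₗ (K.d i j).hom = 0 := by
    rw [← ModuleCat.hom_comp, K.d_comp_d]
    rfl
  rw [← LinearMap.comp_apply, locMap, locMap, ← IsLocalizedModule.map_comp', h, map_zero,
    LinearMap.zero_apply]

/-- `(η_f K)^i = {x ∈ f^i K^i : dx ∈ f^{i+1} K^{i+1}}`, inside `K^i[1/f]`. -/
noncomputable def decalageX (i : ℤ) : Submodule S (LocalizedModule (Submonoid.powers f) (K.X i)) :=
  fPow f (K.X i) i ⊓ (fPow f (K.X (i + 1)) (i + 1)).comap (locMap f (K.d i (i + 1)).hom)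

/-- The differential of `η_f K`, the restriction of that of `K[1/f]`. -/
noncomputable def decalageD (i : ℤ) : decalageX f K i →ₗ[S] decalageX f K (i + 1) :=
  (locMap f (K.d i (i + 1)).hom).restrict fun x hx =>
    ⟨hx.2, by
      change locMap f _ (locMap f _ x) ∈ fPow f (K.X (i + 1 + 1)) (i + 1 + 1)
      rw [locMap_d_d]
      exact Submodule.zero_mem _⟩

/-- The décalage `η_f K`, the subcomplex of `K[1/f]` with
`(η_f K)^i = {x ∈ f^i K^i : dx ∈ f^{i+1} K^{i+1}}`. -/
noncomputable def decalage : CochainComplex (ModuleCat.{max u w} S) ℤ :=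
  CochainComplex.of (fun i => ModuleCat.of S (decalageX f K i))
    (fun i => ModuleCat.ofHom (decalageD f K i))
    (fun i => by
      ext x : 2
      exact Subtype.ext (locMap_d_d f K i (i + 1) (i + 1 + 1) x.1))

end Decalage

/-! ### Torsion-free resolutions and derived décalage -/

section Resolution

variable {S : Type u} [CommRing S]

/-- The free module on the non-zero elements of `M`. -/
abbrev FreeCover (S : Type u) [CommRing S] (M : Type v) [AddCommGroup M] : Type (max u v) :=
  {x : M // x ≠ 0} →₀ S

open Classical in
/-- The generator `[x]` of the free module, with `[0] = 0`. -/
noncomputable def FreeCover.of {M : Type v} [AddCommGroup M] (x : M) : FreeCover S M :=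
  if h : x ≠ 0 then Finsupp.single ⟨x, h⟩ 1 else 0

theorem FreeCover.of_zero {M : Type v} [AddCommGroup M] :
    (FreeCover.of (0 : M) : FreeCover S M) = 0 := by
  simp [FreeCover.of]

/-- The linear map `[x] ↦ φ(x)`, for `φ` with `φ(0) = 0`. -/
noncomputable def FreeCover.lift {M : Type v} [AddCommGroup M] {N : Type w} [AddCommGroup N]
    [Module S N] (φ : M → N) : FreeCover S M →ₗ[S] N :=
  Finsupp.linearCombination S (fun x : {x : M // x ≠ 0} => φ x.1)

theorem FreeCover.lift_of {M : Type v} [AddCommGroup M] {N : Type w} [AddCommGroup N]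
    [Module S N] (φ : M → N) (hφ : φ 0 = 0) (x : M) :
    FreeCover.lift (S := S) φ (FreeCover.of x) = φ x := by
  by_cases h : x = 0
  · rw [h, FreeCover.of_zero, map_zero, hφ]
  · simp [FreeCover.lift, FreeCover.of, h]

theorem FreeCover.hom_ext {M : Type v} [AddCommGroup M] {N : Type w} [AddCommGroup N]
    [Module S N] {g h : FreeCover S M →ₗ[S] N}
    (H : ∀ x : M, g (FreeCover.of x) = h (FreeCover.of x)) : g = h := by
  refine Finsupp.lhom_ext' fun x => LinearMap.ext_ring ?_
  have := H x.1
  simpa [FreeCover.of, x.2] using this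

/-- The linear map `[x] ↦ [g x]` of free modules induced by a linear map `g`. -/
noncomputable def FreeCover.map {M : Type v} [AddCommGroup M] [Module S M] {N : Type w}
    [AddCommGroup N] [Module S N] (g : M →ₗ[S] N) : FreeCover S M →ₗ[S] FreeCover S N :=
  FreeCover.lift fun x => FreeCover.of (g x)

theorem FreeCover.map_of {M : Type v} [AddCommGroup M] [Module S M] {N : Type w}
    [AddCommGroup N] [Module S N] (g : M →ₗ[S] N) (x : M) :
    FreeCover.map g (FreeCover.of x) = FreeCover.of (g x) :=
  FreeCover.lift_of _ (by rw [map_zero, FreeCover.of_zero]) x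

theorem FreeCover.map_zero {M : Type v} [AddCommGroup M] [Module S M] {N : Type w}
    [AddCommGroup N] [Module S N] : FreeCover.map (0 : M →ₗ[S] N) = 0 :=
  FreeCover.hom_ext fun x => by
    rw [FreeCover.map_of, LinearMap.zero_apply, FreeCover.of_zero, LinearMap.zero_apply]

theorem FreeCover.map_comp {M : Type v} [AddCommGroup M] [Module S M] {N : Type w}
    [AddCommGroup N] [Module S N] {P : Type*} [AddCommGroup P] [Module S P] (h : N →ₗ[S] P)
    (g : M →ₗ[S] N) : FreeCover.map h ∘ₗ FreeCover.map g = FreeCover.map (h ∘ₗ g) :=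
  FreeCover.hom_ext fun x => by
    rw [LinearMap.comp_apply, FreeCover.map_of, FreeCover.map_of, FreeCover.map_of,
      LinearMap.comp_apply]

/-- The linear map `[x] ↦ x`. -/
noncomputable def FreeCover.π (S : Type u) [CommRing S] (M : Type v) [AddCommGroup M]
    [Module S M] : FreeCover S M →ₗ[S] M :=
  FreeCover.lift fun x => x

theorem FreeCover.π_of {M : Type v} [AddCommGroup M] [Module S M] (x : M) :
    FreeCover.π S M (FreeCover.of x) = x :=
  FreeCover.lift_of _ rfl x

theorem FreeCover.π_comp_map {M : Type v} [AddCommGroup M] [Module S M] {N : Type w}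
    [AddCommGroup N] [Module S N] (g : M →ₗ[S] N) :
    FreeCover.π S N ∘ₗ FreeCover.map g = g ∘ₗ FreeCover.π S M :=
  FreeCover.hom_ext fun x => by
    rw [LinearMap.comp_apply, FreeCover.map_of, FreeCover.π_of, LinearMap.comp_apply,
      FreeCover.π_of]

variable (K : CochainComplex (ModuleCat.{max u w} S) ℤ)

/-- The complex of free modules with generators `[x]` in degree `i`, for `x ∈ K^i` (and `[0] = 0`),
and differential `[x] ↦ [dx]`. -/
noncomputable def freeCoverComplex : CochainComplex (ModuleCat.{max u w} S) ℤ where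
  X i := ModuleCat.of S (FreeCover S (K.X i))
  d i j := ModuleCat.ofHom (FreeCover.map (K.d i j).hom)
  shape i j h := by
    rw [K.shape i j h, ModuleCat.hom_zero, FreeCover.map_zero]
    rfl
  d_comp_d' i j k _ _ := by
    rw [← ModuleCat.ofHom_comp, FreeCover.map_comp, ← ModuleCat.hom_comp, K.d_comp_d,
      ModuleCat.hom_zero, FreeCover.map_zero]
    rfl

/-- The surjection `[x] ↦ x` onto `K`. -/
noncomputable def freeCoverπ : freeCoverComplex.{u, w} K ⟶ K where
  f i := ModuleCat.ofHom (FreeCover.π S (K.X i))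
  comm' i j _ := ModuleCat.hom_ext (FreeCover.π_comp_map (K.d i j).hom).symm

instance : Epi (freeCoverπ.{u, w} K) := by
  have : ∀ i, Epi ((freeCoverπ.{u, w} K).f i) := fun i => by
    rw [ModuleCat.epi_iff_surjective]
    exact fun x => ⟨(FreeCover.of x : FreeCover S (K.X i)), FreeCover.π_of x⟩
  exact HomologicalComplex.epi_of_epi_f _ this

/-- The short exact sequence `0 → ker → F → K → 0` with `F` the free cover of `K`. -/
noncomputable abbrev freeCoverShortComplex :
    ShortComplex (CochainComplex (ModuleCat.{max u w} S) ℤ) :=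
  ShortComplex.mk (Limits.kernel.ι (freeCoverπ.{u, w} K)) (freeCoverπ.{u, w} K)
    (Limits.kernel.condition _)

/-- A functorial resolution of `K` by a complex of modules without `f`-torsion, for every
non-zero-divisor `f` of `S`: the mapping cone of `ker(F → K) → F`. -/
noncomputable def torsionFreeResolution : CochainComplex (ModuleCat.{max u w} S) ℤ :=
  CochainComplex.mappingCone (freeCoverShortComplex.{u, w} K).f

/-- The augmentation of the resolution. -/
noncomputable def torsionFreeResolutionπ : torsionFreeResolution.{u, w} K ⟶ K :=
  CochainComplex.mappingCone.descShortComplex (freeCoverShortComplex.{u, w} K)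

theorem quasiIso_torsionFreeResolutionπ : QuasiIso (torsionFreeResolutionπ.{u, w} K) :=
  CochainComplex.mappingCone.quasiIso_descShortComplex
    { exact := ShortComplex.exact_kernel (freeCoverπ.{u, w} K)
      mono_f := inferInstance
      epi_g := inferInstance }

theorem mappingCone_torsionFree {F G : CochainComplex (ModuleCat.{v} S) ℤ} (φ : F ⟶ G) (f : S)
    (hF : ∀ (j : ℤ) (y : F.X j), f • y = 0 → y = 0)
    (hG : ∀ (j : ℤ) (y : G.X j), f • y = 0 → y = 0) (i : ℤ)
    (x : (CochainComplex.mappingCone φ).X i) (hx : f • x = 0) : x = 0 := by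
  have hid := CochainComplex.mappingCone.id_X φ i (i + 1) rfl
  generalize (CochainComplex.mappingCone.fst φ).1.v i (i + 1) rfl = a at hid
  generalize (CochainComplex.mappingCone.snd φ).v i i (add_zero i) = b at hid
  have ha : a.hom x = 0 := hF _ _ (by rw [← map_smul, hx, map_zero])
  have hb : b.hom x = 0 := hG _ _ (by rw [← map_smul, hx, map_zero])
  have := congrArg (fun g => g.hom x) hid
  simp only [ModuleCat.hom_add, ModuleCat.hom_comp, LinearMap.add_apply, LinearMap.comp_apply,
    ha, hb, map_zero, add_zero, ModuleCat.hom_id, LinearMap.id_apply] at this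
  exact this.symm

theorem torsionFreeResolution_torsionFree {f : S} (hf : f ∈ nonZeroDivisors S) (i : ℤ)
    (x : (torsionFreeResolution.{u, w} K).X i) (hx : f • x = 0) : x = 0 := by
  have h1 : ∀ (j : ℤ) (y : (freeCoverComplex.{u, w} K).X j), f • y = 0 → y = 0 := by
    intro j y hy
    refine Finsupp.ext fun m => ?_
    have h : f * (show FreeCover S (K.X j) from y) m = 0 :=
      congrArg (fun z : FreeCover S (K.X j) => z m) hy
    exact (mul_left_mem_nonZeroDivisors_eq_zero_iff hf).1 h
  have h2 : ∀ (j : ℤ) (y : (Limits.kernel (freeCoverπ.{u, w} K)).X j), f • y = 0 → y = 0 := by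
    intro j y hy
    have hinj := (ModuleCat.mono_iff_injective
      ((Limits.kernel.ι (freeCoverπ.{u, w} K)).f j)).1 inferInstance
    refine hinj ?_
    rw [map_zero]
    refine h1 j _ ?_
    rw [← map_smul, hy, map_zero]
  exact mappingCone_torsionFree _ f h2 h1 i x hx

/-- The derived décalage `Lη_f K = η_f P`, with `P → K` the functorial resolution of `K` by a
complex without `f`-torsion. -/
noncomputable def derivedDecalage (f : S) : CochainComplex (ModuleCat.{max u w} S) ℤ :=
  decalage.{u, w} f (torsionFreeResolution.{u, w} K)

end Resolution

/-! ### Integrality in torsion-free Λ-rings -/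

section Dwork

/-! A lift `A → B` for `A = R[x_1,…,x_d]` amounts to rank one lifts of the coordinates, so the
condition on objects of `Strat` says that the functor `pts` of rank one lifts of `(x_1,…,x_d)` has
no empty value. If objects `U n` represent the powers `pts ^ (n + 1)`, then the homotopy limit is
computed by the Čech complex `n ↦ U n`. Both complexes are compared with a double complex of
families over pairs of a chain of objects and a tuple of points of its first object: one direction
is contracted by adding a point to the tuple (`CechCover.biV_exact`), the other by prepending `U n`
to the chain (`CechCover.biH_exact`).

The arithmetic heart is the construction of `U n`. Two rank one lifts satisfy `y - x = (q - 1) z`,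
and the elements `λ^k(z)` are then quotients of `∏_{j<k} (y - q^j x)` by `∏_{j<k} (q^{j+1} - 1)`
(`LambdaRing.exists_qBinomials`); the operations `λ^k` are recovered from the Adams operations by
Dwork's lemma (`LambdaRing.dvd_psi_sub`). So the universal ring must contain these quotients. They
also suffice: evaluated at `y = q^m x` they become Gaussian binomials, triangular in `m`, whence
their span over `R[q][x]` is free and saturated (`dvd_coeff_of_dvd_sum_qBinom`,
`mem_qSpan_of_smul_mem`). Saturation makes the span a ring, and a Λ-ring; its universal property is
`QRing.exists_lift`.

For the passage to the Aomoto–Jackson complex, the operators `f ↦ (f(q y_i) - f(y_i)) / y_i` at the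
first point of `U (n + 1)` lower indices of the basis of divided products. Hence they are
surjective, and their common kernel consists of the functions independent of the first point, a copy
of `U n`: their Koszul complex resolves `U n`, which is a `q`-Poincaré lemma. In the cosimplicial
direction, the rings `U (n + 1)` with cofaces that leave the first point alone contract onto
`R[q][x]`, where the operators become `(q - 1)∇_{q,i}`. A second double complex therefore links the
Čech complex to `(Ω^*[q], (q - 1)∇_q)`.

All complexes in the zigzag are `(q - 1)`-torsion-free because the rings are flat over `R[q]`, so
décalage preserves each quasi-isomorphism (`quasiIso_decalageMap`). Finally, multiplication by `(q -
1)^n` in degree `n` identifies `q-Ω` with the décalage of the scaled complex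
(`exists_quasiIso_qOmega`). -/

theorem natCast_dvd_of_prime_pow_dvd {B : Type u} [CommRing B] {n : ℕ} (hn : n ≠ 0) {b : B}
    (h : ∀ p v : ℕ, p.Prime → p ^ (v + 1) ∣ n → ((p ^ (v + 1) : ℕ) : B) ∣ b) : (n : B) ∣ b := by
  rw [← Nat.prod_factorization_pow_eq_self hn, Finsupp.prod, Nat.cast_prod]
  refine Finset.prod_dvd_of_coprime (fun p hp q hq hpq => ?_) (fun p hp => ?_)
  · have := (Nat.coprime_primes (Nat.prime_of_mem_primeFactors hp)
      (Nat.prime_of_mem_primeFactors hq)).2 hpq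
    exact Nat.Coprime.cast (Nat.Coprime.pow _ _ this)
  · obtain ⟨v, hv⟩ := Nat.exists_eq_succ_of_ne_zero (Finsupp.mem_support_iff.1 hp)
    rw [hv]
    exact h p v (Nat.prime_of_mem_primeFactors hp) (by
      have := Nat.ordProj_dvd n p
      rwa [hv] at this)

variable {B : Type u} [CommRing B] [LambdaRing B]

theorem LambdaRing.psi_prime_toPNat' {p : ℕ} (hp : p.Prime) (a : B) :
    (p : B) ∣ psi p.toPNat' a - a ^ p := by
  have h : (p.toPNat' : ℕ) = p := by rw [Nat.toPNat'_coe, if_pos hp.pos]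
  have := LambdaRing.psi_prime p.toPNat' (h.symm ▸ hp) a
  rwa [h] at this

/-- Raising `Ψ^p(a) ≡ a^p` modulo `p` to the power `p^k` improves it to a congruence modulo
`p^{k+1}`; the factor `d` supplies the remaining `p^j`. -/
theorem LambdaRing.prime_pow_dvd_sub {p j k v : ℕ} (hp : p.Prime) (hv : p ^ j * p ^ k = p ^ v)
    (d m : ℕ) (hd : p ^ j ∣ d) (hm : p ^ k ∣ m) (a : B) :
    ((p ^ (v + 1) : ℕ) : B) ∣ (d : B) * (psi p.toPNat' a ^ m - a ^ (p * m)) := by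
  obtain ⟨d', rfl⟩ := hd
  obtain ⟨m', rfl⟩ := hm
  have h1 := dvd_sub_pow_of_dvd_sub (LambdaRing.psi_prime_toPNat' hp a) k
  obtain ⟨t, ht⟩ := h1.trans (sub_dvd_pow_sub_pow _ _ m')
  refine ⟨d' * t, ?_⟩
  rw [pow_succ, ← hv, mul_comm p (p ^ k * m'), pow_mul, mul_comm (p ^ k * m') p, pow_mul a p,
    pow_mul (a ^ p), ht]
  push_cast
  ring

/-- Dwork's lemma, the inductive step in solving the ghost equations. One prime power `p^{v+1}`
dividing `n = p m` is treated at a time: `Ψ^n(z)` is `Ψ^p` of the ghost component at `m`, which is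
then compared term by term with the sum over the proper divisors of `n`. -/
theorem LambdaRing.dvd_psi_sub {z : B} {n : ℕ} (hn : 0 < n) {a : ℕ → B}
    (ha : ∀ m, 0 < m → m < n → ∑ d ∈ m.divisors, (d : B) * a d ^ (m / d) = psi m.toPNat' z) :
    (n : B) ∣ psi n.toPNat' z - ∑ d ∈ n.properDivisors, (d : B) * a d ^ (n / d) := by
  refine natCast_dvd_of_prime_pow_dvd hn.ne' fun p v hp hpn => ?_
  obtain ⟨m, rfl⟩ : p ∣ n := (dvd_pow_self p v.succ_ne_zero).trans hpn
  have hm : 0 < m := Nat.pos_of_mul_pos_left hn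
  have hvm : p ^ v ∣ m := by
    rw [pow_succ'] at hpn
    exact Nat.dvd_of_mul_dvd_mul_left hp.pos hpn
  have hlt : m < p * m := by nlinarith [hp.two_le]
  have hpsi : psi (p * m).toPNat' z = psi p.toPNat' (psi m.toPNat' z) := by
    have : (p * m).toPNat' = p.toPNat' * m.toPNat' := PNat.eq (by
      rw [PNat.mul_coe, Nat.toPNat'_coe, Nat.toPNat'_coe, Nat.toPNat'_coe, if_pos hn,
        if_pos hp.pos, if_pos hm])
    rw [this, map_mul]
    rfl
  have hsub : m.divisors ⊆ (p * m).properDivisors := fun d hd => by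
    rw [Nat.mem_properDivisors]
    exact ⟨(Nat.dvd_of_mem_divisors hd).mul_left p, (Nat.divisor_le hd).trans_lt hlt⟩
  rw [hpsi, ← ha m hm hlt, map_sum, ← Finset.sum_sdiff hsub, sub_add_eq_sub_sub_swap,
    ← Finset.sum_sub_distrib]
  -- The first sum collects the proper divisors of `p m` that do not divide `m`, the second the
  -- differences of the terms at the divisors of `m`.
  refine dvd_sub (Finset.dvd_sum fun d hd => ?_) (Finset.dvd_sum fun d hd => ?_)
  · have hdm := Nat.dvd_of_mem_divisors hd
    obtain ⟨e, rfl⟩ := hdm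
    have hd0 : 0 < d := Nat.pos_of_mul_pos_right hm
    obtain ⟨y, w, hy, hw, hyw⟩ := (Nat.dvd_mul).1 hvm
    obtain ⟨j, -, rfl⟩ := (Nat.dvd_prime_pow hp).1 (Dvd.intro _ hyw)
    obtain ⟨k, -, rfl⟩ := (Nat.dvd_prime_pow hp).1 (Dvd.intro_left _ hyw)
    have := LambdaRing.prime_pow_dvd_sub hp hyw d e hy hw (a d)
    rw [mul_left_comm p d e, Nat.mul_div_cancel_left _ hd0, Nat.mul_div_cancel_left _ hd0,
      map_mul, map_natCast, map_pow, ← mul_sub]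
    exact this
  · rw [Finset.mem_sdiff, Nat.mem_properDivisors, Nat.mem_divisors] at hd
    obtain ⟨⟨⟨e, he⟩, -⟩, h2⟩ := hd
    refine Dvd.dvd.mul_right (Nat.cast_dvd_cast ?_) _
    -- With `p m = d e`, a factor `p` in `e` would force `d ∣ m`. So the whole power `p^{v+1}`
    -- divides `d`.
    have hpe : ¬ p ∣ e := by
      rintro ⟨e', rfl⟩
      refine h2 ⟨⟨e', Nat.eq_of_mul_eq_mul_left hp.pos ?_⟩, hm.ne'⟩
      rw [he]; ring
    rw [he] at hpn
    exact (Nat.Coprime.pow_left _ ((Nat.Prime.coprime_iff_not_dvd hp).2 hpe)).dvd_of_dvd_mul_right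
      hpn

/-- The Adams operations of an element are the ghost components of a truncated Witt vector. -/
theorem LambdaRing.exists_ghost (z : B) (N : ℕ) : ∃ a : ℕ → B, ∀ m, 0 < m → m ≤ N →
    ∑ d ∈ m.divisors, (d : B) * a d ^ (m / d) = psi m.toPNat' z := by
  induction N with
  | zero => exact ⟨0, fun m hm h => absurd h (by omega)⟩
  | succ N ih =>
    obtain ⟨a, ha⟩ := ih
    obtain ⟨t, ht⟩ := LambdaRing.dvd_psi_sub (z := z) N.succ_pos
      (fun m hm h => ha m hm (Nat.lt_succ_iff.1 h))
    -- The quotient `t` is the next Witt component, since `d = N + 1` contributes `(N + 1) t` to the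
    -- ghost component at `N + 1`. Earlier ghost components do not involve it.
    refine ⟨Function.update a (N + 1) t, fun m hm h => ?_⟩
    rcases Nat.lt_or_ge m (N + 1) with h' | h'
    · rw [← ha m hm (Nat.lt_succ_iff.1 h')]
      refine Finset.sum_congr rfl fun d hd => ?_
      rw [Function.update_of_ne ((Nat.divisor_le hd).trans_lt h').ne]
    · obtain rfl : m = N + 1 := le_antisymm h h'
      rw [← Nat.cons_self_properDivisors hm.ne', Finset.sum_cons, Function.update_self, Nat.div_self hm,
        pow_one, Finset.sum_congr rfl (g := fun d : ℕ => (d : B) * a d ^ ((N + 1) / d))]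
      · linear_combination -ht
      · intro d hd
        rw [Function.update_of_ne (Nat.mem_properDivisors.1 hd).2.ne]

end Dwork

/-! ### The λ-operations as power series, and divisibility of `q`-products -/

section Series

open PowerSeries in
/-- The series `∑_{k ≥ 1} n a^k t^{nk}`. -/
noncomputable def ghostSeries {B : Type u} [CommRing B] (a : B) (n : ℕ) : PowerSeries B :=
  PowerSeries.mk fun m => if m ≠ 0 ∧ n ∣ m then (n : B) * a ^ (m / n) else 0

theorem one_sub_mul_ghostSeries {B : Type u} [CommRing B] (a : B) {n : ℕ} (hn : 0 < n) :
    (1 - PowerSeries.C a * PowerSeries.X ^ n) * ghostSeries a n =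
      (n : PowerSeries B) * PowerSeries.C a * PowerSeries.X ^ n := by
  ext m
  have e : ((n : PowerSeries B) * PowerSeries.C a) = PowerSeries.C ((n : B) * a) := by simp
  rw [sub_mul, one_mul, map_sub, mul_assoc, PowerSeries.coeff_C_mul, e, PowerSeries.coeff_C_mul,
    PowerSeries.coeff_X_pow_mul', PowerSeries.coeff_X_pow, ghostSeries, PowerSeries.coeff_mk,
    PowerSeries.coeff_mk]
  rcases lt_trichotomy m n with h | rfl | h
  · rw [if_neg, if_neg (not_le.2 h), if_neg h.ne]
    · simp
    · rintro ⟨h1, h2⟩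
      exact absurd (Nat.le_of_dvd (Nat.pos_of_ne_zero h1) h2) (not_le.2 h)
  · simp [hn.ne', Nat.div_self hn]
  · obtain ⟨k, rfl⟩ := Nat.exists_eq_add_of_lt h
    have e2 : n + k + 1 - n = k + 1 := by omega
    rw [if_pos h.le, if_neg h.ne', e2, add_assoc]
    by_cases hd : n ∣ k + 1
    · obtain ⟨c, hc⟩ := hd
      rw [if_pos ⟨by omega, by rw [hc]; exact ⟨c + 1, by ring⟩⟩, if_pos ⟨by omega, ⟨c, hc⟩⟩, hc,
        Nat.mul_div_cancel_left _ hn, Nat.add_mul_div_left _ _ hn, Nat.div_self hn]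
      ring
    · rw [if_neg (fun h => hd ((Nat.dvd_add_right (dvd_refl n)).1 h.2)), if_neg (fun h => hd h.2)]
      simp

/-- The logarithmic derivative turns the product into a sum, and the factor at `n` contributes `-n
a_n t^n / (1 - a_n t^n)`, minus a geometric series. -/
theorem X_mul_derivative_prod {B : Type u} [CommRing B] (a : ℕ → B) (s : Finset ℕ)
    (hs : ∀ n ∈ s, 0 < n) :
    PowerSeries.X * PowerSeries.derivative B
        (∏ n ∈ s, (1 - PowerSeries.C (a n) * PowerSeries.X ^ n)) =
      - (∏ n ∈ s, (1 - PowerSeries.C (a n) * PowerSeries.X ^ n)) * ∑ n ∈ s, ghostSeries (a n) n := by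
  induction s using Finset.induction_on with
  | empty => simp
  | insert n s hn ih =>
    have hn0 : 0 < n := hs n (Finset.mem_insert_self _ _)
    obtain ⟨k, rfl⟩ := Nat.exists_eq_succ_of_ne_zero hn0.ne'
    have h := ih fun m hm => hs m (Finset.mem_insert_of_mem hm)
    have h2 := one_sub_mul_ghostSeries (a (k + 1)) hn0
    rw [Finset.prod_insert hn, Finset.sum_insert hn, Derivation.leibniz, smul_eq_mul, smul_eq_mul]
    have e : PowerSeries.X * PowerSeries.derivative B
        (1 - PowerSeries.C (a (k + 1)) * PowerSeries.X ^ (k + 1)) =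
        - (((k + 1 : ℕ) : PowerSeries B) * PowerSeries.C (a (k + 1)) * PowerSeries.X ^ (k + 1)) := by
      rw [map_sub, Derivation.leibniz, Derivation.leibniz_pow]
      simp [PowerSeries.derivative_C, PowerSeries.derivative_X]
      ring
    rw [← h2] at e
    simp only [Nat.succ_eq_add_one] at *
    generalize PowerSeries.derivative B (1 - PowerSeries.C (a (k + 1)) * PowerSeries.X ^ (k + 1)) = D at *
    linear_combination (1 - PowerSeries.C (a (k + 1)) * PowerSeries.X ^ (k + 1)) * h +
      (∏ n ∈ s, (1 - PowerSeries.C (a n) * PowerSeries.X ^ n)) * e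

theorem PowerSeries.coeff_X_mul_derivative {B : Type u} [CommRing B] (F : PowerSeries B) (k : ℕ) :
    PowerSeries.coeff k (PowerSeries.X * PowerSeries.derivative B F) =
      (k : B) * PowerSeries.coeff k F := by
  cases k with
  | zero => simp
  | succ k =>
    rw [PowerSeries.coeff_succ_X_mul, PowerSeries.coeff_derivative]
    push_cast
    ring

variable {B : Type u} [CommRing B] [LambdaRing B]

/-- As `G` has no constant term, the equation in degree `k` expresses `k F_k` through lower
coefficients of `F`, and `k` can be cancelled by torsion-freeness. -/
theorem LambdaRing.series_unique {F F' G : PowerSeries B} (N : ℕ)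
    (hG : PowerSeries.coeff 0 G = 0) (h0 : PowerSeries.coeff 0 F = PowerSeries.coeff 0 F')
    (h : ∀ k ≤ N, (k : B) * PowerSeries.coeff k F = PowerSeries.coeff k (F * G))
    (h' : ∀ k ≤ N, (k : B) * PowerSeries.coeff k F' = PowerSeries.coeff k (F' * G)) :
    ∀ k ≤ N, PowerSeries.coeff k F = PowerSeries.coeff k F' := by
  intro k
  induction k using Nat.strong_induction_on with
  | _ k ih =>
    intro hk
    rcases Nat.eq_zero_or_pos k with rfl | hk0
    · exact h0
    · have e : PowerSeries.coeff k (F * G) = PowerSeries.coeff k (F' * G) := by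
        rw [PowerSeries.coeff_mul, PowerSeries.coeff_mul]
        refine Finset.sum_congr rfl fun x hx => ?_
        rw [Finset.HasAntidiagonal.mem_antidiagonal] at hx
        rcases Nat.eq_zero_or_pos x.2 with h2 | h2
        · rw [h2, hG, mul_zero, mul_zero]
        · rw [ih x.1 (by omega) (by omega)]
      have := (h k hk).trans (e.trans (h' k hk).symm)
      refine sub_eq_zero.1 (LambdaRing.torsion_free k hk0.ne' _ ?_)
      rw [mul_sub, this, sub_self]

/-- The series `∑_{m ≥ 1} Ψ^m(z) t^m`. -/
noncomputable def adamsSeries (z : B) : PowerSeries B :=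
  PowerSeries.mk fun m => if m = 0 then 0 else psi m.toPNat' z

theorem coeff_zero_adamsSeries (z : B) : PowerSeries.coeff 0 (adamsSeries z) = 0 := by
  simp [adamsSeries]

/-- The series is `∏_{n ≤ N} (1 - a_n t^n)`, with `a` the Witt components of `z`: up to degree `N`
the coefficients of its logarithmic derivative are the negatives of the ghost components `∑_{n ∣ m}
n a_n^{m/n} = Ψ^m(z)`. Stopping at `N` keeps the product finite. -/
theorem LambdaRing.exists_truncated_series (z : B) (N : ℕ) : ∃ F : PowerSeries B,
    PowerSeries.coeff 0 F = 1 ∧ ∀ k ≤ N, (k : B) * PowerSeries.coeff k F =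
      PowerSeries.coeff k (F * -adamsSeries z) := by
  obtain ⟨a, ha⟩ := LambdaRing.exists_ghost z N
  refine ⟨∏ n ∈ Finset.Icc 1 N, (1 - PowerSeries.C (a n) * PowerSeries.X ^ n), ?_, ?_⟩
  · rw [PowerSeries.coeff_zero_eq_constantCoeff, map_prod]
    refine Finset.prod_eq_one fun n hn => ?_
    have : n ≠ 0 := by
      have := (Finset.mem_Icc.1 hn).1
      omega
    simp [this]
  · intro k hk
    rw [← PowerSeries.coeff_X_mul_derivative, X_mul_derivative_prod a _
      (fun n hn => (Finset.mem_Icc.1 hn).1), neg_mul, ← mul_neg, PowerSeries.coeff_mul,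
      PowerSeries.coeff_mul]
    refine Finset.sum_congr rfl fun x hx => ?_
    rw [Finset.HasAntidiagonal.mem_antidiagonal] at hx
    congr 1
    rw [map_neg, map_neg, map_sum, adamsSeries, PowerSeries.coeff_mk]
    congr 1
    simp only [ghostSeries, PowerSeries.coeff_mk]
    split_ifs with h0
    · simp [h0]
    · rw [← ha x.2 (Nat.pos_of_ne_zero h0) (by omega), Finset.sum_ite, Finset.sum_const_zero,
        add_zero]
      refine Finset.sum_congr ?_ fun _ _ => rfl
      ext n
      rw [Finset.mem_filter, Finset.mem_Icc, Nat.mem_divisors]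
      refine ⟨fun h => ⟨h.2.2, h0⟩, fun h => ⟨⟨Nat.pos_of_dvd_of_pos h.1 (Nat.pos_of_ne_zero h0), ?_⟩,
        h0, h.1⟩⟩
      exact (Nat.le_of_dvd (Nat.pos_of_ne_zero h0) h.1).trans (by omega)

/-- The series `λ_{-t}(z)`, with logarithmic derivative `-∑_{m ≥ 1} Ψ^m(z) t^{m-1}`. -/
theorem LambdaRing.exists_series (z : B) : ∃ F : PowerSeries B,
    PowerSeries.coeff 0 F = 1 ∧
      PowerSeries.X * PowerSeries.derivative B F = F * -adamsSeries z := by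
  choose F hF0 hF using LambdaRing.exists_truncated_series z
  have hG : PowerSeries.coeff 0 (-adamsSeries z) = 0 := by
    rw [map_neg, coeff_zero_adamsSeries, neg_zero]
  have key : ∀ k N, k ≤ N → PowerSeries.coeff k (F k) = PowerSeries.coeff k (F N) := fun k N h =>
    LambdaRing.series_unique k hG ((hF0 _).trans (hF0 _).symm) (hF k)
      (fun j hj => hF N j (hj.trans h)) k le_rfl
  -- By `key` the truncated solutions agree wherever both are valid, so their diagonal coefficients
  -- glue.
  refine ⟨PowerSeries.mk fun k => PowerSeries.coeff k (F k), by simpa using hF0 0, ?_⟩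
  ext k
  rw [PowerSeries.coeff_X_mul_derivative, PowerSeries.coeff_mk, hF k k le_rfl,
    PowerSeries.coeff_mul, PowerSeries.coeff_mul]
  refine Finset.sum_congr rfl fun x hx => ?_
  rw [Finset.HasAntidiagonal.mem_antidiagonal] at hx
  rw [PowerSeries.coeff_mk, key x.1 k (by omega)]

theorem one_sub_mul_powers {B : Type u} [CommRing B] (y : B) :
    (1 - PowerSeries.C y * PowerSeries.X) * (PowerSeries.mk fun m => if m = 0 then 0 else y ^ m) =
      PowerSeries.C y * PowerSeries.X := by
  ext m
  rw [sub_mul, one_mul, map_sub, mul_assoc, PowerSeries.coeff_C_mul, PowerSeries.coeff_C_mul,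
    PowerSeries.coeff_mk]
  cases m with
  | zero => simp
  | succ m =>
    rw [PowerSeries.coeff_succ_X_mul, PowerSeries.coeff_mk, PowerSeries.coeff_X]
    cases m with
    | zero => simp
    | succ m => simp [pow_succ']

/-- In a torsion-free Λ-ring with rank one elements `q, x, y` such that `y - x = (q - 1) z`, the
products `∏_{j < k} (y - q^j x)` are divisible by `∏_{j < k} (q^{j+1} - 1)`. -/
theorem LambdaRing.exists_qBinomials {q x y z : B} (hq : IsRankOne q) (hx : IsRankOne x)
    (hy : IsRankOne y) (hz : y - x = (q - 1) * z) : ∃ h : ℕ → B, h 0 = 1 ∧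
      ∀ k, (q ^ (k + 1) - 1) * h (k + 1) = (y - q ^ k * x) * h k := by
  obtain ⟨F, hF0, hF⟩ := LambdaRing.exists_series z
  set Y : PowerSeries B := PowerSeries.mk fun m => if m = 0 then 0 else y ^ m with hY
  set Z : PowerSeries B := PowerSeries.mk fun m => if m = 0 then 0 else x ^ m with hZ
  set g := adamsSeries z with hg
  have hres : PowerSeries.X * PowerSeries.derivative B (PowerSeries.rescale q F) =
      PowerSeries.rescale q F * -PowerSeries.rescale q g := by
    rw [← map_neg, ← map_mul, ← hF]
    ext k
    rw [PowerSeries.coeff_rescale, PowerSeries.coeff_X_mul_derivative,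
      PowerSeries.coeff_X_mul_derivative, PowerSeries.coeff_rescale]
    ring
  -- Applying `Ψ^m` to the hypothesis gives `y^m - x^m = (q^m - 1) Ψ^m(z)`.
  have hYZ : PowerSeries.rescale q g - g = Y - Z := by
    ext m
    rw [map_sub, map_sub, PowerSeries.coeff_rescale, hg, adamsSeries, hY, hZ, PowerSeries.coeff_mk,
      PowerSeries.coeff_mk, PowerSeries.coeff_mk]
    split_ifs with h
    · simp
    · have hm : (m.toPNat' : ℕ) = m := by rw [Nat.toPNat'_coe, if_pos (Nat.pos_of_ne_zero h)]
      have := congrArg (psi m.toPNat') hz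
      rw [map_sub, map_mul, map_sub, map_one, hq, hx, hy, hm] at this
      rw [this]
      ring
  have hder : ∀ (c : B) (f : PowerSeries B), PowerSeries.X * PowerSeries.derivative B
      ((1 - PowerSeries.C c * PowerSeries.X) * f) = (1 - PowerSeries.C c * PowerSeries.X) *
        (PowerSeries.X * PowerSeries.derivative B f) - PowerSeries.C c * PowerSeries.X * f := by
    intro c f
    rw [Derivation.leibniz, map_sub, Derivation.leibniz]
    simp [PowerSeries.derivative_C, PowerSeries.derivative_X]
    ring
  have h1 := hder y F
  have h2 := hder x (PowerSeries.rescale q F)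
  have hy' := one_sub_mul_powers y
  have hx' := one_sub_mul_powers x
  rw [← hY] at hy'
  rw [← hZ] at hx'
  rw [hF] at h1
  rw [hres] at h2
  -- Both sides have constant term `1` and logarithmic derivative `-(Y + g)/t`, so they coincide.
  -- This is `λ_{-t}((q-1)z) = (1 - yt)/(1 - xt)` in multiplicative form.
  have key : (1 - PowerSeries.C y * PowerSeries.X) * F =
      (1 - PowerSeries.C x * PowerSeries.X) * PowerSeries.rescale q F := by
    ext k
    refine LambdaRing.series_unique (G := -(Y + g)) k ?_ ?_ ?_ ?_ k le_rfl
    · rw [map_neg, map_add, hg, coeff_zero_adamsSeries, hY]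
      simp
    · have : PowerSeries.coeff 0 (PowerSeries.rescale q F) = 1 := by
        rw [PowerSeries.coeff_rescale, hF0, pow_zero, mul_one]
      rw [PowerSeries.coeff_zero_eq_constantCoeff_apply] at this hF0
      simp [hF0, this]
    · intro j _
      rw [← PowerSeries.coeff_X_mul_derivative, h1]
      congr 1
      linear_combination F * hy'
    · intro j _
      rw [← PowerSeries.coeff_X_mul_derivative, h2]
      congr 1
      linear_combination (-(1 - PowerSeries.C x * PowerSeries.X) * PowerSeries.rescale q F) * hYZ +
        PowerSeries.rescale q F * hx'
  -- The witness is `λ^k(z)`; the recursion is the coefficient of `t^{k+1}` in `key`.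
  refine ⟨fun k => (-1) ^ k * PowerSeries.coeff k F, by simpa using hF0, fun k => ?_⟩
  have := congrArg (PowerSeries.coeff (k + 1)) key
  rw [sub_mul, sub_mul, one_mul, one_mul, map_sub, map_sub, mul_assoc, mul_assoc,
    PowerSeries.coeff_C_mul, PowerSeries.coeff_C_mul, PowerSeries.coeff_succ_X_mul,
    PowerSeries.coeff_succ_X_mul, PowerSeries.coeff_rescale, PowerSeries.coeff_rescale] at this
  simp only [pow_succ (-1 : B)]
  linear_combination (-1) ^ k * this

end Series

/-! ### Gaussian binomials -/

section Gauss

variable (R : Type u) [CommRing R]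

/-- The polynomial `∏_{j < l} (q^m - q^j) / (q^{j+1} - 1)`. -/
noncomputable def qGauss : ℕ → ℕ → R[X]
  | _, 0 => 1
  | 0, _ + 1 => 0
  | m + 1, l + 1 => qGauss m (l + 1) + X ^ m * qGauss m l

@[simp] theorem qGauss_zero_right (m : ℕ) : qGauss R m 0 = 1 := by
  cases m <;> rw [qGauss]

theorem qGauss_succ_succ (m l : ℕ) :
    qGauss R (m + 1) (l + 1) = qGauss R m (l + 1) + X ^ m * qGauss R m l := by
  rw [qGauss]

/-- The recursive definition makes integrality evident; this identity shows that it produces the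
intended quotient. -/
theorem qGauss_mul (m l : ℕ) :
    (X ^ (l + 1) - 1) * qGauss R m (l + 1) = (X ^ m - X ^ l) * qGauss R m l := by
  induction m generalizing l with
  | zero => cases l <;> simp [qGauss]
  | succ m ih =>
    have h1 := ih l
    cases l with
    | zero =>
      simp only [qGauss_succ_succ, qGauss_zero_right] at h1 ⊢
      linear_combination h1
    | succ l =>
      have h2 := ih l
      rw [qGauss_succ_succ, qGauss_succ_succ]
      linear_combination h1 + X ^ (m + 1) * h2

theorem qGauss_eq_zero {m l : ℕ} (h : m < l) : qGauss R m l = 0 := by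
  induction m generalizing l with
  | zero =>
    obtain ⟨l, rfl⟩ := Nat.exists_eq_succ_of_ne_zero h.ne'
    rw [qGauss]
  | succ m ih =>
    obtain ⟨l, rfl⟩ := Nat.exists_eq_succ_of_ne_zero (show l ≠ 0 by omega)
    rw [Nat.succ_eq_add_one, qGauss_succ_succ, ih (by omega), ih (by omega), mul_zero, add_zero]

/-- The diagonal value need not be a unit of `R[q]`, but it is a power of `q`; hence the repeated
hypothesis `s ∣ X * g → s ∣ g` on denominators below. The exponent plays no role. -/
theorem exists_qGauss_self (l : ℕ) : ∃ e : ℕ, qGauss R l l = X ^ e := by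
  induction l with
  | zero => exact ⟨0, by simp⟩
  | succ l ih =>
    obtain ⟨e, he⟩ := ih
    exact ⟨l + e, by rw [qGauss_succ_succ, qGauss_eq_zero R l.lt_succ_self, he, zero_add, pow_add]⟩

/-- The multiplicative set generated by the polynomials `q^j - 1`, `j ≥ 1`. -/
noncomputable def qMonoid : Submonoid R[X] := Submonoid.closure (Set.range fun j : ℕ => X ^ (j + 1) - 1)

variable {R}

theorem X_pow_sub_one_mem_qMonoid (j : ℕ) : (X ^ (j + 1) - 1 : R[X]) ∈ qMonoid R :=
  Submonoid.subset_closure ⟨j, rfl⟩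

theorem qMonoid_le_nonZeroDivisors : qMonoid R ≤ nonZeroDivisors R[X] := by
  rw [qMonoid, Submonoid.closure_le]
  rintro _ ⟨j, rfl⟩
  have : (X ^ (j + 1) - C 1 : R[X]).Monic := monic_X_pow_sub_C 1 j.succ_ne_zero
  simpa using this.mem_nonZeroDivisors

/-- Modulo `q^{j+1} - 1` the element `q` is invertible, with inverse `q^j`. For products of such
polynomials the factors are divided out one at a time. -/
theorem dvd_of_dvd_X_mul_of_mem_qMonoid {s : R[X]} (hs : s ∈ qMonoid R) :
    ∀ g, s ∣ X * g → s ∣ g := by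
  induction hs using Submonoid.closure_induction with
  | mem s hs =>
    obtain ⟨j, rfl⟩ := hs
    intro g hg
    have h1 : (X ^ (j + 1) - 1 : R[X]) ∣ X ^ j * (X * g) := hg.mul_left _
    have h2 : (X ^ (j + 1) - 1 : R[X]) ∣ (X ^ (j + 1) - 1) * g := Dvd.intro _ rfl
    have := dvd_sub h1 h2
    ring_nf at this ⊢
    exact this
  | one => exact fun g _ => one_dvd g
  | mul s t hs ht ihs iht =>
    rintro g ⟨h, hh⟩
    obtain ⟨g', rfl⟩ := ihs g ⟨t * h, by rw [hh, mul_assoc]⟩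
    refine mul_dvd_mul_left s (iht g' ⟨h, ?_⟩)
    refine (mul_cancel_left_mem_nonZeroDivisors (qMonoid_le_nonZeroDivisors hs)).1 ?_
    linear_combination hh

theorem dvd_of_dvd_X_mul_natCast (n : ℕ) (g : R[X]) (h : (n : R[X]) ∣ X * g) : (n : R[X]) ∣ g := by
  rw [← C_eq_natCast, C_dvd_iff_dvd_coeff] at h ⊢
  intro i
  simpa using h (i + 1)

theorem psi_mem_qMonoid [LambdaRing R] {s : R[X]} (hs : s ∈ qMonoid R) (n : ℕ+) :
    psi n s ∈ qMonoid R := by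
  induction hs using Submonoid.closure_induction with
  | mem s hs =>
    obtain ⟨j, rfl⟩ := hs
    obtain ⟨k, hk⟩ := Nat.exists_eq_succ_of_ne_zero (Nat.mul_ne_zero n.ne_zero j.succ_ne_zero)
    rw [map_sub, map_one, map_pow, Polynomial.isRankOne_X n, ← pow_mul, ← Nat.succ_eq_add_one, hk]
    exact X_pow_sub_one_mem_qMonoid k
  | one => rw [map_one]; exact one_mem _
  | mul s t hs ht ihs iht => rw [map_mul]; exact mul_mem ihs iht

theorem MvPolynomial.C_dvd_of_dvd_C_X_mul {σ : Type v} {s : R[X]}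
    (hs : ∀ g, s ∣ Polynomial.X * g → s ∣ g)
    {f : MvPolynomial σ R[X]} (h : MvPolynomial.C s ∣ MvPolynomial.C Polynomial.X * f) :
    MvPolynomial.C s ∣ f := by
  rw [MvPolynomial.C_dvd_iff_dvd_coeff] at h ⊢
  intro m
  have := h m
  rw [MvPolynomial.coeff_C_mul] at this
  exact hs _ this

theorem MvPolynomial.C_dvd_of_dvd_X_mul {σ : Type v} {S : Type u} [CommRing S] {s : S} {i : σ}
    {f : MvPolynomial σ S} (h : MvPolynomial.C s ∣ MvPolynomial.X i * f) :
    MvPolynomial.C s ∣ f := by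
  rw [MvPolynomial.C_dvd_iff_dvd_coeff] at h ⊢
  intro m
  have := h (Finsupp.single i 1 + m)
  rwa [MvPolynomial.coeff_X_mul] at this

theorem MvPolynomial.C_mul_eq_zero {σ : Type v} {S : Type u} [CommRing S] {s : S}
    (hs : s ∈ nonZeroDivisors S) {f : MvPolynomial σ S} (h : MvPolynomial.C s * f = 0) : f = 0 := by
  ext m
  have := congrArg (MvPolynomial.coeff m) h
  rw [MvPolynomial.coeff_C_mul, MvPolynomial.coeff_zero] at this
  rw [MvPolynomial.coeff_zero]
  exact (mul_left_mem_nonZeroDivisors_eq_zero_iff hs).1 this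

end Gauss

/-! ### The ring of `q`-integer-valued functions -/

section Model

variable (R : Type u) [CommRing R] {d : ℕ} {ι : Type} [Fintype ι] (c : ι → Fin d)

/-- Functions on `ℕ^ι` with values in `R[q][x_1,…,x_d]`. -/
abbrev QFun (R : Type u) [CommRing R] (d : ℕ) (ι : Type) : Type u :=
  (ι → ℕ) → MvPolynomial (Fin d) R[X]

/-- The function `m ↦ q^{m_a} x_{c(a)}`. -/
noncomputable def qPower (a : ι) : QFun R d ι :=
  fun m => MvPolynomial.C (X ^ m a) * MvPolynomial.X (c a)

/-- The product over `a` of `∏_{j < k_a} (y_a - q^j x_{c(a)}) / (q^{j+1} - 1)`, as a function with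
`y_a = q^{m_a} x_{c(a)}`. -/
noncomputable def qBinom (k : ι → ℕ) : QFun R d ι :=
  fun m => ∏ a, (MvPolynomial.C (qGauss R (m a) (k a)) * MvPolynomial.X (c a) ^ k a)

variable {R c}

/-- Triangularity for the product order on `ι → ℕ`: this, with the shape of the diagonal values,
drives the Newton interpolation below. -/
theorem qBinom_eq_zero {k m : ι → ℕ} (h : ¬ k ≤ m) : qBinom R c k m = 0 := by
  rw [Pi.le_def, not_forall] at h
  obtain ⟨a, ha⟩ := h
  refine Finset.prod_eq_zero (Finset.mem_univ a) ?_
  rw [qGauss_eq_zero R (not_le.1 ha), map_zero, zero_mul]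

/-- The diagonal value is a product of powers of `q` and of the variables `x_i`. Powers of `q`
cancel by `hs`, and variables cancel for any constant `s`. -/
theorem dvd_of_dvd_mul_qBinom_self {s : R[X]} (hs : ∀ g, s ∣ X * g → s ∣ g) (k : ι → ℕ)
    {f : MvPolynomial (Fin d) R[X]} (h : MvPolynomial.C s ∣ qBinom R c k k * f) :
    MvPolynomial.C s ∣ f := by
  rw [qBinom] at h
  generalize (Finset.univ : Finset ι) = t at h
  classical
  induction t using Finset.induction_on with
  | empty => simpa using h
  | insert a t ha ih =>
    refine ih ?_
    obtain ⟨e, he⟩ := exists_qGauss_self R (k a)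
    rw [Finset.prod_insert ha, he, mul_assoc, mul_assoc] at h
    generalize (∏ x ∈ t, MvPolynomial.C (qGauss R (k x) (k x)) * MvPolynomial.X (c x) ^ k x) * f
      = g at h ⊢
    have h2 : MvPolynomial.C s ∣ MvPolynomial.X (c a) ^ k a * g := by
      clear he
      generalize MvPolynomial.X (c a) ^ k a * g = g' at h ⊢
      induction e with
      | zero => simpa using h
      | succ e ihe =>
        refine ihe (MvPolynomial.C_dvd_of_dvd_C_X_mul hs ?_)
        rw [← mul_assoc, ← map_mul, ← pow_succ']
        exact h
    clear h
    generalize k a = n at h2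
    induction n with
    | zero => simpa using h2
    | succ n ihn =>
      refine ihn (MvPolynomial.C_dvd_of_dvd_X_mul (i := c a) ?_)
      rwa [← mul_assoc, ← pow_succ']

/-- Newton interpolation: evaluating at `m = k` kills the terms with `l ≰ k`, the terms with `l < k`
are divisible by induction, and the diagonal term can be cancelled. The case `s = 0` is linear
independence; regular `s` give saturation of the span. -/
theorem dvd_coeff_of_dvd_sum_qBinom {s : R[X]} (hs : ∀ g, s ∣ X * g → s ∣ g)
    (e : (ι → ℕ) →₀ MvPolynomial (Fin d) R[X])
    (h : ∀ m, MvPolynomial.C s ∣ (e.sum fun k a => a • qBinom R c k) m) (k : ι → ℕ) :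
    MvPolynomial.C s ∣ e k := by
  classical
  induction k using WellFoundedLT.induction with
  | _ k ih =>
    refine dvd_of_dvd_mul_qBinom_self (c := c) hs k ?_
    have h1 := h k
    rw [Finsupp.sum, Finset.sum_apply] at h1
    by_cases hk : k ∈ e.support
    · rw [← Finset.add_sum_erase _ _ hk] at h1
      refine (dvd_add_left (Finset.dvd_sum fun l hl => ?_)).1 (by
        simpa only [Pi.smul_apply, smul_eq_mul, mul_comm] using h1)
      rw [Finset.mem_erase] at hl
      by_cases hlk : l ≤ k
      · exact (ih l (lt_of_le_of_ne hlk hl.1)).mul_left _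
      · rw [qBinom_eq_zero hlk, zero_mul]
        exact dvd_zero _
    · rw [Finsupp.notMem_support_iff.1 hk, mul_zero]
      exact dvd_zero _

variable (R c)

theorem linearIndependent_qBinom :
    LinearIndependent (MvPolynomial (Fin d) R[X]) (qBinom R c) := by
  rw [linearIndependent_iff]
  intro e he
  ext k : 1
  rw [Finsupp.linearCombination_apply] at he
  -- Divisibility by `0` means vanishing, and `q` is a non-zero-divisor.
  have := dvd_coeff_of_dvd_sum_qBinom (c := c) (s := 0) (fun g hg => by
    rw [zero_dvd_iff] at hg ⊢
    exact (mul_left_mem_nonZeroDivisors_eq_zero_iff (Polynomial.X_mem_nonzeroDivisors)).1 hg) e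
    (fun m => by rw [he]; exact dvd_zero _) k
  rwa [map_zero, zero_dvd_iff] at this

/-- The span of the functions `qBinom`. -/
noncomputable def qSpan : Submodule (MvPolynomial (Fin d) R[X]) (QFun R d ι) :=
  Submodule.span _ (Set.range (qBinom R c))

variable {R c}

theorem qBinom_mem_qSpan (k : ι → ℕ) : qBinom R c k ∈ qSpan R c :=
  Submodule.subset_span ⟨k, rfl⟩

/-- Saturation: the coefficients of `s f` are themselves divisible by `s`. Structure on the span can
thus be built after clearing denominators. -/
theorem mem_qSpan_of_smul_mem {s : R[X]} (hs : ∀ g, s ∣ X * g → s ∣ g)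
    (hs' : s ∈ nonZeroDivisors R[X]) {f : QFun R d ι}
    (hf : (MvPolynomial.C s : MvPolynomial (Fin d) R[X]) • f ∈ qSpan R c) : f ∈ qSpan R c := by
  rw [qSpan, Finsupp.mem_span_range_iff_exists_finsupp] at hf
  obtain ⟨e, he⟩ := hf
  choose g hg using dvd_coeff_of_dvd_sum_qBinom (c := c) hs e (fun m => by
    rw [he]; exact Dvd.intro _ rfl)
  have : f = ∑ k ∈ e.support, g k • qBinom R c k := by
    refine sub_eq_zero.1 (funext fun m => MvPolynomial.C_mul_eq_zero hs' ?_)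
    have h2 := congrFun he m
    rw [Finsupp.sum, Finset.sum_apply] at h2
    simp only [Pi.smul_apply, hg, smul_eq_mul] at h2
    rw [Pi.sub_apply, mul_sub, ← h2, Finset.sum_apply, Finset.mul_sum, sub_eq_zero]
    exact Finset.sum_congr rfl fun k _ => by rw [Pi.smul_apply, smul_eq_mul, mul_assoc]
  rw [this]
  exact Submodule.sum_mem _ fun k _ => Submodule.smul_mem _ _ (qBinom_mem_qSpan k)

variable (R c)

/-- Polynomials in the functions `q^{m_a} x_{c(a)}`. -/
noncomputable def qEval : MvPolynomial ι (MvPolynomial (Fin d) R[X]) →ₐ[MvPolynomial (Fin d) R[X]]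
    QFun R d ι :=
  MvPolynomial.aeval (qPower R c)

/-- The polynomial `∏_{j < n} (y - q^j x)`. -/
noncomputable def qFall {B : Type v} [CommRing B] (q x y : B) (n : ℕ) : B :=
  ∏ j ∈ Finset.range n, (y - q ^ j * x)

/-- The polynomial `∏_{j < n} (q^{j+1} - 1)`. -/
noncomputable def qFact (n : ℕ) : R[X] := ∏ j ∈ Finset.range n, (X ^ (j + 1) - 1)

/-- The product over `a` of `∏_{j < k_a} (y_a - q^j x_{c(a)})`, as a polynomial. -/
noncomputable def qNewton (k : ι → ℕ) : MvPolynomial ι (MvPolynomial (Fin d) R[X]) :=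
  ∏ a, qFall (MvPolynomial.C (MvPolynomial.C X)) (MvPolynomial.C (MvPolynomial.X (c a)))
    (MvPolynomial.X a) (k a)

/-- The common denominator of `qBinom`. -/
noncomputable def qDenom (k : ι → ℕ) : R[X] := ∏ a, qFact R (k a)

variable {R} in
theorem qFact_mem (n : ℕ) : qFact R n ∈ qMonoid R :=
  prod_mem fun j _ => X_pow_sub_one_mem_qMonoid j

variable {R} in
theorem qDenom_mem (k : ι → ℕ) : qDenom R k ∈ qMonoid R :=
  prod_mem fun _ _ => qFact_mem _

theorem qFact_succ (n : ℕ) : qFact R (n + 1) = qFact R n * (X ^ (n + 1) - 1) := by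
  rw [qFact, Finset.prod_range_succ, ← qFact]

theorem qFall_succ {B : Type v} [CommRing B] (q x y : B) (n : ℕ) :
    qFall q x y (n + 1) = qFall q x y n * (y - q ^ n * x) := by
  rw [qFall, Finset.prod_range_succ, ← qFall]

theorem map_qFall {B : Type v} {B' : Type w} [CommRing B] [CommRing B'] {F : Type*} [FunLike F B B']
    [RingHomClass F B B'] (f : F) (q x y : B) (n : ℕ) : f (qFall q x y n) = qFall (f q) (f x) (f y) n := by
  simp [qFall]

theorem qFall_qGauss (x : MvPolynomial (Fin d) R[X]) (m n : ℕ) :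
    qFall (MvPolynomial.C X) x (MvPolynomial.C (X ^ m) * x) n =
      MvPolynomial.C (qFact R n) * (MvPolynomial.C (qGauss R m n) * x ^ n) := by
  induction n with
  | zero => simp [qFall, qFact]
  | succ n ih =>
    have h := congrArg (MvPolynomial.C (σ := Fin d)) (qGauss_mul R m n)
    rw [qFall_succ, ih, qFact_succ, pow_succ x]
    simp only [map_mul, map_sub, map_pow, map_one] at h ⊢
    linear_combination - MvPolynomial.C (qFact R n) * x ^ n * x * h

/-- At `y_a = q^{m_a} x_{c(a)}` the factor `y_a - q^j x_{c(a)}` is `(q^{m_a} - q^j) x_{c(a)}`, the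
numerator of `qGauss`. -/
theorem qEval_qNewton (k : ι → ℕ) : qEval R c (qNewton R c k) =
    (MvPolynomial.C (qDenom R k) : MvPolynomial (Fin d) R[X]) • qBinom R c k := by
  funext m
  have e : ∀ F, qEval R c F m = MvPolynomial.aeval (fun a => qPower R c a m) F := fun F => by
    have : (Pi.evalAlgHom (MvPolynomial (Fin d) R[X]) (fun _ : ι → ℕ =>
        MvPolynomial (Fin d) R[X]) m).comp (qEval R c) =
        MvPolynomial.aeval (fun a => qPower R c a m) := by
      ext a : 1
      simp [qEval]
    exact DFunLike.congr_fun this F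
  rw [e, qNewton, map_prod, Pi.smul_apply, qBinom, smul_eq_mul, qDenom, map_prod,
    ← Finset.prod_mul_distrib]
  refine Finset.prod_congr rfl fun a _ => ?_
  rw [← qFall_qGauss, map_qFall]
  simp [qPower]

/-- This is `y_a = (y_a - q^{k_a} x_{c(a)}) + q^{k_a} x_{c(a)}`; it makes the span of the Newton
products stable under multiplication by the variables. -/
theorem qNewton_mul_X (k : ι → ℕ) (a : ι) [DecidableEq ι] : qNewton R c k * MvPolynomial.X a =
    qNewton R c (Function.update k a (k a + 1)) +
      (MvPolynomial.C (X ^ k a) * MvPolynomial.X (c a) : MvPolynomial (Fin d) R[X]) •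
        qNewton R c k := by
  rw [qNewton, qNewton, ← Finset.mul_prod_erase _ _ (Finset.mem_univ a),
    ← Finset.mul_prod_erase _ _ (Finset.mem_univ a)]
  have : ∏ b ∈ Finset.univ.erase a, qFall (MvPolynomial.C (MvPolynomial.C (X : R[X])))
      (MvPolynomial.C (MvPolynomial.X (c b))) (MvPolynomial.X b) (Function.update k a (k a + 1) b)
      = ∏ b ∈ Finset.univ.erase a, qFall (MvPolynomial.C (MvPolynomial.C (X : R[X])))
      (MvPolynomial.C (MvPolynomial.X (c b))) (MvPolynomial.X b) (k b) :=
    Finset.prod_congr rfl fun b hb => by rw [Function.update_of_ne (Finset.ne_of_mem_erase hb)]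
  rw [this, Function.update_self]
  rw [qFall_succ, MvPolynomial.smul_eq_C_mul, map_mul, map_pow, map_pow]
  ring

theorem span_qNewton : Submodule.span (MvPolynomial (Fin d) R[X]) (Set.range (qNewton R c)) = ⊤ := by
  classical
  rw [eq_top_iff]
  rintro F -
  induction F using MvPolynomial.induction_on with
  | C p =>
    have : (MvPolynomial.C p : MvPolynomial ι (MvPolynomial (Fin d) R[X])) =
        p • qNewton R c 0 := by
      rw [MvPolynomial.smul_eq_C_mul]
      simp [qNewton, qFall]
    rw [this]
    exact Submodule.smul_mem _ _ (Submodule.subset_span ⟨0, rfl⟩)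
  | add F G hF hG => exact Submodule.add_mem _ hF hG
  | mul_X F a hF =>
    induction hF using Submodule.span_induction with
    | mem F hF =>
      obtain ⟨k, rfl⟩ := hF
      rw [qNewton_mul_X]
      exact Submodule.add_mem _ (Submodule.subset_span ⟨_, rfl⟩)
        (Submodule.smul_mem _ _ (Submodule.subset_span ⟨_, rfl⟩))
    | zero => rw [zero_mul]; exact Submodule.zero_mem _
    | add F G _ _ hF hG => rw [add_mul]; exact Submodule.add_mem _ hF hG
    | smul p F _ hF => rw [smul_mul_assoc]; exact Submodule.smul_mem _ _ hF

theorem qEval_mem (F : MvPolynomial ι (MvPolynomial (Fin d) R[X])) : qEval R c F ∈ qSpan R c := by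
  have : F ∈ Submodule.span (MvPolynomial (Fin d) R[X]) (Set.range (qNewton R c)) := by
    rw [span_qNewton]; trivial
  induction this using Submodule.span_induction with
  | mem F hF =>
    obtain ⟨k, rfl⟩ := hF
    rw [qEval_qNewton]
    exact Submodule.smul_mem _ _ (qBinom_mem_qSpan k)
  | zero => rw [map_zero]; exact Submodule.zero_mem _
  | add F G _ _ hF hG => rw [map_add]; exact Submodule.add_mem _ hF hG
  | smul p F _ hF => rw [map_smul]; exact Submodule.smul_mem _ _ hF

variable {R c}

/-- Up to a denominator in `qMonoid`, every element of the span is a polynomial in the `y_a`.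
Together with saturation this reduces statements about the span to statements about polynomials. -/
theorem exists_smul_eq_qEval {f : QFun R d ι} (hf : f ∈ qSpan R c) : ∃ s ∈ qMonoid R, ∃ F,
    (MvPolynomial.C s : MvPolynomial (Fin d) R[X]) • f = qEval R c F := by
  induction hf using Submodule.span_induction with
  | mem f hf =>
    obtain ⟨k, rfl⟩ := hf
    exact ⟨qDenom R k, qDenom_mem k, qNewton R c k, (qEval_qNewton R c k).symm⟩
  | zero => exact ⟨1, one_mem _, 0, by simp⟩
  | add f g _ _ hf hg =>
    obtain ⟨s, hs, F, hF⟩ := hf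
    obtain ⟨t, ht, G, hG⟩ := hg
    refine ⟨s * t, mul_mem hs ht, (MvPolynomial.C t : MvPolynomial (Fin d) R[X]) • F +
      (MvPolynomial.C s : MvPolynomial (Fin d) R[X]) • G, ?_⟩
    rw [map_add, map_smul, map_smul, ← hF, ← hG, smul_smul, smul_smul, smul_add, map_mul,
      mul_comm (MvPolynomial.C t)]
  | smul p f _ hf =>
    obtain ⟨s, hs, F, hF⟩ := hf
    exact ⟨s, hs, p • F, by rw [map_smul, ← hF, smul_comm]⟩

theorem mem_qSpan_of_mem_qMonoid {s : R[X]} (hs : s ∈ qMonoid R) {f : QFun R d ι}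
    (hf : (MvPolynomial.C s : MvPolynomial (Fin d) R[X]) • f ∈ qSpan R c) : f ∈ qSpan R c :=
  mem_qSpan_of_smul_mem (dvd_of_dvd_X_mul_of_mem_qMonoid hs) (qMonoid_le_nonZeroDivisors hs) hf

variable (R c)

/-- The ring of `q`-integer-valued functions: the span of the functions `qBinom`. -/
noncomputable def qRing : Subalgebra (MvPolynomial (Fin d) R[X]) (QFun R d ι) :=
  (qSpan R c).toSubalgebra (by simpa using qEval_mem R c 1) (by
    intro f g hf hg
    obtain ⟨s, hs, F, hF⟩ := exists_smul_eq_qEval hf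
    obtain ⟨t, ht, G, hG⟩ := exists_smul_eq_qEval hg
    -- After clearing denominators the product is a polynomial, hence in the span; saturation
    -- removes the denominators again.
    refine mem_qSpan_of_mem_qMonoid (mul_mem hs ht) ?_
    rw [map_mul, ← smul_mul_smul_comm, hF, hG, ← map_mul]
    exact qEval_mem R c _)

end Model

/-! ### The Λ-ring structure and the universal property of the model -/

section ModelLambda

/-- Polynomials over `R[q][x_1,…,x_d]` in variables indexed by `ι`. -/
abbrev QPoly (R : Type u) [CommRing R] (d : ℕ) (ι : Type) : Type u :=
  MvPolynomial ι (MvPolynomial (Fin d) R[X])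

variable {R : Type u} [CommRing R] {d : ℕ} {ι : Type} [Fintype ι] {c : ι → Fin d}

variable (R c)

/-- The ring `qRing` as a type. -/
def QRing : Type u := qRing R c

namespace QRing

noncomputable instance : CommRing (QRing R c) := inferInstanceAs (CommRing (qRing R c))

noncomputable instance : Algebra (MvPolynomial (Fin d) R[X]) (QRing R c) :=
  inferInstanceAs (Algebra (MvPolynomial (Fin d) R[X]) (qRing R c))

noncomputable instance : Algebra R[X] (QRing R c) := inferInstanceAs (Algebra R[X] (qRing R c))

instance : IsScalarTower R[X] (MvPolynomial (Fin d) R[X]) (QRing R c) :=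
  inferInstanceAs (IsScalarTower R[X] (MvPolynomial (Fin d) R[X]) (qRing R c))

/-- The inclusion of `QRing` into functions. -/
noncomputable def val : QRing R c →ₐ[MvPolynomial (Fin d) R[X]] QFun R d ι := (qRing R c).val

variable {R c}

/-- A function in the span of the `qBinom` as an element of `QRing`. -/
def mk (f : QFun R d ι) (hf : f ∈ qSpan R c) : QRing R c := ⟨f, hf⟩

@[simp] theorem val_mk (f : QFun R d ι) (hf : f ∈ qSpan R c) : val R c (mk f hf) = f := rfl

theorem val_mem (f : QRing R c) : val R c f ∈ qSpan R c := f.2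

theorem val_injective : Function.Injective (val R c) := Subtype.val_injective

@[ext] theorem ext {f g : QRing R c} (h : ∀ m, val R c f m = val R c g m) : f = g :=
  val_injective (funext h)

theorem val_smul (s : R[X]) (f : QRing R c) (m : ι → ℕ) :
    val R c (s • f) m = MvPolynomial.C s * val R c f m := by
  rw [← algebraMap_smul (MvPolynomial (Fin d) R[X]) s f, map_smul]
  rfl

theorem val_algebraMap (s : R[X]) (m : ι → ℕ) :
    val R c (algebraMap R[X] (QRing R c) s) m = MvPolynomial.C s := by
  rw [Algebra.algebraMap_eq_smul_one, val_smul, map_one, Pi.one_apply, mul_one]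

variable (R c)

/-- The functions `qBinom` as a basis of `QRing`. -/
noncomputable def basis : Module.Basis (ι → ℕ) (MvPolynomial (Fin d) R[X]) (QRing R c) :=
  Module.Basis.mk (v := fun k => mk (qBinom R c k) (qBinom_mem_qSpan k))
    (LinearIndependent.of_comp (val R c).toLinearMap (linearIndependent_qBinom R c)) (by
      intro x _
      have h : val R c x ∈ Submodule.map (val R c).toLinearMap (Submodule.span _
          (Set.range fun k => mk (qBinom R c k) (qBinom_mem_qSpan k))) := by
        rw [Submodule.map_span, ← Set.range_comp]
        exact val_mem x
      obtain ⟨y, hy, e⟩ := h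
      rwa [← val_injective e])

theorem val_basis (k : ι → ℕ) : val R c (basis R c k) = qBinom R c k := by
  rw [basis, Module.Basis.mk_apply, val_mk]

instance : Module.Flat R[X] (QRing R c) := by
  have : Module.Free (MvPolynomial (Fin d) R[X]) (QRing R c) := .of_basis (basis R c)
  exact Module.Flat.trans R[X] (MvPolynomial (Fin d) R[X]) (QRing R c)

/-- The base point `x_i` of `QRing`. -/
noncomputable def base (i : Fin d) : QRing R c :=
  algebraMap (MvPolynomial (Fin d) R[X]) (QRing R c) (MvPolynomial.X i)

/-- The element `y_a` of `QRing`. -/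
noncomputable def pt (a : ι) : QRing R c :=
  mk (qPower R c a) (by simpa [qEval] using qEval_mem R c (MvPolynomial.X a))

theorem val_base (i : Fin d) (m : ι → ℕ) : val R c (base R c i) m = MvPolynomial.X i := by
  rw [base, AlgHom.commutes]
  rfl

theorem val_pt (a : ι) (m : ι → ℕ) :
    val R c (pt R c a) m = MvPolynomial.C (X ^ m a) * MvPolynomial.X (c a) := rfl

/-- Polynomials in the `y_a` as elements of `QRing`. -/
noncomputable def eval : QPoly R d ι →ₐ[MvPolynomial (Fin d) R[X]] QRing R c :=
  MvPolynomial.aeval (pt R c)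

theorem val_eval (F : QPoly R d ι) : val R c (eval R c F) = qEval R c F := by
  have : (val R c).comp (eval R c) = qEval R c := by
    ext a : 1
    rw [AlgHom.comp_apply, eval, qEval, MvPolynomial.aeval_X, MvPolynomial.aeval_X]
    rfl
  exact DFunLike.congr_fun this F

theorem eval_qNewton (k : ι → ℕ) : eval R c (qNewton R c k) =
    (MvPolynomial.C (qDenom R k) : MvPolynomial (Fin d) R[X]) • basis R c k := by
  refine val_injective ?_
  rw [val_eval, qEval_qNewton, ← val_basis, map_smul]

variable {R c}

theorem exists_smul_eq_eval (f : QRing R c) : ∃ s ∈ qMonoid R, ∃ F, s • f = eval R c F := by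
  obtain ⟨s, hs, F, hF⟩ := exists_smul_eq_qEval (val_mem f)
  refine ⟨s, hs, F, ext fun m => ?_⟩
  rw [val_eval, ← hF, val_smul]
  rfl

theorem exists_pt_sub_base (a : ι) : ∃ z : QRing R c,
    pt R c a - base R c (c a) = algebraMap R[X] (QRing R c) (X - 1) * z := by
  classical
  refine ⟨basis R c (Pi.single a 1), ext fun m => ?_⟩
  have h2 : qGauss R (m a) 1 * (X - 1) = X ^ m a - 1 := by
    simpa [mul_comm] using qGauss_mul R (m a) 0
  have h : qBinom R c (Pi.single a 1) m =
      MvPolynomial.C (qGauss R (m a) 1) * MvPolynomial.X (c a) := by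
    rw [qBinom, Finset.prod_eq_single a]
    · simp
    · intro b _ hb
      simp [hb]
    · simp
  rw [map_sub, map_mul, Pi.sub_apply, Pi.mul_apply, val_pt, val_base, val_algebraMap, val_basis, h,
    ← mul_assoc, ← map_mul, mul_comm (X - 1), h2, map_sub, map_one]
  ring

/-- Two algebra maps out of `QRing` agree if they agree on the points. -/
theorem algHom_ext {B : Type v} [CommRing B] [Algebra R[X] B]
    (hB : ∀ s ∈ qMonoid R, ∀ b : B, s • b = 0 → b = 0) {f g : QRing R c →ₐ[R[X]] B}
    (h0 : ∀ i, f (base R c i) = g (base R c i))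
    (h : ∀ a, f (pt R c a) = g (pt R c a)) : f = g := by
  have key : f.toRingHom.comp (eval R c).toRingHom = g.toRingHom.comp (eval R c).toRingHom := by
    refine MvPolynomial.ringHom_ext (fun p => ?_) (fun a => ?_)
    · have : (f.comp (IsScalarTower.toAlgHom R[X] (MvPolynomial (Fin d) R[X]) (QRing R c))) =
          g.comp (IsScalarTower.toAlgHom R[X] (MvPolynomial (Fin d) R[X]) (QRing R c)) :=
        MvPolynomial.algHom_ext h0
      simpa [eval] using DFunLike.congr_fun this p
    · simpa [eval] using h a
  ext x
  obtain ⟨s, hs, F, hF⟩ := exists_smul_eq_eval x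
  refine sub_eq_zero.1 (hB s hs _ ?_)
  rw [smul_sub, ← map_smul, ← map_smul, hF, sub_eq_zero]
  exact DFunLike.congr_fun key F

end QRing

theorem smul_eq_zero_of_flat {S : Type u} [CommRing S] {B : Type v} [AddCommGroup B] [Module S B]
    [Module.Flat S B] {s : S} (hs : s ∈ nonZeroDivisors S) (b : B) (hb : s • b = 0) : b = 0 :=
  (Module.Flat.isSMulRegular_of_nonZeroDivisors hs).right_eq_zero_of_smul hb

variable {R c} [LambdaRing R]

theorem psi_C (n : ℕ+) (s : R[X]) :
    (psi n : MvPolynomial (Fin d) R[X] →+* _) (MvPolynomial.C s) = MvPolynomial.C (psi n s) :=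
  ((MvPolynomial.instLambdaAlgebra (R := R[X])).isLambdaHom n _).symm

theorem psi_qPower {ι : Type} {c : ι → Fin d} (n : ℕ+) (a : ι) (m : ι → ℕ) :
    (psi n : MvPolynomial (Fin d) R[X] →+* _) (qPower R c a m) = qPower R c a m ^ (n : ℕ) := by
  rw [qPower, map_mul, psi_C, map_pow, Polynomial.isRankOne_X n, MvPolynomial.isRankOne_X _ n,
    mul_pow, ← map_pow, ← pow_mul, ← pow_mul, mul_comm (n : ℕ)]

/-- `Ψ^n` acts on coefficients and raises each `y_a` to the power `n`, so polynomials in the `y_a`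
stay polynomials. -/
theorem exists_psi_qEval {ι : Type} {c : ι → Fin d} (n : ℕ+) (F : QPoly R d ι) : ∃ G : QPoly R d ι,
    (psi n : MvPolynomial (Fin d) R[X] →+* _).compLeft (ι → ℕ) (qEval R c F) = qEval R c G := by
  induction F using MvPolynomial.induction_on with
  | C p =>
    refine ⟨MvPolynomial.C (psi n p), ?_⟩
    funext m
    simp [qEval]
  | add F F' hF hF' =>
    obtain ⟨G, hG⟩ := hF
    obtain ⟨G', hG'⟩ := hF'
    exact ⟨G + G', by rw [map_add, map_add, map_add, hG, hG']⟩
  | mul_X F a hF =>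
    obtain ⟨G, hG⟩ := hF
    have hX : (psi n : MvPolynomial (Fin d) R[X] →+* _).compLeft (ι → ℕ) (qPower R c a) =
        qPower R c a ^ (n : ℕ) := funext fun m => psi_qPower n a m
    have hE : qEval R c (MvPolynomial.X a) = qPower R c a := MvPolynomial.aeval_X _ _
    exact ⟨G * MvPolynomial.X a ^ (n : ℕ), by
      rw [map_mul, map_mul, map_mul, hG, map_pow, hE, hX]⟩

/-- `Ψ^n` maps a denominator to a denominator, as `Ψ^n(q^j - 1) = q^{nj} - 1`, so saturation
applies. -/
theorem psi_mem_qRing (n : ℕ+) {f : QFun R d ι} (hf : f ∈ qRing R c) :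
    (psi n : MvPolynomial (Fin d) R[X] →+* _).compLeft (ι → ℕ) f ∈ qRing R c := by
  obtain ⟨s, hs, F, hF⟩ := exists_smul_eq_qEval (c := c) hf
  refine mem_qSpan_of_mem_qMonoid (c := c) (psi_mem_qMonoid hs n) ?_
  have h := congrArg ((psi n : MvPolynomial (Fin d) R[X] →+* _).compLeft (ι → ℕ)) hF
  obtain ⟨G, hG⟩ := exists_psi_qEval (c := c) n F
  rw [hG] at h
  have e2 : (psi n : MvPolynomial (Fin d) R[X] →+* _).compLeft (ι → ℕ)
      ((MvPolynomial.C s : MvPolynomial (Fin d) R[X]) • f) =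
      (MvPolynomial.C (psi n s) : MvPolynomial (Fin d) R[X]) •
        (psi n : MvPolynomial (Fin d) R[X] →+* _).compLeft (ι → ℕ) f := by
    funext m
    simp [psi_C]
  rw [← e2, h]
  exact qEval_mem R c _

theorem natCast_mem_nonZeroDivisors {n : ℕ} (hn : n ≠ 0) : (n : R[X]) ∈ nonZeroDivisors R[X] :=
  mem_nonZeroDivisors_iff_right.2 fun f hf => LambdaRing.torsion_free n hn f (by rwa [mul_comm])

namespace QRing

/-- The Adams operations of `QRing` are computed pointwise. -/
noncomputable def adams (n : ℕ+) : QRing R c →+* QRing R c :=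
  ((psi n : MvPolynomial (Fin d) R[X] →+* _).compLeft (ι → ℕ)).restrict
    (qRing R c) (qRing R c) fun _ hf => psi_mem_qRing n hf

theorem val_adams (n : ℕ+) (f : QRing R c) (m : ι → ℕ) :
    val R c (adams n f) m = psi n (val R c f m) := rfl

noncomputable instance : LambdaRing (QRing R c) where
  psi :=
    { toFun := adams
      map_one' := by
        ext f m : 2
        rw [val_adams, map_one]
        rfl
      map_mul' := fun n n' => by
        ext f m : 2
        rw [val_adams, map_mul]
        rfl }
  psi_prime := fun p hp f => by
    -- The quotient by `p` exists pointwise; saturation with respect to `p` places it in the span.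
    choose g hg using fun m => LambdaRing.psi_prime p hp (val R c f m)
    have hmem : g ∈ qSpan R c := by
      refine mem_qSpan_of_smul_mem (c := c) (s := ((p : ℕ) : R[X]))
        (dvd_of_dvd_X_mul_natCast p) (natCast_mem_nonZeroDivisors p.ne_zero) ?_
      have : (MvPolynomial.C ((p : ℕ) : R[X]) : MvPolynomial (Fin d) R[X]) • g =
          val R c (adams p f - f ^ (p : ℕ)) := by
        funext m
        rw [map_sub, map_pow, Pi.sub_apply, Pi.pow_apply, val_adams, hg m, Pi.smul_apply,
          smul_eq_mul, map_natCast]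
      rw [this]
      exact val_mem _
    refine ⟨mk g hmem, ext fun m => ?_⟩
    change val R c (adams p f - f ^ (p : ℕ)) m = _
    rw [map_sub, map_pow, Pi.sub_apply, Pi.pow_apply, val_adams, hg m, map_mul, map_natCast, val_mk]
    rfl
  torsion_free := fun n hn f hf => by
    refine ext fun m => LambdaRing.torsion_free n hn _ ?_
    have := congrFun (congrArg (val R c) hf) m
    rw [map_mul, map_natCast, map_zero] at this
    exact this

theorem val_psi (n : ℕ+) (f : QRing R c) (m : ι → ℕ) :
    val R c ((psi n : QRing R c →+* QRing R c) f) m = psi n (val R c f m) := rfl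

instance : LambdaAlgebra R[X] (QRing R c) where
  isLambdaHom := fun n s => ext fun m => by
    rw [val_psi, val_algebraMap, val_algebraMap, psi_C]

theorem isRankOne_base (i : Fin d) : IsRankOne (base R c i) := fun n => ext fun m => by
  rw [val_psi, map_pow, Pi.pow_apply, val_base, MvPolynomial.isRankOne_X i n]

theorem isRankOne_pt (a : ι) : IsRankOne (pt R c a) := fun n => ext fun m => by
  rw [val_psi, map_pow, Pi.pow_apply]
  exact psi_qPower n a m

theorem psi_smul {B : Type v} [CommRing B] [LambdaRing B] [Algebra R[X] B] [LambdaAlgebra R[X] B]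
    (n : ℕ+) (s : R[X]) (x : B) : psi n (s • x) = psi n s • psi n x := by
  rw [Algebra.smul_def, map_mul, ← LambdaAlgebra.isLambdaHom n, Algebra.smul_def]

/-- The universal property of `QRing`. -/
theorem exists_lift {B : Type v} [CommRing B] [LambdaRing B] [Algebra R[X] B]
    [LambdaAlgebra R[X] B] [Module.Flat R[X] B] {b0 : Fin d → B} {b z : ι → B}
    (hb0 : ∀ i, IsRankOne (b0 i)) (hb : ∀ a, IsRankOne (b a))
    (hz : ∀ a, b a - b0 (c a) = algebraMap R[X] B (X - 1) * z a) :
    ∃ φ : QRing R c →ₐ[R[X]] B, IsLambdaHom (φ : QRing R c →+* B) ∧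
      (∀ i, φ (base R c i) = b0 i) ∧ ∀ a, φ (pt R c a) = b a := by
  have hq : IsRankOne (algebraMap R[X] B X) := fun n => by
    rw [← LambdaAlgebra.isLambdaHom n, Polynomial.isRankOne_X n, map_pow]
  -- The `h a k` are the divided products in `B`, the forced images of the factors of the basis
  -- elements.
  choose h h0 hh using fun a => LambdaRing.exists_qBinomials hq (hb0 (c a)) (hb a)
    (z := z a) (by simpa using hz a)
  let _ : Algebra (MvPolynomial (Fin d) R[X]) B := (MvPolynomial.aeval b0).toRingHom.toAlgebra
  have hPB : ∀ p : MvPolynomial (Fin d) R[X], algebraMap _ B p = MvPolynomial.aeval b0 p :=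
    fun _ => rfl
  have : IsScalarTower R[X] (MvPolynomial (Fin d) R[X]) B := .of_algebraMap_eq fun s => by
    rw [hPB, MvPolynomial.algebraMap_eq, MvPolynomial.aeval_C]
  let φ : QRing R c →ₗ[MvPolynomial (Fin d) R[X]] B :=
    (basis R c).constr (MvPolynomial (Fin d) R[X]) fun k => ∏ a, h a (k a)
  let ev : QPoly R d ι →ₐ[MvPolynomial (Fin d) R[X]] B := MvPolynomial.aeval b
  have hfall : ∀ a n, qFall (algebraMap R[X] B X) (b0 (c a)) (b a) n =
      algebraMap R[X] B (qFact R n) * h a n := by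
    intro a n
    induction n with
    | zero => simp [qFall, qFact, h0]
    | succ n ih =>
      rw [qFall_succ, ih, qFact_succ, map_mul, map_sub, map_pow, map_one]
      linear_combination - algebraMap R[X] B (qFact R n) * hh a n
  -- On Newton products both sides agree because the denominators match, and these span all
  -- polynomials.
  have hφ : ∀ F, φ (eval R c F) = ev F := by
    have : φ ∘ₗ (eval R c).toLinearMap = ev.toLinearMap := by
      refine LinearMap.ext_on_range (span_qNewton R c) fun k => ?_
      rw [LinearMap.comp_apply, AlgHom.toLinearMap_apply, AlgHom.toLinearMap_apply,
        eval_qNewton, map_smul, Module.Basis.constr_basis, qNewton, map_prod, Algebra.smul_def,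
        hPB, MvPolynomial.aeval_C, qDenom, map_prod, ← Finset.prod_mul_distrib]
      refine Finset.prod_congr rfl fun a _ => ?_
      rw [← hfall, map_qFall]
      simp [ev, hPB]
    exact fun F => DFunLike.congr_fun this F
  -- By flatness denominators act injectively on `B`. Multiplicativity and compatibility with `Ψ^n`
  -- therefore need checking only on polynomials in the `y_a`.
  have hreg : ∀ s ∈ qMonoid R, ∀ b : B, s • b = 0 → b = 0 := fun s hs b =>
    smul_eq_zero_of_flat (qMonoid_le_nonZeroDivisors hs) b
  have hsm : ∀ (s : R[X]) (x : QRing R c), φ (s • x) = s • φ x := fun s x =>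
    LinearMap.map_smul_of_tower φ s x
  have hone : φ 1 = 1 := by
    have := hφ 1
    rwa [map_one (eval R c), map_one ev] at this
  let Φ : QRing R c →ₐ[R[X]] B := AlgHom.ofLinearMap (φ.restrictScalars R[X]) hone (by
    intro x y
    obtain ⟨s, hs, F, hF⟩ := exists_smul_eq_eval x
    obtain ⟨t, ht, G, hG⟩ := exists_smul_eq_eval y
    refine sub_eq_zero.1 (hreg (s * t) (mul_mem hs ht) _ ?_)
    change (s * t) • (φ (x * y) - φ x * φ y) = 0
    rw [smul_sub, ← smul_mul_smul_comm, ← hsm, ← hsm, ← hsm, ← smul_mul_smul_comm, hF, hG,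
      ← map_mul, hφ, hφ, hφ, map_mul, sub_self])
  have hΦ : ∀ x, Φ x = φ x := fun _ => rfl
  have hbase : ∀ i, Φ (base R c i) = b0 i := fun i => by
    rw [hΦ, base, Algebra.algebraMap_eq_smul_one, map_smul, hone,
      ← Algebra.algebraMap_eq_smul_one, hPB, MvPolynomial.aeval_X]
  have hpt : ∀ a, Φ (pt R c a) = b a := fun a => by
    have := hφ (MvPolynomial.X a)
    rw [hΦ]
    simpa [eval, ev] using this
  have hev : ∀ (n : ℕ+) (F : QPoly R d ι), Φ (psi n (eval R c F)) = psi n (Φ (eval R c F)) := by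
    intro n F
    have : (Φ.toRingHom.comp ((psi n : QRing R c →+* QRing R c).comp (eval R c).toRingHom)) =
        (psi n : B →+* B).comp (Φ.toRingHom.comp (eval R c).toRingHom) := by
      refine MvPolynomial.ringHom_ext (fun p => ?_) (fun a => ?_)
      · have : (Φ.toRingHom.comp ((psi n : QRing R c →+* QRing R c).comp
            (algebraMap (MvPolynomial (Fin d) R[X]) (QRing R c)))) =
            (psi n : B →+* B).comp (Φ.toRingHom.comp
              (algebraMap (MvPolynomial (Fin d) R[X]) (QRing R c))) := by
          refine MvPolynomial.ringHom_ext (fun s => ?_) (fun i => ?_)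
          · change Φ (psi n (algebraMap (MvPolynomial (Fin d) R[X]) (QRing R c)
              (algebraMap R[X] _ s))) = psi n (Φ (algebraMap (MvPolynomial (Fin d) R[X])
                (QRing R c) (algebraMap R[X] _ s)))
            rw [← IsScalarTower.algebraMap_apply, ← LambdaAlgebra.isLambdaHom n, AlgHom.commutes,
              AlgHom.commutes, LambdaAlgebra.isLambdaHom n]
          · change Φ (psi n (base R c i)) = psi n (Φ (base R c i))
            rw [isRankOne_base i n, map_pow, hbase, hb0 i n]
        have := DFunLike.congr_fun this p
        simpa [eval] using this
      · have : Φ (psi n (pt R c a)) = psi n (Φ (pt R c a)) := by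
          rw [isRankOne_pt a n, map_pow, hpt, hb a n]
        simpa [eval] using this
    exact DFunLike.congr_fun this F
  refine ⟨Φ, fun n x => ?_, hbase, hpt⟩
  obtain ⟨s, hs, F, hF⟩ := exists_smul_eq_eval x
  refine sub_eq_zero.1 (hreg _ (psi_mem_qMonoid hs n) _ ?_)
  change psi n s • (Φ (psi n x) - psi n (Φ x)) = 0
  rw [smul_sub, ← map_smul, ← psi_smul, ← psi_smul, ← map_smul, hF, hev, sub_self]

end QRing

end ModelLambda

/-! ### Difference operators on `QRing` -/

namespace QRing

variable {R : Type u} [CommRing R] {d : ℕ} {ι : Type} [Fintype ι] [DecidableEq ι] {c : ι → Fin d}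

/-- The operator lowering the `a`-th index of the basis. -/
noncomputable def lower (a : ι) : QRing R c →ₗ[MvPolynomial (Fin d) R[X]] QRing R c :=
  (basis R c).constr (MvPolynomial (Fin d) R[X]) fun k =>
    if k a = 0 then 0 else basis R c (Function.update k a (k a - 1))

/-- The operator raising the `a`-th index of the basis. -/
noncomputable def raise (a : ι) : QRing R c →ₗ[MvPolynomial (Fin d) R[X]] QRing R c :=
  (basis R c).constr (MvPolynomial (Fin d) R[X]) fun k =>
    basis R c (Function.update k a (k a + 1))

theorem lower_basis (a : ι) (k : ι → ℕ) : lower a (basis R c k) =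
    if k a = 0 then 0 else basis R c (Function.update k a (k a - 1)) :=
  Module.Basis.constr_basis ..

theorem raise_basis (a : ι) (k : ι → ℕ) :
    raise a (basis R c k) = basis R c (Function.update k a (k a + 1)) :=
  Module.Basis.constr_basis ..

theorem lower_raise (a : ι) (f : QRing R c) : lower a (raise a f) = f := by
  have : lower a ∘ₗ raise a = (LinearMap.id : QRing R c →ₗ[MvPolynomial (Fin d) R[X]] _) :=
    (basis R c).ext fun k => by
      rw [LinearMap.comp_apply, raise_basis, lower_basis]
      simp
  exact DFunLike.congr_fun this f

theorem lower_lower (a b : ι) (f : QRing R c) : lower a (lower b f) = lower b (lower a f) := by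
  rcases eq_or_ne a b with rfl | hab
  · rfl
  have : lower a ∘ₗ lower b =
      (lower b ∘ₗ lower a : QRing R c →ₗ[MvPolynomial (Fin d) R[X]] _) :=
    (basis R c).ext fun k => by
      rw [LinearMap.comp_apply, LinearMap.comp_apply, lower_basis, lower_basis]
      by_cases ha : k a = 0 <;> by_cases hb : k b = 0 <;>
        simp [ha, hb, lower_basis, hab, hab.symm, Function.update_comm hab]
  exact DFunLike.congr_fun this f

theorem lower_raise_of_ne {a b : ι} (hab : a ≠ b) (f : QRing R c) :
    lower a (raise b f) = raise b (lower a f) := by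
  have : lower a ∘ₗ raise b =
      (raise b ∘ₗ lower a : QRing R c →ₗ[MvPolynomial (Fin d) R[X]] _) :=
    (basis R c).ext fun k => by
      rw [LinearMap.comp_apply, LinearMap.comp_apply, raise_basis, lower_basis, lower_basis]
      by_cases ha : k a = 0 <;>
        simp [ha, raise_basis, hab, hab.symm, Function.update_comm hab]
  exact DFunLike.congr_fun this f

/-- The recursion of `qGauss` in its first argument, in the `a`-th factor; the other factors are
unchanged. -/
theorem qBinom_update_succ (a : ι) (k m : ι → ℕ) :
    qBinom R c k (Function.update m a (m a + 1)) = qBinom R c k m +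
      if k a = 0 then 0 else qPower R c a m * qBinom R c (Function.update k a (k a - 1)) m := by
  have e : ∀ k m : ι → ℕ, qBinom R c k m = (MvPolynomial.C (qGauss R (m a) (k a)) *
      MvPolynomial.X (c a) ^ k a) * ∏ b ∈ Finset.univ.erase a,
        (MvPolynomial.C (qGauss R (m b) (k b)) * MvPolynomial.X (c b) ^ k b) := fun k m =>
    (Finset.mul_prod_erase _ _ (Finset.mem_univ a)).symm
  have e1 : ∏ b ∈ Finset.univ.erase a, (MvPolynomial.C (qGauss R (Function.update m a (m a + 1) b)
      (k b)) * MvPolynomial.X (c b) ^ k b : MvPolynomial (Fin d) R[X]) =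
      ∏ b ∈ Finset.univ.erase a, (MvPolynomial.C (qGauss R (m b) (k b)) *
        MvPolynomial.X (c b) ^ k b) :=
    Finset.prod_congr rfl fun b hb => by rw [Function.update_of_ne (Finset.ne_of_mem_erase hb)]
  have e2 : ∏ b ∈ Finset.univ.erase a, (MvPolynomial.C (qGauss R (m b)
      (Function.update k a (k a - 1) b)) * MvPolynomial.X (c b) ^ (Function.update k a (k a - 1) b) :
        MvPolynomial (Fin d) R[X]) = ∏ b ∈ Finset.univ.erase a,
          (MvPolynomial.C (qGauss R (m b) (k b)) * MvPolynomial.X (c b) ^ k b) :=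
    Finset.prod_congr rfl fun b hb => by rw [Function.update_of_ne (Finset.ne_of_mem_erase hb)]
  rw [e, e k m, e (Function.update k a (k a - 1)) m, e1, e2, Function.update_self,
    Function.update_self]
  split_ifs with h
  · simp [h]
  · obtain ⟨l, hl⟩ := Nat.exists_eq_succ_of_ne_zero h
    rw [hl, Nat.succ_eq_add_one, qGauss_succ_succ, Nat.add_sub_cancel, map_add, map_mul, qPower]
    ring

/-- The linear map underlying `shift`. -/
noncomputable def shiftLinear (a : ι) : QRing R c →ₗ[MvPolynomial (Fin d) R[X]] QRing R c :=
  LinearMap.id + LinearMap.mulLeft _ (pt R c a) ∘ₗ lower a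

/-- By the recursion for `qBinom`, the operator `1 + y_a · lower a` is translation of `m_a` by one,
and hence multiplicative. -/
theorem val_shiftLinear (a : ι) (f : QRing R c) (m : ι → ℕ) :
    val R c (shiftLinear a f) m = val R c f (Function.update m a (m a + 1)) := by
  have : LinearMap.proj (R := MvPolynomial (Fin d) R[X]) m ∘ₗ (val R c).toLinearMap ∘ₗ
      shiftLinear a = LinearMap.proj (R := MvPolynomial (Fin d) R[X])
        (Function.update m a (m a + 1)) ∘ₗ (val R c).toLinearMap :=
    (basis R c).ext fun k => by
      simp only [LinearMap.comp_apply, AlgHom.toLinearMap_apply, LinearMap.proj_apply, shiftLinear,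
        LinearMap.add_apply, LinearMap.id_apply, LinearMap.mulLeft_apply, map_add, map_mul,
        Pi.mul_apply, val_basis, lower_basis, qBinom_update_succ]
      congr 1
      split_ifs
      · simp
      · rw [val_basis]
        rfl
  exact DFunLike.congr_fun this f

/-- The automorphism of `QRing` with `y_a ↦ q y_a`. -/
noncomputable def shift (a : ι) : QRing R c →ₐ[R[X]] QRing R c :=
  AlgHom.ofLinearMap ((shiftLinear a).restrictScalars R[X])
    (ext fun m => by
      change val R c (shiftLinear a 1) m = _
      rw [val_shiftLinear, map_one]
      rfl)
    (fun f g => ext fun m => by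
      change val R c (shiftLinear a (f * g)) m = val R c (shiftLinear a f * shiftLinear a g) m
      rw [val_shiftLinear, map_mul, map_mul, Pi.mul_apply, Pi.mul_apply, val_shiftLinear,
        val_shiftLinear])

theorem val_shift (a : ι) (f : QRing R c) (m : ι → ℕ) :
    val R c (shift a f) m = val R c f (Function.update m a (m a + 1)) :=
  val_shiftLinear a f m

/-- This identifies `lower a` as the difference operator `f ↦ (f(q y_a) - f(y_a)) / y_a`, that is,
`q - 1` times the Jackson derivative in `y_a`. -/
theorem pt_mul_lower (a : ι) (f : QRing R c) : pt R c a * lower a f = shift a f - f := by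
  change _ = shiftLinear a f - f
  simp [shiftLinear]

/-- Values of `y_a` are powers of `q` times a variable, hence regular. Identities for `lower a` may
thus be checked for `y_a · lower a = shift a - 1`. -/
theorem pt_mul_eq_zero {ι : Type} [Fintype ι] {c : ι → Fin d} {a : ι} {f : QRing R c}
    (h : pt R c a * f = 0) : f = 0 := by
  refine ext fun m => ?_
  have := congrFun (congrArg (val R c) h) m
  rw [map_mul, Pi.mul_apply, val_pt, map_zero, Pi.zero_apply, mul_assoc] at this
  have hX : (X ^ m a : R[X]) ∈ nonZeroDivisors R[X] :=
    Submonoid.pow_mem _ Polynomial.X_mem_nonzeroDivisors _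
  have h1 := MvPolynomial.C_mul_eq_zero hX this
  rw [map_zero, Pi.zero_apply]
  have h2 : MvPolynomial.C 0 ∣ MvPolynomial.X (c a) * val R c f m := by rw [h1]; exact dvd_zero _
  simpa using MvPolynomial.C_dvd_of_dvd_X_mul h2

theorem shift_base (a : ι) (i : Fin d) : shift a (base R c i) = base R c i :=
  ext fun m => by rw [val_shift, val_base, val_base]

theorem shift_pt_self (a : ι) : shift a (pt R c a) = (X : R[X]) • pt R c a := ext fun m => by
  rw [val_shift, val_smul, val_pt, val_pt, Function.update_self, pow_succ', map_mul, mul_assoc]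

theorem shift_pt_of_ne {a b : ι} (h : b ≠ a) : shift a (pt R c b) = pt R c b := ext fun m => by
  rw [val_shift, val_pt, val_pt, Function.update_of_ne h]

/-- If `lower a f = 0` then `f` is fixed by the shift, so it does not depend on `m_a`; putting `m_a
= 0` amounts to specializing `y_a` to `x_{c(a)}`. -/
theorem val_eq_of_lower_eq_zero (T : Finset ι) {f : QRing R c} (h : ∀ a ∈ T, lower a f = 0)
    (m : ι → ℕ) : val R c f (fun b => if b ∈ T then 0 else m b) = val R c f m := by
  have step : ∀ a, lower a f = 0 → ∀ m, val R c f (Function.update m a 0) = val R c f m := by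
    intro a ha m
    have hs : shift a f = f := by
      have := pt_mul_lower a f
      rw [ha, mul_zero] at this
      exact (sub_eq_zero.1 this.symm)
    have : ∀ n, val R c f (Function.update m a n) = val R c f (Function.update m a 0) := by
      intro n
      induction n with
      | zero => rfl
      | succ n ih =>
        rw [← ih]
        conv_rhs => rw [← hs, val_shift]
        simp
    rw [← this (m a), Function.update_eq_self]
  induction T using Finset.induction_on with
  | empty => simp
  | insert a T ha ih =>
    rw [← ih fun b hb => h b (Finset.mem_insert_of_mem hb),
      ← step a (h a (Finset.mem_insert_self _ _)) (fun b => if b ∈ T then 0 else m b)]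
    refine congrArg (val R c f) (funext fun b => ?_)
    rcases eq_or_ne b a with rfl | hb
    · simp
    · simp [hb]

end QRing

/-! ### Quasi-isomorphisms, elementwise -/

section Elementwise

variable {S : Type u} [CommRing S]

/-- The two hypotheses are injectivity and surjectivity on homology, in its model as kernel modulo
range. -/
theorem ShortComplex.quasiIso_of_elements {S₁ S₂ : ShortComplex (ModuleCat.{v} S)} (φ : S₁ ⟶ S₂)
    (inj : ∀ x : S₁.X₂, S₁.g x = 0 → (∃ y, S₂.f y = φ.τ₂ x) → ∃ x', S₁.f x' = x)
    (surj : ∀ y : S₂.X₂, S₂.g y = 0 → ∃ x, S₁.g x = 0 ∧ ∃ y', S₂.f y' = y - φ.τ₂ x) :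
    ShortComplex.QuasiIso φ := by
  let γ := ShortComplex.leftHomologyMapData φ S₁.moduleCatLeftHomologyData
    S₂.moduleCatLeftHomologyData
  rw [γ.quasiIso_iff, ConcreteCategory.isIso_iff_bijective]
  have hK : ∀ x : LinearMap.ker S₁.g.hom,
      (show LinearMap.ker S₂.g.hom from γ.φK x).1 = φ.τ₂ x.1 := fun x =>
    ConcreteCategory.congr_hom γ.commi (show S₁.moduleCatLeftHomologyData.K from x)
  have hπ : ∀ x : LinearMap.ker S₁.g.hom, γ.φH (Submodule.Quotient.mk x) =
      (Submodule.Quotient.mk (show LinearMap.ker S₂.g.hom from γ.φK x) :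
        LinearMap.ker S₂.g.hom ⧸ LinearMap.range S₂.moduleCatToCycles) := fun x =>
    ConcreteCategory.congr_hom γ.commπ (show S₁.moduleCatLeftHomologyData.K from x)
  constructor
  · refine (injective_iff_map_eq_zero γ.φH.hom).2 fun h hh => ?_
    obtain ⟨x, rfl⟩ := Submodule.Quotient.mk_surjective _ h
    have h1 := (hπ x).symm.trans hh
    obtain ⟨y, hy⟩ := (Submodule.Quotient.mk_eq_zero _).1 h1
    obtain ⟨x', hx'⟩ := inj x.1 x.2 ⟨y, by rw [← hK, ← hy]; rfl⟩
    exact (Submodule.Quotient.mk_eq_zero _).2 ⟨x', Subtype.ext hx'⟩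
  · intro h
    obtain ⟨y, rfl⟩ := Submodule.Quotient.mk_surjective _ h
    obtain ⟨x, hx, y', hy'⟩ := surj y.1 y.2
    refine ⟨(Submodule.Quotient.mk (⟨x, hx⟩ : LinearMap.ker S₁.g.hom) :
      LinearMap.ker S₁.g.hom ⧸ LinearMap.range S₁.moduleCatToCycles), ?_⟩
    refine (hπ _).trans ((Submodule.Quotient.eq (LinearMap.range S₂.moduleCatToCycles)).2
      (LinearMap.mem_range.2 ⟨y', Subtype.ext ?_⟩)).symm
    exact hy'.trans (congrArg (y.1 - ·) (hK ⟨x, hx⟩).symm)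

theorem ShortComplex.exists_of_quasiIso {S₁ S₂ : ShortComplex (ModuleCat.{v} S)} (φ : S₁ ⟶ S₂)
    (h : ShortComplex.QuasiIso φ) :
    (∀ x : S₁.X₂, S₁.g x = 0 → (∃ y, S₂.f y = φ.τ₂ x) → ∃ x', S₁.f x' = x) ∧
    (∀ y : S₂.X₂, S₂.g y = 0 → ∃ x, S₁.g x = 0 ∧ ∃ y', S₂.f y' = y - φ.τ₂ x) := by
  let γ := ShortComplex.leftHomologyMapData φ S₁.moduleCatLeftHomologyData
    S₂.moduleCatLeftHomologyData
  rw [γ.quasiIso_iff, ConcreteCategory.isIso_iff_bijective] at h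
  have hK : ∀ x : LinearMap.ker S₁.g.hom,
      (show LinearMap.ker S₂.g.hom from γ.φK x).1 = φ.τ₂ x.1 := fun x =>
    ConcreteCategory.congr_hom γ.commi (show S₁.moduleCatLeftHomologyData.K from x)
  have hπ : ∀ x : LinearMap.ker S₁.g.hom, γ.φH (Submodule.Quotient.mk x) =
      (Submodule.Quotient.mk (show LinearMap.ker S₂.g.hom from γ.φK x) :
        LinearMap.ker S₂.g.hom ⧸ LinearMap.range S₂.moduleCatToCycles) := fun x =>
    ConcreteCategory.congr_hom γ.commπ (show S₁.moduleCatLeftHomologyData.K from x)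
  constructor
  · rintro x hx ⟨y, hy⟩
    have : (Submodule.Quotient.mk (⟨x, hx⟩ : LinearMap.ker S₁.g.hom) :
        LinearMap.ker S₁.g.hom ⧸ LinearMap.range S₁.moduleCatToCycles) = 0 := by
      refine (injective_iff_map_eq_zero γ.φH.hom).1 h.1 _ ((hπ _).trans ?_)
      exact (Submodule.Quotient.mk_eq_zero _).2 ⟨y, Subtype.ext (hy.trans (hK ⟨x, hx⟩).symm)⟩
    obtain ⟨x', hx'⟩ := (Submodule.Quotient.mk_eq_zero _).1 this
    exact ⟨x', congrArg Subtype.val hx'⟩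
  · intro y hy
    obtain ⟨h', hh'⟩ := h.2 (Submodule.Quotient.mk (⟨y, hy⟩ : LinearMap.ker S₂.g.hom) :
        LinearMap.ker S₂.g.hom ⧸ LinearMap.range S₂.moduleCatToCycles)
    obtain ⟨x, rfl⟩ := Submodule.Quotient.mk_surjective _ h'
    have h1 := hh'.symm.trans (hπ x)
    obtain ⟨y', hy'⟩ := (Submodule.Quotient.eq _).1 h1
    refine ⟨x.1, x.2, y', ?_⟩
    rw [← hK]
    exact congrArg Subtype.val hy'

variable {ι : Type w} {c : ComplexShape ι}

theorem quasiIsoAt_iff_elements {K L : HomologicalComplex (ModuleCat.{v} S) c} (f : K ⟶ L)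
    {h i j : ι} (hh : c.prev i = h) (hj : c.next i = j) : QuasiIsoAt f i ↔
      (∀ x : K.X i, K.d i j x = 0 → (∃ y, L.d h i y = f.f i x) → ∃ x', K.d h i x' = x) ∧
      (∀ y : L.X i, L.d i j y = 0 → ∃ x, K.d i j x = 0 ∧ ∃ y', L.d h i y' = y - f.f i x) := by
  rw [quasiIsoAt_iff' f h i j hh hj]
  exact ⟨fun H => ShortComplex.exists_of_quasiIso _ H,
    fun H => ShortComplex.quasiIso_of_elements _ H.1 H.2⟩

end Elementwise

/-! ### Sequences of modules and their quasi-isomorphisms -/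

/-- A cochain complex of modules in non-negative degrees, in unbundled form. -/
structure SeqComplex (S : Type u) [CommRing S] where
  /-- the terms -/
  X : ℕ → Type v
  [addCommGroup : ∀ n, AddCommGroup (X n)]
  [module : ∀ n, Module S (X n)]
  /-- the differentials -/
  d : ∀ n, X n →ₗ[S] X (n + 1)
  d_d : ∀ n x, d (n + 1) (d n x) = 0

namespace SeqComplex

attribute [instance] addCommGroup module

variable {S : Type u} [CommRing S]

/-- Boundaries of a sequence of modules. -/
def IsBoundary (K : SeqComplex.{u, v} S) : ∀ {n : ℕ}, K.X n → Prop
  | 0, x => x = 0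
  | _ + 1, x => ∃ y, K.d _ y = x

/-- Families of maps that induce isomorphisms in cohomology. -/
structure IsQuasiIso (K : SeqComplex.{u, v} S) (L : SeqComplex.{u, w} S)
    (f : ∀ n, K.X n →ₗ[S] L.X n) : Prop where
  comm : ∀ n x, f (n + 1) (K.d n x) = L.d n (f n x)
  inj : ∀ n (x : K.X n), K.d n x = 0 → L.IsBoundary (f n x) → K.IsBoundary x
  surj : ∀ n (y : L.X n), L.d n y = 0 → ∃ x, K.d n x = 0 ∧ L.IsBoundary (y - f n x)

theorem isQuasiIso_of_bijective (K : SeqComplex.{u, v} S) (L : SeqComplex.{u, w} S)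
    (f : ∀ n, K.X n →ₗ[S] L.X n) (comm : ∀ n x, f (n + 1) (K.d n x) = L.d n (f n x))
    (hf : ∀ n, Function.Bijective (f n)) : IsQuasiIso K L f where
  comm := comm
  inj
    | 0, x, _, h => (hf 0).1 (h.trans (map_zero _).symm)
    | n + 1, x, _, ⟨y, hy⟩ => by
      obtain ⟨z, rfl⟩ := (hf n).2 y
      exact ⟨z, (hf _).1 (by rw [comm, hy])⟩
  surj n y hy := by
    obtain ⟨x, rfl⟩ := (hf n).2 y
    refine ⟨x, (hf _).1 (by rw [comm, hy, map_zero]), ?_⟩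
    rw [sub_self]
    cases n with
    | zero => rfl
    | succ n => exact ⟨0, map_zero _⟩

/-- The cochain complex of modules attached to a sequence of modules. -/
noncomputable def toComplex (K : SeqComplex.{u, v} S) :
    CochainComplex (ModuleCat.{max v w} S) ℕ :=
  CochainComplex.of (fun n => ModuleCat.of S (ULift.{w} (K.X n)))
    (fun n => ModuleCat.ofHom (ULift.moduleEquiv.symm.toLinearMap ∘ₗ K.d n ∘ₗ
      ULift.moduleEquiv.toLinearMap))
    (fun n => by
      ext x
      exact K.d_d n x.down)

theorem toComplex_d (K : SeqComplex.{u, v} S) (n : ℕ) (x : (toComplex.{u, v, w} K).X n) :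
    ((toComplex.{u, v, w} K).d n (n + 1)) x =
      (show (toComplex.{u, v, w} K).X (n + 1) from
        ULift.up (K.d n (show ULift.{w} (K.X n) from x).down)) := by
  have h : (toComplex.{u, v, w} K).d n (n + 1) = ModuleCat.ofHom
      (ULift.moduleEquiv.symm.toLinearMap ∘ₗ K.d n ∘ₗ ULift.moduleEquiv.toLinearMap) :=
    CochainComplex.of_d (fun n => ModuleCat.of S (ULift.{w} (K.X n))) (fun n => ModuleCat.ofHom
      (ULift.moduleEquiv.symm.toLinearMap ∘ₗ K.d n ∘ₗ ULift.moduleEquiv.toLinearMap)) n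
  rw [h]
  rfl

universe t

/-- The complex `A` is isomorphic to the sequence `K`. -/
def Represents (A : CochainComplex (ModuleCat.{t} S) ℕ) (K : SeqComplex.{u, v} S) : Prop :=
  ∃ e : ∀ n, A.X n ≃ₗ[S] K.X n, ∀ n (x : A.X n), e (n + 1) (A.d n (n + 1) x) = K.d n (e n x)

theorem represents_toComplex (K : SeqComplex.{u, v} S) : Represents (toComplex.{u, v, w} K) K :=
  ⟨fun _ => ULift.moduleEquiv, fun n x => by rw [toComplex_d]; rfl⟩

theorem isBoundary_iff {A : CochainComplex (ModuleCat.{t} S) ℕ} {K : SeqComplex.{u, v} S}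
    (e : ∀ n, A.X n ≃ₗ[S] K.X n)
    (he : ∀ n (x : A.X n), e (n + 1) (A.d n (n + 1) x) = K.d n (e n x)) {n : ℕ} (x : A.X n) :
    K.IsBoundary (e n x) ↔ ∃ y, A.d ((ComplexShape.up ℕ).prev n) n y = x := by
  cases n with
  | zero =>
    -- In degree `0` the predecessor is by default `0` itself, and the differential from `0` to `0`
    -- vanishes.
    rw [A.shape _ _ (by simp)]
    exact (map_eq_zero_iff (e 0) (e 0).injective).trans
      ⟨fun h => ⟨0, h.symm⟩, fun ⟨_, h⟩ => h.symm⟩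
  | succ n =>
    rw [CochainComplex.prev_nat_succ n]
    constructor
    · rintro ⟨y, hy⟩
      refine ⟨(e n).symm y, (e (n + 1)).injective ?_⟩
      rw [he, LinearEquiv.apply_symm_apply, hy]
    · rintro ⟨y, rfl⟩
      exact ⟨e n y, (he n y).symm⟩

theorem exists_quasiIso {A B : CochainComplex (ModuleCat.{t} S) ℕ} {K : SeqComplex.{u, v} S}
    {L : SeqComplex.{u, w} S} (hA : Represents A K) (hB : Represents B L)
    {f : ∀ n, K.X n →ₗ[S] L.X n} (hf : IsQuasiIso K L f) : ∃ g : A ⟶ B, QuasiIso g := by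
  obtain ⟨e, he⟩ := hA
  obtain ⟨e', he'⟩ := hB
  let φ : ∀ n, A.X n →ₗ[S] B.X n := fun n =>
    (e' n).symm.toLinearMap ∘ₗ f n ∘ₗ (e n).toLinearMap
  have hφ : ∀ n x, e' n (φ n x) = f n (e n x) := fun n x => LinearEquiv.apply_symm_apply _ _
  have hcomm : ∀ n (x : A.X n), φ (n + 1) (A.d n (n + 1) x) = B.d n (n + 1) (φ n x) := fun n x =>
    (e' (n + 1)).injective (by rw [hφ, he, he', hφ, hf.comm])
  let g : A ⟶ B := CochainComplex.ofHom (fun n => ModuleCat.ofHom (φ n)) fun n => by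
    ext x
    exact (hcomm n x).symm
  have hg : ∀ n x, g.f n x = φ n x := fun _ _ => rfl
  refine ⟨g, ⟨fun n => (quasiIsoAt_iff_elements g rfl (CochainComplex.next ℕ n)).2
    ⟨fun x hx h => ?_, fun y hy => ?_⟩⟩⟩
  · rw [← isBoundary_iff e he]
    refine hf.inj n _ ?_ ?_
    · rw [← he, hx, map_zero]
    · rwa [← isBoundary_iff e' he', hg, hφ] at h
  · obtain ⟨x, hx, h⟩ := hf.surj n (e' n y) (by rw [← he', hy, map_zero])
    refine ⟨(e n).symm x, (e (n + 1)).injective ?_, ?_⟩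
    · rw [he, LinearEquiv.apply_symm_apply, hx, map_zero]
    · rwa [← isBoundary_iff e' he', map_sub, hg, hφ, LinearEquiv.apply_symm_apply]

end SeqComplex

/-! ### Semi-cosimplicial modules -/

/-- A semi-cosimplicial module. -/
structure SemiCosimplicial (S : Type u) [CommRing S] where
  /-- the terms -/
  X : ℕ → Type v
  [addCommGroup : ∀ n, AddCommGroup (X n)]
  [module : ∀ n, Module S (X n)]
  /-- the cofaces -/
  δ : ∀ n, Fin (n + 2) → X n →ₗ[S] X (n + 1)
  δ_δ : ∀ n (i j : Fin (n + 2)), i ≤ j → ∀ x,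
    δ (n + 1) j.succ (δ n i x) = δ (n + 1) i.castSucc (δ n j x)

namespace SemiCosimplicial

attribute [instance] addCommGroup module

variable {S : Type u} [CommRing S] (K : SemiCosimplicial.{u, v} S)

/-- The alternating sum of the cofaces. -/
def altD (n : ℕ) : K.X n →ₗ[S] K.X (n + 1) := ∑ i : Fin (n + 2), (-1 : ℤ) ^ (i : ℕ) • K.δ n i

theorem altD_apply (n : ℕ) (x : K.X n) :
    K.altD n x = ∑ i : Fin (n + 2), (-1 : ℤ) ^ (i : ℕ) • K.δ n i x := by
  simp [altD, LinearMap.sum_apply]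

theorem altD_altD (n : ℕ) (x : K.X n) : K.altD (n + 1) (K.altD n x) = 0 := by
  simp only [altD_apply, map_sum, map_zsmul, Finset.smul_sum, smul_smul]
  rw [← Finset.sum_product']
  let P := Fin (n + 2) × Fin (n + 3)
  let T : Finset P := {ij : P | (ij.2 : ℕ) ≤ (ij.1 : ℕ)}
  rw [Finset.univ_product_univ, ← Finset.sum_add_sum_compl T, ← eq_neg_iff_add_eq_zero,
    ← Finset.sum_neg_distrib]
  -- The term `(i, j)` with `j ≤ i`, where `i` is the inner coface and `j` the outer one, cancels
  -- against `(j, i + 1)`.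
  let φ : ∀ ij : P, ij ∈ T → P := fun ij hij =>
    (Fin.castLT ij.2 (lt_of_le_of_lt (Finset.mem_filter.mp hij).right (Fin.is_lt ij.1)), ij.1.succ)
  apply Finset.sum_bij φ
  · intro ij hij
    simp_rw [T, φ, Finset.compl_filter, Finset.mem_filter_univ, Fin.val_succ,
      Fin.val_castLT] at hij ⊢
    lia
  · rintro ⟨i, j⟩ hij ⟨i', j'⟩ hij' h
    rw [Prod.mk_inj]
    exact ⟨by simpa [φ] using! congr_arg Prod.snd h,
      by simpa [φ, Fin.castSucc_castLT] using! congr_arg Fin.castSucc (congr_arg Prod.fst h)⟩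
  · rintro ⟨i', j'⟩ hij'
    simp_rw [T, Finset.compl_filter, Finset.mem_filter_univ, not_le] at hij'
    refine ⟨(j'.pred <| ?_, Fin.castSucc i'), ?_, ?_⟩
    · rintro rfl
      simp only [Fin.val_zero, not_lt_zero] at hij'
    · simpa [T] using! Nat.le_sub_one_of_lt hij'
    · simp only [φ, Fin.castLT_castSucc, Fin.succ_pred]
  · rintro ⟨i, j⟩ hij
    have hji : (j : ℕ) ≤ i := (Finset.mem_filter.mp hij).right
    have h := K.δ_δ n (Fin.castLT j (lt_of_le_of_lt hji i.is_lt)) i hji x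
    rw [Fin.castSucc_castLT] at h
    simp only [φ]
    rw [h, ← neg_smul]
    congr 1
    simp only [Fin.val_succ, Fin.val_castLT, pow_succ]
    ring

/-- The complex of a semi-cosimplicial module. -/
def toSeq : SeqComplex.{u, v} S where
  X := K.X
  d := K.altD
  d_d := K.altD_altD

theorem altD_comm {L : SemiCosimplicial.{u, w} S} {n : ℕ} (f : K.X n →ₗ[S] L.X n)
    (g : K.X (n + 1) →ₗ[S] L.X (n + 1)) (h : ∀ i x, g (K.δ n i x) = L.δ n i (f x)) (x : K.X n) :
    g (K.altD n x) = L.altD n (f x) := by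
  simp only [altD_apply, map_sum, map_zsmul, h]

/-- An extra codegeneracy makes the complex exact in positive degrees. -/
theorem exact_of_contraction (h : ∀ n, K.X (n + 1) →ₗ[S] K.X n)
    (h_zero : ∀ n x, h n (K.δ n 0 x) = x)
    (h_succ : ∀ n (i : Fin (n + 2)) x, h (n + 1) (K.δ (n + 1) i.succ x) = K.δ n i (h n x))
    (n : ℕ) (x : K.X (n + 1)) (hx : K.altD (n + 1) x = 0) : K.altD n (h n x) = x := by
  -- Applying `h` to the alternating sum gives `x - altD (h x)`, since the zeroth term is `x` and
  -- the others are shifted by one.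
  have h1 : h (n + 1) (K.altD (n + 1) x) = 0 := by rw [hx, map_zero]
  rw [altD_apply, Fin.sum_univ_succ, map_add, map_sum] at h1
  simp only [map_zsmul, h_zero, h_succ] at h1
  simp only [Fin.val_zero, pow_zero, one_smul, Fin.val_succ, pow_succ,
    mul_neg, mul_one, neg_smul, Finset.sum_neg_distrib] at h1
  rw [altD_apply, eq_comm, ← sub_eq_zero, sub_eq_add_neg, h1]

theorem altD_zero_eq_zero_iff (x : K.X 0) : K.altD 0 x = 0 ↔ K.δ 0 0 x = K.δ 0 1 x := by
  rw [altD_apply, Fin.sum_univ_two]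
  simp [← sub_eq_add_neg, sub_eq_zero]

end SemiCosimplicial

/-! ### Double complexes -/

/-- A double complex in the first quadrant, with anticommuting differentials. -/
structure DoubleComplex (S : Type u) [CommRing S] where
  /-- the terms -/
  X : ℕ → ℕ → Type v
  [addCommGroup : ∀ p n, AddCommGroup (X p n)]
  [module : ∀ p n, Module S (X p n)]
  /-- the differential in the first direction -/
  dh : ∀ p n, X p n →ₗ[S] X (p + 1) n
  /-- the differential in the second direction -/
  dv : ∀ p n, X p n →ₗ[S] X p (n + 1)
  dh_dh : ∀ p n x, dh (p + 1) n (dh p n x) = 0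
  dv_dv : ∀ p n x, dv p (n + 1) (dv p n x) = 0
  anticomm : ∀ p n x, dh p (n + 1) (dv p n x) + dv (p + 1) n (dh p n x) = 0

namespace DoubleComplex

attribute [instance] addCommGroup module

variable {S : Type u} [CommRing S]

/-- The double complex with anticommuting differentials attached to one with commuting
differentials. -/
def ofComm (X : ℕ → ℕ → Type v) [∀ p n, AddCommGroup (X p n)] [∀ p n, Module S (X p n)]
    (dh : ∀ p n, X p n →ₗ[S] X (p + 1) n) (dv : ∀ p n, X p n →ₗ[S] X p (n + 1))
    (dh_dh : ∀ p n x, dh (p + 1) n (dh p n x) = 0) (dv_dv : ∀ p n x, dv p (n + 1) (dv p n x) = 0)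
    (comm : ∀ p n x, dh p (n + 1) (dv p n x) = dv (p + 1) n (dh p n x)) :
    DoubleComplex.{u, v} S where
  X := X
  dh := dh
  dv p n := (-1 : ℤ) ^ p • dv p n
  dh_dh := dh_dh
  dv_dv p n x := by simp [dv_dv]
  anticomm p n x := by simp [comm, pow_succ]

variable (K : DoubleComplex.{u, v} S)

/-- The double complex with the two directions exchanged. -/
def flip : DoubleComplex.{u, v} S where
  X p n := K.X n p
  dh p n := K.dv n p
  dv p n := K.dh n p
  dh_dh p n := K.dv_dv n p
  dv_dv p n := K.dh_dh n p
  anticomm p n x := (add_comm _ _).trans (K.anticomm n p x)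

/-- The contribution of the first differential to the total differential. -/
def hPart (z : ∀ p n, K.X p n) : ∀ p n, K.X p n
  | 0, _ => 0
  | p + 1, n => K.dh p n (z p n)

/-- The contribution of the second differential to the total differential. -/
def vPart (z : ∀ p n, K.X p n) : ∀ p n, K.X p n
  | _, 0 => 0
  | p, n + 1 => K.dv p n (z p n)

/-- The total differential, on families indexed by all bidegrees. -/
def totalD : (∀ p n, K.X p n) →ₗ[S] (∀ p n, K.X p n) where
  toFun z p n := K.hPart z p n + K.vPart z p n
  map_add' z z' := by
    funext p n
    cases p <;> cases n <;> (simp [hPart, vPart]; try abel)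
  map_smul' c z := by
    funext p n
    cases p <;> cases n <;> simp [hPart, vPart]

theorem totalD_totalD (z : ∀ p n, K.X p n) : K.totalD (K.totalD z) = 0 := by
  funext p n
  change K.hPart (K.totalD z) p n + K.vPart (K.totalD z) p n = 0
  cases p with
  | zero =>
    cases n with
    | zero => simp [hPart, vPart]
    | succ n =>
      cases n with
      | zero => simp [totalD, hPart, vPart]
      | succ n => simp [totalD, hPart, vPart, K.dv_dv]
  | succ p =>
    cases n with
    | zero =>
      cases p with
      | zero => simp [totalD, hPart, vPart]
      | succ p => simp [totalD, hPart, vPart, K.dh_dh]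
    | succ n =>
      have h1 : K.dh p (n + 1) (K.hPart z p (n + 1)) = 0 := by
        cases p <;> simp [hPart, K.dh_dh]
      have h2 : K.dv (p + 1) n (K.vPart z (p + 1) n) = 0 := by
        cases n <;> simp [vPart, K.dv_dv]
      change K.dh p (n + 1) (K.hPart z p (n + 1) + K.dv p n (z p n)) +
        K.dv (p + 1) n (K.dh p n (z p n) + K.vPart z (p + 1) n) = 0
      rw [map_add, map_add, h1, h2, zero_add, add_zero, K.anticomm]

/-- The families supported in total degree `N`. -/
def tot (N : ℕ) : Submodule S (∀ p n, K.X p n) where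
  carrier := {z | ∀ p n, p + n ≠ N → z p n = 0}
  zero_mem' := fun _ _ _ => rfl
  add_mem' := fun {a b} ha hb p n h => by
    change a p n + b p n = 0
    rw [ha p n h, hb p n h, add_zero]
  smul_mem' := fun c a ha p n h => by
    change c • a p n = 0
    rw [ha p n h, smul_zero]

theorem totalD_mem {N : ℕ} {z : ∀ p n, K.X p n} (hz : z ∈ K.tot N) : K.totalD z ∈ K.tot (N + 1) := by
  intro p n h
  change K.hPart z p n + K.vPart z p n = 0
  have h1 : K.hPart z p n = 0 := by
    cases p with
    | zero => rfl
    | succ p => simp only [hPart]; rw [hz p n (by omega), map_zero]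
  have h2 : K.vPart z p n = 0 := by
    cases n with
    | zero => rfl
    | succ n => simp only [vPart]; rw [hz p n (by omega), map_zero]
  rw [h1, h2, add_zero]

/-- The total complex. -/
def total : SeqComplex.{u, v} S where
  X N := K.tot N
  d _ := K.totalD.restrict fun _ hz => K.totalD_mem hz
  d_d _ z := Subtype.ext (K.totalD_totalD z.1)

/-- The exchange of directions on families. -/
def swapFamily : (∀ p n, K.flip.X p n) →ₗ[S] (∀ p n, K.X p n) where
  toFun z p n := z n p
  map_add' _ _ := rfl
  map_smul' _ _ := rfl

theorem swapFamily_totalD (z : ∀ p n, K.flip.X p n) :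
    K.swapFamily (K.flip.totalD z) = K.totalD (K.swapFamily z) := by
  funext p n
  refine (add_comm _ _).trans (congrArg₂ (· + ·) ?_ ?_)
  · cases p <;> rfl
  · cases n <;> rfl

theorem swapFamily_mem {N : ℕ} {z : ∀ p n, K.flip.X p n} (hz : z ∈ K.flip.tot N) :
    K.swapFamily z ∈ K.tot N := fun p n h => hz n p (by omega)

/-- The total complexes of a double complex and of its flip are isomorphic. -/
theorem isQuasiIso_swap : SeqComplex.IsQuasiIso K.flip.total K.total
    (fun _ => K.swapFamily.restrict fun _ hz => K.swapFamily_mem hz) := by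
  refine SeqComplex.isQuasiIso_of_bijective _ _ _
    (fun N z => Subtype.ext (K.swapFamily_totalD z.1)) fun N => ⟨fun z z' h => ?_, fun z => ?_⟩
  · refine Subtype.ext (funext fun p => funext fun n => ?_)
    exact congrFun (congrFun (congrArg Subtype.val h) n) p
  · exact ⟨⟨fun p n => z.1 n p, fun p n h => z.2 n p (by omega)⟩, rfl⟩

/-- If the differentials in the second direction are exact in positive degrees, families whose
total differential is concentrated in `n = 0` are so concentrated up to boundaries. -/
theorem exists_reduction
    (hexact : ∀ p n (x : K.X p (n + 1)), K.dv p (n + 1) x = 0 → ∃ y, K.dv p n y = x) (N : ℕ) :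
    ∀ (k : ℕ) (z : ∀ p n, K.X p n), z ∈ K.tot N → (∀ p n, k < n → z p n = 0) →
      (∀ p n, K.totalD z p (n + 1) = 0) →
      ∃ y : ∀ p n, K.X p n, (∀ p n, p + n + 1 ≠ N → y p n = 0) ∧
        ∀ p n, (z - K.totalD y) p (n + 1) = 0 := by
  intro k
  induction k with
  | zero =>
    intro z _ hk _
    exact ⟨0, fun _ _ _ => rfl, fun p n => by
      rw [map_zero, sub_zero]; exact hk p _ (Nat.succ_pos n)⟩
  | succ k ih =>
    intro z hz hk hD
    -- The entry of the total differential in position `(p, k + 2)` has no horizontal part, because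
    -- `z` vanishes beyond `n = k + 1`.
    have hcyc : ∀ p, K.dv p (k + 1) (z p (k + 1)) = 0 := by
      intro p
      have h := hD p (k + 1)
      change K.hPart z p (k + 2) + K.dv p (k + 1) (z p (k + 1)) = 0 at h
      have h0 : K.hPart z p (k + 2) = 0 := by
        cases p with
        | zero => rfl
        | succ p => simp only [hPart]; rw [hk p (k + 2) (by omega), map_zero]
      rwa [h0, zero_add] at h
    -- Preimages are chosen to be `0` outside total degree `N - 1`, so that the correction is
    -- homogeneous.
    have hY : ∀ p, ∃ y, K.dv p k y = z p (k + 1) ∧ (p + k + 1 ≠ N → y = 0) := by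
      intro p
      by_cases hp : p + k + 1 = N
      · obtain ⟨y, hy⟩ := hexact p k _ (hcyc p)
        exact ⟨y, hy, fun h => absurd hp h⟩
      · exact ⟨0, by rw [map_zero, hz p (k + 1) (by omega)], fun _ => rfl⟩
    choose Y hY1 hY2 using hY
    let y : ∀ p n, K.X p n := fun p => Pi.single k (Y p)
    have hy0 : ∀ p n, n ≠ k → y p n = 0 := fun p n h => Pi.single_eq_of_ne h _
    have hyk : ∀ p, y p k = Y p := fun p => Pi.single_eq_same k _
    have hysupp : ∀ p n, p + n + 1 ≠ N → y p n = 0 := by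
      intro p n h
      by_cases hn : n = k
      · subst hn
        rw [hyk, hY2 p h]
      · exact hy0 p n hn
    -- For `N = 0` there is no total degree `N - 1`, and the correction `y` is zero.
    have hDy : K.totalD y ∈ K.tot N := by
      cases N with
      | zero =>
        have : y = 0 := by
          funext p n
          exact hysupp p n (by omega)
        rw [this, map_zero]
        exact Submodule.zero_mem _
      | succ N => exact K.totalD_mem fun p n h => hysupp p n (by omega)
    obtain ⟨y', hy'1, hy'2⟩ := ih (z - K.totalD y) (Submodule.sub_mem _ hz hDy)
      (fun p n hn => by
        obtain ⟨m, rfl⟩ : ∃ m, n = m + 1 := ⟨n - 1, by omega⟩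
        change z p (m + 1) - (K.hPart y p (m + 1) + K.dv p m (y p m)) = 0
        have h0 : K.hPart y p (m + 1) = 0 := by
          cases p with
          | zero => rfl
          | succ p => simp only [hPart]; rw [hy0 p (m + 1) (by omega), map_zero]
        rw [h0, zero_add]
        by_cases hm : m = k
        · subst hm
          rw [hyk, hY1, sub_self]
        · rw [hy0 p m hm, map_zero, hk p (m + 1) (by omega), sub_zero])
      (fun p n => by
        rw [map_sub, K.totalD_totalD, sub_zero]
        exact hD p n)
    refine ⟨y + y', fun p n h => ?_, fun p n => ?_⟩
    · change y p n + y' p n = 0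
      rw [hysupp p n h, hy'1 p n h, add_zero]
    · rw [map_add, ← sub_sub]
      exact hy'2 p n

/-- The family concentrated in bidegree `(N, 0)`. -/
def single (N : ℕ) : K.X N 0 →ₗ[S] K.tot N where
  toFun x := ⟨Pi.single N (Pi.single 0 x), fun p n h => by
    by_cases hp : p = N
    · subst hp
      rw [Pi.single_eq_same, Pi.single_eq_of_ne (by omega)]
    · rw [Pi.single_eq_of_ne hp]
      rfl⟩
  map_add' x y := Subtype.ext (by
    change (Pi.single N (Pi.single 0 (x + y)) : ∀ p n, K.X p n) =
      Pi.single N (Pi.single 0 x) + Pi.single N (Pi.single 0 y)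
    rw [Pi.single_add, Pi.single_add])
  map_smul' c x := Subtype.ext (by
    change (Pi.single N (Pi.single 0 (c • x)) : ∀ p n, K.X p n) =
      c • (Pi.single N (Pi.single 0 x) : ∀ p n, K.X p n)
    rw [Pi.single_smul, Pi.single_smul])

theorem single_apply_self (N : ℕ) (x : K.X N 0) : (K.single N x).1 N 0 = x := by
  change (Pi.single N (Pi.single 0 x) : ∀ p n, K.X p n) N 0 = x
  rw [Pi.single_eq_same, Pi.single_eq_same]

theorem single_apply_succ (N : ℕ) (x : K.X N 0) (p n : ℕ) : (K.single N x).1 p (n + 1) = 0 :=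
  if h : p + (n + 1) = N then by
    change (Pi.single N (Pi.single 0 x) : ∀ p n, K.X p n) p (n + 1) = 0
    rw [Pi.single_eq_of_ne (by omega)]
    rfl
  else (K.single N x).2 p (n + 1) h

theorem eq_single {N : ℕ} (z : K.tot N) (hz : ∀ p n, z.1 p (n + 1) = 0) :
    z = K.single N (z.1 N 0) := by
  refine Subtype.ext (funext fun p => funext fun n => ?_)
  cases n with
  | zero =>
    by_cases hp : p = N
    · subst hp
      rw [single_apply_self]
    · rw [z.2 p 0 (by omega), (K.single N _).2 p 0 (by omega)]
  | succ n => rw [hz, single_apply_succ]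

theorem totalD_single (N : ℕ) (x : K.X N 0) (hx : K.dv N 0 x = 0) :
    K.total.d N (K.single N x) = K.single (N + 1) (K.dh N 0 x) := by
  have h1 : ∀ p n, (K.total.d N (K.single N x)).1 p (n + 1) = 0 := by
    intro p n
    change K.hPart (K.single N x).1 p (n + 1) + K.dv p n ((K.single N x).1 p n) = 0
    have h2 : K.hPart (K.single N x).1 p (n + 1) = 0 := by
      cases p with
      | zero => rfl
      | succ p => simp only [hPart]; rw [single_apply_succ, map_zero]
    have h3 : K.dv p n ((K.single N x).1 p n) = 0 := by
      by_cases h : p + n = N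
      · cases n with
        | zero =>
          obtain rfl : p = N := h
          rw [single_apply_self, hx]
        | succ n => rw [single_apply_succ, map_zero]
      · rw [(K.single N x).2 p n h, map_zero]
    rw [h2, h3, add_zero]
  rw [K.eq_single _ h1]
  congr 1
  change K.dh N 0 ((K.single N x).1 N 0) + 0 = _
  rw [single_apply_self, add_zero]

/-- A double complex whose second differentials are exact in positive degrees is
quasi-isomorphic to the complex of the kernels in degree zero. -/
theorem isQuasiIso_single (E : SeqComplex.{u, w} S) (ε : ∀ p, E.X p →ₗ[S] K.X p 0)
    (hexact : ∀ p n (x : K.X p (n + 1)), K.dv p (n + 1) x = 0 → ∃ y, K.dv p n y = x)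
    (ε_inj : ∀ p, Function.Injective (ε p)) (dv_ε : ∀ p e, K.dv p 0 (ε p e) = 0)
    (ker_ε : ∀ p x, K.dv p 0 x = 0 → ∃ e, ε p e = x)
    (ε_comm : ∀ p e, ε (p + 1) (E.d p e) = K.dh p 0 (ε p e)) :
    SeqComplex.IsQuasiIso E K.total (fun N => K.single N ∘ₗ ε N) where
  comm N e := by
    change K.single (N + 1) (ε (N + 1) (E.d N e)) = K.total.d N (K.single N (ε N e))
    rw [K.totalD_single N _ (dv_ε N e), ε_comm]
  inj := by
    intro N e _ hb
    cases N with
    | zero =>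
      change K.single 0 (ε 0 e) = 0 at hb
      refine ε_inj 0 ?_
      rw [map_zero, ← K.single_apply_self 0 (ε 0 e), hb]
      rfl
    | succ M =>
      obtain ⟨z, hz⟩ := hb
      change K.total.d M z = K.single (M + 1) (ε (M + 1) e) at hz
      have hz' : K.totalD z.1 = (K.single (M + 1) (ε (M + 1) e)).1 := congrArg Subtype.val hz
      -- The primitive `z` is moved into the row `n = 0` without changing its differential; its only
      -- entry is then a vertical cycle and comes from `E`.
      obtain ⟨y, hy1, hy2⟩ := K.exists_reduction hexact M M z.1 z.2
        (fun p n h => z.2 p n (by omega)) (fun p n => by rw [hz', single_apply_succ])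
      have hDy : K.totalD y ∈ K.tot M := by
        cases M with
        | zero =>
          have : y = 0 := funext fun p => funext fun n => hy1 p n (by omega)
          rw [this, map_zero]
          exact Submodule.zero_mem _
        | succ M => exact K.totalD_mem fun p n h => hy1 p n (by omega)
      have hz'2 := K.eq_single ⟨z.1 - K.totalD y, Submodule.sub_mem _ z.2 hDy⟩ hy2
      have hz'3 : K.totalD (z.1 - K.totalD y) = (K.single (M + 1) (ε (M + 1) e)).1 := by
        rw [map_sub, K.totalD_totalD, sub_zero, hz']
      have h4 : K.dv M 0 ((z.1 - K.totalD y) M 0) = 0 := by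
        have h5 := congrFun (congrFun hz'3 M) 1
        rw [single_apply_succ] at h5
        change K.hPart (z.1 - K.totalD y) M 1 + K.dv M 0 ((z.1 - K.totalD y) M 0) = 0 at h5
        have h6 : K.hPart (z.1 - K.totalD y) M 1 = 0 := by
          cases M with
          | zero => rfl
          | succ M => simp only [hPart]; rw [hy2, map_zero]
        rwa [h6, zero_add] at h5
      obtain ⟨e', he'⟩ := ker_ε M _ h4
      refine ⟨e', ε_inj _ ?_⟩
      have h5 := congrFun (congrFun hz'3 (M + 1)) 0
      rw [single_apply_self] at h5
      rw [ε_comm, he', ← h5]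
      exact (add_zero _).symm
  surj := by
    intro N z hz
    have hz' : K.totalD z.1 = 0 := congrArg Subtype.val hz
    obtain ⟨y, hy1, hy2⟩ := K.exists_reduction hexact N N z.1 z.2
      (fun p n h => z.2 p n (by omega)) (fun p n => by rw [hz']; rfl)
    have hDy : K.totalD y ∈ K.tot N := by
      cases N with
      | zero =>
        have : y = 0 := funext fun p => funext fun n => hy1 p n (by omega)
        rw [this, map_zero]
        exact Submodule.zero_mem _
      | succ N => exact K.totalD_mem fun p n h => hy1 p n (by omega)
    have hz'2 := K.eq_single ⟨z.1 - K.totalD y, Submodule.sub_mem _ z.2 hDy⟩ hy2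
    have hz'3 : K.totalD (z.1 - K.totalD y) = 0 := by
      rw [map_sub, K.totalD_totalD, sub_zero, hz']
    have h4 : K.dv N 0 ((z.1 - K.totalD y) N 0) = 0 := by
      have h5 : _ = (0 : K.X N 1) := congrFun (congrFun hz'3 N) 1
      change K.hPart (z.1 - K.totalD y) N 1 + K.dv N 0 ((z.1 - K.totalD y) N 0) = 0 at h5
      have h6 : K.hPart (z.1 - K.totalD y) N 1 = 0 := by
        cases N with
        | zero => rfl
        | succ N => simp only [hPart]; rw [hy2, map_zero]
      rwa [h6, zero_add] at h5
    obtain ⟨e, he⟩ := ker_ε N _ h4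
    refine ⟨e, ε_inj _ ?_, ?_⟩
    · rw [map_zero, ε_comm, he]
      have h5 : _ = (0 : K.X (N + 1) 0) := congrFun (congrFun hz'3 (N + 1)) 0
      exact (add_zero _).symm.trans h5
    · have h5 : (show K.tot N from z) - (K.single N ∘ₗ ε N) e = ⟨K.totalD y, hDy⟩ := by
        rw [LinearMap.comp_apply, he, ← hz'2]
        exact Subtype.ext (sub_sub_cancel _ _)
      change K.total.IsBoundary ((show K.tot N from z) - (K.single N ∘ₗ ε N) e)
      rw [h5]
      cases N with
      | zero =>
        have : y = 0 := funext fun p => funext fun n => hy1 p n (by omega)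
        refine Subtype.ext ?_
        change K.totalD y = 0
        rw [this, map_zero]
      | succ N => exact ⟨⟨y, fun p n h => hy1 p n (by omega)⟩, rfl⟩

end DoubleComplex

/-! ### Koszul complexes of commuting endomorphisms -/

section Koszul

variable {S : Type u} [CommRing S] {d : ℕ} {M : Type v} [AddCommGroup M] [Module S M]

/-- The Koszul differential on inhomogeneous forms `∑_I ω_I dx_I`. -/
def koszulAll (D : Fin d → M →ₗ[S] M) : (Finset (Fin d) → M) →ₗ[S] (Finset (Fin d) → M) :=
  LinearMap.pi fun J => ∑ i ∈ J, wedgeSign d J i • (D i ∘ₗ LinearMap.proj (J.erase i))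

theorem koszulAll_apply (D : Fin d → M →ₗ[S] M) (ω : Finset (Fin d) → M) (J : Finset (Fin d)) :
    koszulAll D ω J = ∑ i ∈ J, wedgeSign d J i • D i (ω (J.erase i)) := by
  simp [koszulAll, LinearMap.sum_apply]

theorem koszulAll_koszulAll (D : Fin d → M →ₗ[S] M)
    (hD : ∀ i j x, D i (D j x) = D j (D i x)) (ω : Finset (Fin d) → M) :
    koszulAll D (koszulAll D ω) = 0 := by
  funext J
  simp only [koszulAll_apply, map_sum, map_zsmul, Finset.smul_sum, smul_smul]
  rw [Finset.sum_sigma']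
  refine Finset.sum_involution (fun x _ => ⟨x.2, x.1⟩) ?_ ?_ ?_ ?_
  · rintro ⟨i, k⟩ h
    simp only [Finset.mem_sigma, Finset.mem_erase] at h
    rw [wedgeSign_antisymm d J h.1 h.2.2 h.2.1.symm, hD i k,
      Finset.erase_right_comm, neg_smul, neg_add_cancel]
  · rintro ⟨i, k⟩ h _ heq
    simp only [Finset.mem_sigma, Finset.mem_erase] at h
    exact h.2.1 (congrArg Sigma.fst heq)
  · rintro ⟨i, k⟩ h
    simp only [Finset.mem_sigma, Finset.mem_erase] at h ⊢
    exact ⟨h.2.2, h.2.1.symm, h.1⟩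
  · rintro ⟨i, k⟩ h
    rfl

/-- The Koszul differential on forms of degree `m`. -/
def koszulD (D : Fin d → M →ₗ[S] M) (m : ℕ) : ({I : Finset (Fin d) // I.card = m} → M) →ₗ[S]
    ({I : Finset (Fin d) // I.card = m + 1} → M) :=
  LinearMap.pi fun I => ∑ i : I.1,
    wedgeSign d I.1 i • (D i ∘ₗ
      LinearMap.proj (⟨I.1.erase i, by
        rw [Finset.card_erase_of_mem i.2, I.2, Nat.add_sub_cancel]⟩ :
          {I : Finset (Fin d) // I.card = m}))

theorem koszulD_apply (D : Fin d → M →ₗ[S] M) (m : ℕ)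
    (ω : {I : Finset (Fin d) // I.card = m} → M) (I : {I : Finset (Fin d) // I.card = m + 1}) :
    koszulD D m ω I = ∑ i : I.1, wedgeSign d I.1 i • D i (ω ⟨I.1.erase i, by
        rw [Finset.card_erase_of_mem i.2, I.2, Nat.add_sub_cancel]⟩) := by
  simp [koszulD, LinearMap.sum_apply]

/-- The inhomogeneous form attached to a form of degree `m`. -/
def extendForm {m : ℕ} (ω : {I : Finset (Fin d) // I.card = m} → M) : Finset (Fin d) → M :=
  fun I => if h : I.card = m then ω ⟨I, h⟩ else 0

theorem extendForm_apply {m : ℕ} (ω : {I : Finset (Fin d) // I.card = m} → M)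
    {I : Finset (Fin d)} (h : I.card = m) : extendForm ω I = ω ⟨I, h⟩ :=
  dif_pos h

theorem extendForm_injective {m : ℕ} :
    Function.Injective (extendForm : ({I : Finset (Fin d) // I.card = m} → M) → _) := by
  intro ω ω' h
  funext I
  rw [← extendForm_apply ω I.2, h, extendForm_apply ω' I.2]

/-- Extension by zero to inhomogeneous forms removes the dependence of the index type on the degree,
so that the computations can be made with `koszulAll`. -/
theorem extendForm_koszulD (D : Fin d → M →ₗ[S] M) {m : ℕ}
    (ω : {I : Finset (Fin d) // I.card = m} → M) :
    extendForm (koszulD D m ω) = koszulAll D (extendForm ω) := by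
  funext I
  rw [koszulAll_apply]
  by_cases hI : I.card = m + 1
  · rw [extendForm_apply _ hI, koszulD_apply,
      ← Finset.sum_coe_sort I fun i => wedgeSign d I i • D i (extendForm ω (I.erase i))]
    refine Finset.sum_congr rfl fun i _ => ?_
    rw [extendForm_apply]
  · rw [extendForm, dif_neg hI]
    symm
    refine Finset.sum_eq_zero fun i hi => ?_
    have h : ¬ (I.erase i).card = m := by
      have := Finset.card_erase_add_one hi
      omega
    rw [extendForm, dif_neg h, map_zero, smul_zero]

theorem koszulD_koszulD (D : Fin d → M →ₗ[S] M) (hD : ∀ i j x, D i (D j x) = D j (D i x)) (m : ℕ)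
    (ω : {I : Finset (Fin d) // I.card = m} → M) : koszulD D (m + 1) (koszulD D m ω) = 0 := by
  refine extendForm_injective ?_
  rw [extendForm_koszulD, extendForm_koszulD, koszulAll_koszulAll D hD]
  funext I
  by_cases hI : I.card = m + 1 + 1
  · rw [extendForm_apply _ hI]; rfl
  · rw [extendForm, dif_neg hI]; rfl

/-- The Koszul complex of commuting endomorphisms. -/
def koszulComplex (D : Fin d → M →ₗ[S] M) (hD : ∀ i j x, D i (D j x) = D j (D i x)) :
    SeqComplex.{u, v} S where
  X m := {I : Finset (Fin d) // I.card = m} → M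
  d := koszulD D
  d_d := koszulD_koszulD D hD

/-- A map of modules applied to the coefficients of forms. -/
def formMap {N : Type w} [AddCommGroup N] [Module S N] (f : M →ₗ[S] N) (m : ℕ) :
    ({I : Finset (Fin d) // I.card = m} → M) →ₗ[S] ({I : Finset (Fin d) // I.card = m} → N) :=
  LinearMap.pi fun I => f ∘ₗ LinearMap.proj I

theorem formMap_apply {N : Type w} [AddCommGroup N] [Module S N] (f : M →ₗ[S] N) (m : ℕ)
    (ω : {I : Finset (Fin d) // I.card = m} → M) (I : {I : Finset (Fin d) // I.card = m}) :
    formMap f m ω I = f (ω I) := rfl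

theorem formMap_koszulD {N : Type w} [AddCommGroup N] [Module S N] (f : M →ₗ[S] N)
    (D : Fin d → M →ₗ[S] M) (D' : Fin d → N →ₗ[S] N) (h : ∀ i x, f (D i x) = D' i (f x)) (m : ℕ)
    (ω : {I : Finset (Fin d) // I.card = m} → M) :
    formMap f (m + 1) (koszulD D m ω) = koszulD D' m (formMap f m ω) := by
  funext I
  rw [formMap_apply, koszulD_apply, koszulD_apply, map_sum]
  refine Finset.sum_congr rfl fun i _ => ?_
  rw [map_zsmul, h, formMap_apply]

/-- Contraction with `∂/∂x_i` followed by a right inverse of the `i`-th endomorphism. -/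
def koszulHomotopy (T : Fin d → M →ₗ[S] M) (i : Fin d) (ω : Finset (Fin d) → M) :
    Finset (Fin d) → M :=
  fun J => if i ∈ J then 0 else wedgeSign d (insert i J) i • T i (ω (insert i J))

theorem wedgeSign_mul_self (I : Finset (Fin d)) (i : Fin d) :
    wedgeSign d I i * wedgeSign d I i = 1 := by
  rw [wedgeSign, ← mul_pow]
  simp

theorem koszulAll_koszulHomotopy_of_mem (D T : Fin d → M →ₗ[S] M) (hT : ∀ i x, D i (T i x) = x)
    (ω : Finset (Fin d) → M) {i : Fin d} {J : Finset (Fin d)} (hi : i ∈ J) :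
    koszulAll D (koszulHomotopy T i ω) J = ω J := by
  rw [koszulAll_apply, Finset.sum_eq_single_of_mem i hi]
  · rw [koszulHomotopy, if_neg (Finset.notMem_erase i J), Finset.insert_erase hi, map_zsmul, hT,
      smul_smul, wedgeSign_mul_self, one_smul]
  · intro k hk hki
    rw [koszulHomotopy, if_pos (Finset.mem_erase.2 ⟨hki.symm, hi⟩), map_zero, smul_zero]

/-- The coefficient at `insert i J` of the equation `dω = 0` expresses `D_i ω_J` through the other
coefficients. Applying `T_i`, which commutes with the remaining `D_k`, produces exactly the terms on
the left, up to the sign rule for `dx_i ∧ dx_k`. -/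
theorem koszulAll_koszulHomotopy_of_notMem (D T : Fin d → M →ₗ[S] M)
    (hDT : ∀ i j x, i ≠ j → D j (T i x) = T i (D j x))
    (ω : Finset (Fin d) → M) (hω : koszulAll D ω = 0) {i : Fin d} {J : Finset (Fin d)}
    (hi : i ∉ J) : koszulAll D (koszulHomotopy T i ω) J = T i (D i (ω J)) := by
  have h0 : T i (koszulAll D ω (insert i J)) = 0 := by rw [hω]; exact map_zero _
  rw [koszulAll_apply, Finset.sum_insert hi, Finset.erase_insert hi, map_add, map_zsmul,
    map_sum] at h0
  have h1 : T i (D i (ω J)) = -(wedgeSign d (insert i J) i • ∑ k ∈ J,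
      T i (wedgeSign d (insert i J) k • D k (ω ((insert i J).erase k)))) := by
    rw [← smul_neg, ← eq_neg_of_add_eq_zero_left h0, smul_smul, wedgeSign_mul_self, one_smul]
  rw [h1, koszulAll_apply, Finset.smul_sum, ← Finset.sum_neg_distrib]
  refine Finset.sum_congr rfl fun k hk => ?_
  have hik : i ≠ k := fun h => hi (h ▸ hk)
  have hi' : i ∉ J.erase k := fun h => hi (Finset.mem_of_mem_erase h)
  have he : insert i (J.erase k) = (insert i J).erase k := (Finset.erase_insert_of_ne hik).symm
  rw [koszulHomotopy, if_neg hi', map_zsmul, hDT i k _ hik, smul_smul, map_zsmul, smul_smul,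
    ← neg_smul, he]
  congr 1
  have h2 := wedgeSign_antisymm d (insert i J) (Finset.mem_insert_self i J)
    (Finset.mem_insert_of_mem hk) hik
  rw [Finset.erase_insert hi] at h2
  have h3 := wedgeSign_mul_self (insert i J) i
  have h6 : wedgeSign d J k = -(wedgeSign d (insert i J) i * wedgeSign d (insert i J) k *
      wedgeSign d ((insert i J).erase k) i) := by
    linear_combination wedgeSign d (insert i J) i * h2 - wedgeSign d J k * h3
  rw [h6]
  linear_combination (-(wedgeSign d (insert i J) i * wedgeSign d (insert i J) k)) *
    wedgeSign_mul_self ((insert i J).erase k) i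

/-- If the endomorphisms have right inverses that commute with the other endomorphisms, the
Koszul complex is exact in positive degrees. -/
theorem exists_koszulD_eq (D T : Fin d → M →ₗ[S] M) (hD : ∀ i j x, D i (D j x) = D j (D i x))
    (hT : ∀ i x, D i (T i x) = x) (hDT : ∀ i j x, i ≠ j → D j (T i x) = T i (D j x)) {m : ℕ}
    (ω : {I : Finset (Fin d) // I.card = m + 1} → M) (hω : koszulD D (m + 1) ω = 0) :
    ∃ η, koszulD D m η = ω := by
  have h0 : koszulAll D (extendForm ω) = 0 := by
    rw [← extendForm_koszulD, hω]
    funext I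
    simp [extendForm]
  -- Induction on the set `s` of directions treated so far: `ω` agrees with a boundary in all
  -- components `J` meeting `s`.
  have key : ∀ s : Finset (Fin d), ∃ η : Finset (Fin d) → M, (∀ I, I.card ≠ m → η I = 0) ∧
      ∀ J, ∀ i ∈ s, i ∈ J → extendForm ω J = koszulAll D η J := by
    intro s
    induction s using Finset.induction_on with
    | empty => exact ⟨0, fun _ _ => rfl, fun J i hi => absurd hi (Finset.notMem_empty i)⟩
    | insert k s hk ih =>
      obtain ⟨η, hη1, hη2⟩ := ih
      let ω' := extendForm ω - koszulAll D η
      have hω' : koszulAll D ω' = 0 := by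
        rw [map_sub, h0, koszulAll_koszulAll D hD, sub_zero]
      refine ⟨η + koszulHomotopy T k ω', fun I hI => ?_, fun J i hi hiJ => ?_⟩
      · have h1 : koszulHomotopy T k ω' I = 0 := by
          rw [koszulHomotopy]
          split_ifs with h
          · rfl
          · have h2 : (insert k I).card = I.card + 1 := Finset.card_insert_of_notMem h
            have h3 : ω' (insert k I) = 0 := by
              change extendForm ω _ - koszulAll D η _ = 0
              rw [extendForm, dif_neg (by omega), koszulAll_apply, zero_sub, neg_eq_zero]
              refine Finset.sum_eq_zero fun j hj => ?_
              have h4 := Finset.card_erase_add_one hj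
              rw [hη1 _ (by omega), map_zero, smul_zero]
            rw [h3, map_zero, smul_zero]
        rw [Pi.add_apply, hη1 I hI, h1, add_zero]
      · have h1 : ω' J = koszulAll D (koszulHomotopy T k ω') J := by
          by_cases hkJ : k ∈ J
          · rw [koszulAll_koszulHomotopy_of_mem D T hT _ hkJ]
          · have his : i ∈ s := (Finset.mem_insert.1 hi).resolve_left
              fun h => hkJ (h ▸ hiJ)
            have h2 : ω' J = 0 := sub_eq_zero.2 (hη2 J i his hiJ)
            rw [koszulAll_koszulHomotopy_of_notMem D T hDT ω' hω' hkJ, h2, map_zero, map_zero]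
        rw [map_add, Pi.add_apply, ← h1]
        exact (add_sub_cancel _ _).symm
  obtain ⟨η, hη1, hη2⟩ := key Finset.univ
  refine ⟨fun I => η I.1, extendForm_injective ?_⟩
  have h1 : extendForm (fun I : {I : Finset (Fin d) // I.card = m} => η I.1) = η := by
    funext I
    by_cases hI : I.card = m
    · rw [extendForm_apply _ hI]
    · rw [extendForm, dif_neg hI, hη1 I hI]
  rw [extendForm_koszulD, h1]
  funext J
  -- The component at `∅` is the only one that meets no direction; it vanishes as the degree is
  -- positive.
  obtain rfl | ⟨i, hi⟩ := J.eq_empty_or_nonempty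
  · rw [extendForm, dif_neg (by simp), koszulAll_apply, Finset.sum_empty]
  · exact (hη2 J i (Finset.mem_univ i) hi).symm

/-- Forms of degree zero. -/
def constForm : M →ₗ[S] ({I : Finset (Fin d) // I.card = 0} → M) :=
  LinearMap.pi fun _ => LinearMap.id

theorem koszulD_zero_eq_zero_iff (D : Fin d → M →ₗ[S] M)
    (ω : {I : Finset (Fin d) // I.card = 0} → M) :
    koszulD D 0 ω = 0 ↔ ∀ i, D i (ω ⟨∅, rfl⟩) = 0 := by
  have h1 : ∀ i, koszulD D 0 ω ⟨{i}, rfl⟩ = D i (ω ⟨∅, rfl⟩) := by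
    intro i
    rw [← extendForm_apply (koszulD D 0 ω) (I := {i}) rfl, extendForm_koszulD, koszulAll_apply,
      Finset.sum_singleton, Finset.erase_singleton, extendForm_apply ω (I := ∅) rfl]
    simp [wedgeSign, Finset.filter_singleton]
  constructor
  · intro h i
    rw [← h1, h]
    rfl
  · intro h
    funext ⟨I, hI⟩
    obtain ⟨i, rfl⟩ := Finset.card_eq_one.1 hI
    exact (h1 i).trans (h i)

theorem constForm_eq (ω : {I : Finset (Fin d) // I.card = 0} → M) :
    constForm (S := S) (ω ⟨∅, rfl⟩) = ω := by
  funext ⟨I, hI⟩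
  obtain rfl := Finset.card_eq_zero.1 hI
  rfl

end Koszul

theorem koszulD_jacksonDeriv (R : Type u) [CommRing R] (d m : ℕ) :
    koszulD (fun i => (X - 1 : R[X]) • jacksonDeriv R d i) m = (X - 1 : R[X]) • nablaq R d m := by
  refine LinearMap.ext fun ω => funext fun I => ?_
  rw [koszulD_apply]
  simp only [nablaq, LinearMap.smul_apply, Pi.smul_apply, LinearMap.pi_apply, LinearMap.sum_apply,
    LinearMap.comp_apply, LinearMap.proj_apply, Finset.smul_sum]
  exact Finset.sum_congr rfl fun i _ => smul_comm _ _ _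

/-! ### Homotopy limits over categories with a Čech cover of the final object -/

section CechCover

universe t x

/-- A functor `pts` of points, all of whose values are non-empty, together with objects `U n`
that represent `j ↦ pts j ^ (n + 1)`. -/
structure CechCover (J : Type v) [Category.{w} J] where
  /-- the points of an object -/
  pts : J → Type x
  /-- the images of points under a morphism -/
  push : ∀ {j k : J}, (j ⟶ k) → pts j → pts k
  push_id : ∀ (j : J) (a : pts j), push (𝟙 j) a = a
  push_comp : ∀ {j k l : J} (f : j ⟶ k) (g : k ⟶ l) (a : pts j),
    push (f ≫ g) a = push g (push f a)
  /-- a point of each object -/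
  point : ∀ j, pts j
  /-- the representing objects -/
  U : ℕ → J
  /-- the universal points -/
  univ : ∀ n, Fin (n + 1) → pts (U n)
  /-- the morphism attached to a family of points -/
  desc : ∀ {n : ℕ} {j : J}, (Fin (n + 1) → pts j) → (U n ⟶ j)
  push_desc : ∀ {n : ℕ} {j : J} (w : Fin (n + 1) → pts j) (a : Fin (n + 1)),
    push (desc w) (univ n a) = w a
  hom_ext : ∀ {n : ℕ} {j : J} {f g : U n ⟶ j}, (∀ a, push f (univ n a) = push g (univ n a)) → f = g

theorem succAbove_succAbove {n : ℕ} {i j : Fin (n + 2)} (h : i ≤ j) (k : Fin (n + 1)) :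
    j.succ.succAbove (i.succAbove k) = i.castSucc.succAbove (j.succAbove k) :=
  DFunLike.congr_fun (congrArg SimplexCategory.Hom.toOrderHom (SimplexCategory.δ_comp_δ h)) k

variable {S : Type u} [CommRing S] {J : Type v} [Category.{w} J]

/-- The coface of standard simplices, as a monotone map. -/
def cofaceHom {n : ℕ} (i : Fin (n + 2)) : Fin (n + 1) →o Fin (n + 2) :=
  (SimplexCategory.δ i).toOrderHom

theorem cofaceHom_comp {n : ℕ} {i j : Fin (n + 2)} (h : i ≤ j) :
    (cofaceHom j.succ).comp (cofaceHom i) = (cofaceHom i.castSucc).comp (cofaceHom j) :=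
  OrderHom.ext _ _ (funext fun k => succAbove_succAbove h k)

/-- The monotone map `0 ↦ 0`, `k + 1 ↦ f k + 1`. -/
def consHom {p q : ℕ} (f : Fin (p + 1) →o Fin (q + 1)) : Fin (p + 2) →o Fin (q + 2) where
  toFun := Fin.cons 0 fun k => (f k).succ
  monotone' := by
    intro a b h
    cases a using Fin.cases with
    | zero => rw [Fin.cons_zero]; exact Fin.zero_le _
    | succ a =>
      cases b using Fin.cases with
      | zero => exact absurd h (by simp)
      | succ b =>
        rw [Fin.cons_succ, Fin.cons_succ]
        exact Fin.succ_le_succ_iff.2 (f.monotone (Fin.succ_le_succ_iff.1 h))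

/-- Cofaces of positive index fix the first vertex; they are therefore compatible with prepending an
object to a chain. -/
theorem cofaceHom_succ {n : ℕ} (i : Fin (n + 2)) : cofaceHom i.succ = consHom (cofaceHom i) := by
  refine OrderHom.ext _ _ (funext fun k => ?_)
  cases k using Fin.cases with
  | zero => exact Fin.succ_succAbove_zero i
  | succ k => exact Fin.succ_succAbove_succ i k

/-- The semi-cosimplicial module underlying the cosimplicial replacement. -/
def replacementSemi (F : J ⥤ ModuleCat.{t} S) : SemiCosimplicial.{u, max v w t} S where
  X p := ∀ σ : ComposableArrows J p, F.obj (σ.obj (Fin.last p))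
  δ _ i := ((cosimplicialReplacement F).δ i).hom
  δ_δ _ _ _ h x := ConcreteCategory.congr_hom
    ((cosimplicialReplacement F).δ_comp_δ h) x

theorem represents_replacement (F : J ⥤ ModuleCat.{t} S) : SeqComplex.Represents
    ((AlgebraicTopology.alternatingCofaceMapComplex _).obj (cosimplicialReplacement F))
    (replacementSemi F).toSeq := by
  have h : ∀ n, ((AlgebraicTopology.alternatingCofaceMapComplex _).obj
      (cosimplicialReplacement F)).d n (n + 1) =
      ∑ i : Fin (n + 2), (-1 : ℤ) ^ (i : ℕ) • (cosimplicialReplacement F).δ i := fun n =>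
    CochainComplex.of_d (fun n => (cosimplicialReplacement F).obj (SimplexCategory.mk n))
      (AlgebraicTopology.AlternatingCofaceMapComplex.objD (cosimplicialReplacement F)) n
  have h2 : ∀ n, (∑ i : Fin (n + 2), (-1 : ℤ) ^ (i : ℕ) • (cosimplicialReplacement F).δ i).hom =
      ∑ i : Fin (n + 2), (-1 : ℤ) ^ (i : ℕ) • ((cosimplicialReplacement F).δ i).hom := fun n => by
    simp only [ModuleCat.hom_sum, ModuleCat.hom_zsmul]
  exact ⟨fun n => LinearEquiv.refl _ _, fun n x =>
    DFunLike.congr_fun ((congrArg ModuleCat.Hom.hom (h n)).trans (h2 n)) x⟩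

namespace CechCover

variable (c : CechCover.{v, w, x} J) (F : J ⥤ ModuleCat.{t} S)

/-- The families in bidegree `(p, n)`. -/
abbrev biX (p n : ℕ) : Type (max v w t x) :=
  ∀ (σ : ComposableArrows J p) (_ : Fin (n + 1) → c.pts (σ.obj 0)), F.obj (σ.obj (Fin.last p))

/-- The action of monotone maps on families. -/
def biMap {p q : ℕ} (n : ℕ) (f : Fin (p + 1) →o Fin (q + 1)) :
    c.biX F p n →ₗ[S] c.biX F q n where
  toFun s σ w := (F.map (σ.map (homOfLE (Fin.le_last (f (Fin.last p)))))).hom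
    (s (f.monotone.functor ⋙ σ) fun a => c.push (σ.map (homOfLE (Fin.zero_le (f 0)))) (w a))
  map_add' s s' := by
    funext σ w
    exact map_add _ _ _
  map_smul' r s := by
    funext σ w
    exact map_smul _ _ _

theorem biMap_comp {p q r : ℕ} (n : ℕ) (f : Fin (p + 1) →o Fin (q + 1))
    (g : Fin (q + 1) →o Fin (r + 1)) (s : c.biX F p n) :
    c.biMap F n g (c.biMap F n f s) = c.biMap F n (g.comp f) s := by
  funext σ w
  have h1 : ∀ a, c.push ((g.monotone.functor ⋙ σ).map (homOfLE (Fin.zero_le (f 0))))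
      (c.push (σ.map (homOfLE (Fin.zero_le (g 0)))) (w a)) =
      c.push (σ.map (homOfLE (Fin.zero_le (g (f 0))))) (w a) := by
    intro a
    rw [← homOfLE_comp (Fin.zero_le (g 0)) (g.monotone (Fin.zero_le (f 0))), σ.map_comp,
      c.push_comp]
    rfl
  have h2 := map_homOfLE_trans (F := F) (σ := σ)
    (g.monotone (Fin.le_last (f (Fin.last p)))) (Fin.le_last (g (Fin.last q)))
    (s ((g.comp f).monotone.functor ⋙ σ)
      fun a => c.push (σ.map (homOfLE (Fin.zero_le (g (f 0))))) (w a))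
  exact (congrArg (fun w' : Fin (n + 1) → c.pts (σ.obj (g (f 0))) =>
    (F.map (σ.map (homOfLE (Fin.le_last (g (Fin.last q)))))).hom
      ((F.map (σ.map (homOfLE (g.monotone (Fin.le_last (f (Fin.last p))))))).hom
        (s ((g.comp f).monotone.functor ⋙ σ) w'))) (funext h1)).trans h2.symm

/-- The semi-cosimplicial module in the first direction. -/
def biH (n : ℕ) : SemiCosimplicial.{u, max v w t x} S where
  X p := c.biX F p n
  δ p i := c.biMap F n (cofaceHom i)
  δ_δ p i j h s := by
    rw [biMap_comp, biMap_comp, cofaceHom_comp h]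

/-- The semi-cosimplicial module in the second direction. -/
def biV (p : ℕ) : SemiCosimplicial.{u, max v w t x} S where
  X n := c.biX F p n
  δ n i :=
    { toFun := fun s σ w => s σ (w ∘ i.succAbove)
      map_add' := fun _ _ => rfl
      map_smul' := fun _ _ => rfl }
  δ_δ n i j h s := by
    funext σ w
    exact congrArg (s σ) (funext fun k => congrArg w (succAbove_succAbove h k))

theorem biH_biV (p n : ℕ) (s : c.biX F p n) :
    (c.biH F (n + 1)).altD p ((c.biV F p).altD n s) =
      (c.biV F (p + 1)).altD n ((c.biH F n).altD p s) :=
  (c.biV F p).altD_comm (L := c.biV F (p + 1)) ((c.biH F n).altD p) ((c.biH F (n + 1)).altD p)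
    (fun i => fun s => ((c.biH F n).altD_comm (L := c.biH F (n + 1)) ((c.biV F p).δ n i)
      ((c.biV F (p + 1)).δ n i) (fun _ _ => rfl) s).symm) s

/-- The double complex comparing the homotopy limit and the Čech complex. -/
def biComplex : DoubleComplex.{u, max v w t x} S :=
  DoubleComplex.ofComm (fun p n => c.biX F p n) (fun p n => (c.biH F n).altD p)
    (fun p n => (c.biV F p).altD n) (fun _ n => (c.biH F n).altD_altD _)
    (fun p _ => (c.biV F p).altD_altD _) (c.biH_biV F)

end CechCover

end CechCover

/-! ### Augmented double complexes with commuting differentials -/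

namespace DoubleComplex

variable {S : Type u} [CommRing S] (X : ℕ → ℕ → Type v) [∀ p n, AddCommGroup (X p n)]
  [∀ p n, Module S (X p n)] (dh : ∀ p n, X p n →ₗ[S] X (p + 1) n)
  (dv : ∀ p n, X p n →ₗ[S] X p (n + 1))
  (dh_dh : ∀ p n x, dh (p + 1) n (dh p n x) = 0) (dv_dv : ∀ p n x, dv p (n + 1) (dv p n x) = 0)
  (comm : ∀ p n x, dh p (n + 1) (dv p n x) = dv (p + 1) n (dh p n x))

/-- A double complex with columns exact in positive degrees is quasi-isomorphic to the complex of
the kernels. -/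
theorem exists_isQuasiIso_ofComm (E : SeqComplex.{u, w} S) (ε : ∀ p, E.X p →ₗ[S] X p 0)
    (hexact : ∀ p n (x : X p (n + 1)), dv p (n + 1) x = 0 → ∃ y, dv p n y = x)
    (ε_inj : ∀ p, Function.Injective (ε p)) (dv_ε : ∀ p e, dv p 0 (ε p e) = 0)
    (ker_ε : ∀ p x, dv p 0 x = 0 → ∃ e, ε p e = x)
    (ε_comm : ∀ p e, ε (p + 1) (E.d p e) = dh p 0 (ε p e)) :
    ∃ f, SeqComplex.IsQuasiIso E (ofComm X dh dv dh_dh dv_dv comm).total f := by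
  have hs : ∀ (p n : ℕ) (x : X p n), ((-1 : ℤ) ^ p • dv p n) x = (-1 : ℤ) ^ p • dv p n x :=
    fun _ _ _ => rfl
  -- The sign `(-1)^p` of `ofComm` alters neither kernels nor images.
  have h0 : ∀ (p n : ℕ) (x : X p n), ((-1 : ℤ) ^ p • dv p n) x = 0 → dv p n x = 0 := by
    intro p n x h
    rw [hs] at h
    rcases neg_one_pow_eq_or ℤ p with e | e
    · rwa [e, one_smul] at h
    · rwa [e, neg_one_smul, neg_eq_zero] at h
  refine ⟨_, isQuasiIso_single (ofComm X dh dv dh_dh dv_dv comm) E ε ?_ ε_inj ?_ ?_ ε_comm⟩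
  · intro p n x hx
    obtain ⟨y, hy⟩ := hexact p n x (h0 p (n + 1) x hx)
    refine ⟨(-1 : ℤ) ^ p • y, (hs p n _).trans ?_⟩
    rw [map_zsmul, smul_smul, ← mul_pow, hy, neg_mul_neg, one_mul, one_pow]
    exact one_smul ℤ (show X p (n + 1) from x)
  · intro p e
    exact (hs p 0 _).trans ((congrArg ((-1 : ℤ) ^ p • ·) (dv_ε p e)).trans (smul_zero _))
  · exact fun p x hx => ker_ε p x (h0 p 0 x hx)

/-- A double complex with rows exact in positive degrees is quasi-isomorphic to the complex of
the kernels. -/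
theorem exists_isQuasiIso_flip_ofComm (E : SeqComplex.{u, w} S) (ε : ∀ n, E.X n →ₗ[S] X 0 n)
    (hexact : ∀ p n (x : X (p + 1) n), dh (p + 1) n x = 0 → ∃ y, dh p n y = x)
    (ε_inj : ∀ n, Function.Injective (ε n)) (dh_ε : ∀ n e, dh 0 n (ε n e) = 0)
    (ker_ε : ∀ n x, dh 0 n x = 0 → ∃ e, ε n e = x)
    (ε_comm : ∀ n e, ε (n + 1) (E.d n e) = dv 0 n (ε n e)) :
    ∃ f, SeqComplex.IsQuasiIso E (ofComm X dh dv dh_dh dv_dv comm).flip.total f := by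
  refine ⟨_, isQuasiIso_single (ofComm X dh dv dh_dh dv_dv comm).flip E ε
    (fun p n x hx => hexact n p x hx) ε_inj dh_ε ker_ε fun n e => (ε_comm n e).trans ?_⟩
  change _ = (-1 : ℤ) ^ 0 • dv 0 n (ε n e)
  rw [pow_zero, one_smul]

end DoubleComplex

/-! ### Contractions of the double complex; the homotopy limit as a Čech complex -/

section CechCover

universe t x

/-- The monotone map `k ↦ k + 1`. -/
def succHom (p : ℕ) : Fin (p + 1) →o Fin (p + 2) where
  toFun := Fin.succ
  monotone' _ _ h := Fin.succ_le_succ_iff.2 h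

theorem cofaceHom_zero (p : ℕ) : cofaceHom (0 : Fin (p + 2)) = succHom p :=
  OrderHom.ext _ _ (funext fun k => congrFun Fin.succAbove_zero k)

variable {S : Type u} [CommRing S] {J : Type v} [Category.{w} J]

/-- Families over chains, transported along an equality of chains. -/
theorem CechCover.map_family_congr (c : CechCover.{v, w, x} J) (F : J ⥤ ModuleCat.{t} S) {p n : ℕ}
    (s : c.biX F p n) {σ σ' : ComposableArrows J p} (h : σ = σ') {k : J}
    (g : σ.obj (Fin.last p) ⟶ k) (g' : σ'.obj (Fin.last p) ⟶ k)
    (hg : g = eqToHom (by rw [h]) ≫ g') (a : Fin (n + 1) → c.pts (σ.obj 0))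
    (a' : Fin (n + 1) → c.pts (σ'.obj 0))
    (ha : ∀ i, a' i = c.push (eqToHom (by rw [h])) (a i)) :
    (F.map g).hom (s σ a) = (F.map g').hom (s σ' a') := by
  subst h
  obtain rfl : a' = a := funext fun i => (ha i).trans (c.push_id _ _)
  rw [hg, eqToHom_refl, Category.id_comp]

theorem precomp_map_zero_succ {p : ℕ} (σ : ComposableArrows J p) {j : J} (g : j ⟶ σ.obj 0)
    (k : Fin (p + 1)) : (σ.precomp g).map (homOfLE (Fin.zero_le k.succ)) =
      g ≫ σ.map (homOfLE (Fin.zero_le k)) := by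
  obtain ⟨k, hk⟩ := k
  cases k with
  | zero => exact (Category.comp_id g).symm.trans (congrArg (g ≫ ·) (σ.map_id 0).symm)
  | succ k => rfl

/-- Reindexing a chain with a prepended object along `consHom f` prepends the same object to the
chain reindexed along `f`; the first arrow is composed up to the vertex `f 0`. -/
theorem consHom_functor_precomp {p q : ℕ} (f : Fin (p + 1) →o Fin (q + 1))
    (σ : ComposableArrows J q) {j : J} (g : j ⟶ σ.obj 0) :
    (show ComposableArrows J (p + 1) from (consHom f).monotone.functor ⋙ σ.precomp g) =
      ComposableArrows.precomp (show ComposableArrows J p from f.monotone.functor ⋙ σ)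
        (show j ⟶ σ.obj (f 0) from g ≫ σ.map (homOfLE (Fin.zero_le (f 0)))) := by
  refine ComposableArrows.ext_succ rfl rfl ?_
  refine Eq.trans ?_ ((Category.id_comp _).trans (Category.comp_id _)).symm
  exact precomp_map_zero_succ σ g (f 0)

namespace CechCover

variable (c : CechCover.{v, w, x} J) (F : J ⥤ ModuleCat.{t} S)

theorem desc_comp {n : ℕ} {j k : J} (a : Fin (n + 1) → c.pts j) (g : j ⟶ k) :
    c.desc a ≫ g = c.desc fun i => c.push g (a i) :=
  c.hom_ext fun i => by rw [c.push_comp, c.push_desc, c.push_desc]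

theorem desc_univ (n : ℕ) : c.desc (c.univ n) = 𝟙 (c.U n) :=
  c.hom_ext fun i => by rw [c.push_desc, c.push_id]

/-- The morphism `U n → U m` attached to a map of indices. -/
def θ {n m : ℕ} (f : Fin (n + 1) → Fin (m + 1)) : c.U n ⟶ c.U m := c.desc (c.univ m ∘ f)

theorem push_θ {n m : ℕ} (f : Fin (n + 1) → Fin (m + 1)) (a : Fin (n + 1)) :
    c.push (c.θ f) (c.univ n a) = c.univ m (f a) :=
  c.push_desc _ a

theorem θ_desc {n m : ℕ} {j : J} (f : Fin (n + 1) → Fin (m + 1)) (a : Fin (m + 1) → c.pts j) :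
    c.θ f ≫ c.desc a = c.desc (a ∘ f) :=
  c.hom_ext fun i => by rw [c.push_comp, c.push_θ, c.push_desc, c.push_desc]; rfl

theorem θ_comp {n m k : ℕ} (f : Fin (n + 1) → Fin (m + 1)) (g : Fin (m + 1) → Fin (k + 1)) :
    c.θ f ≫ c.θ g = c.θ (g ∘ f) := c.θ_desc f _

/-- The Čech complex, as a semi-cosimplicial module. -/
def cechSemi : SemiCosimplicial.{u, t} S where
  X n := F.obj (c.U n)
  δ _ i := (F.map (c.θ i.succAbove)).hom
  δ_δ n i j h x := by
    have := congrArg F.map (congrArg c.θ (funext fun k => succAbove_succAbove h k :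
      j.succ.succAbove ∘ i.succAbove = i.castSucc.succAbove ∘ j.succAbove))
    rw [← c.θ_comp, ← c.θ_comp, F.map_comp, F.map_comp] at this
    exact ConcreteCategory.congr_hom this x

/-- For a fixed chain this is the cochain complex of functions on powers of a non-empty set,
contracted by inserting a chosen point. The choice need not be natural, as the chain does not vary.
-/
theorem biV_exact (p n : ℕ) (s : c.biX F p (n + 1)) (hs : (c.biV F p).altD (n + 1) s = 0) :
    ∃ y, (c.biV F p).altD n y = s := by
  let h : ∀ n, c.biX F p (n + 1) →ₗ[S] c.biX F p n := fun n =>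
    { toFun := fun s σ w => s σ (Fin.cons (c.point _) w)
      map_add' := fun _ _ => rfl
      map_smul' := fun _ _ => rfl }
  refine ⟨h n s, (c.biV F p).exact_of_contraction h (fun n s => ?_) (fun n i s => ?_) n s hs⟩
  · funext σ w
    refine congrArg (s σ) (funext fun k => ?_)
    change (Fin.cons _ w : Fin (n + 2) → _) ((0 : Fin (n + 2)).succAbove k) = _
    rw [Fin.succAbove_zero, Fin.cons_succ]
  · funext σ w
    refine congrArg (s σ) (funext fun k => ?_)
    change (Fin.cons _ w : Fin (n + 3) → _) (i.succ.succAbove k) =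
      (Fin.cons _ (w ∘ i.succAbove) : Fin (n + 2) → _) k
    cases k using Fin.cases with
    | zero => rw [Fin.succ_succAbove_zero, Fin.cons_zero, Fin.cons_zero]
    | succ k => rw [Fin.succ_succAbove_succ, Fin.cons_succ, Fin.cons_succ]; rfl

/-- The homotopy limit maps to the double complex by a quasi-isomorphism. -/
theorem exists_isQuasiIso_replacement :
    ∃ f, SeqComplex.IsQuasiIso (replacementSemi F).toSeq (c.biComplex F).total f := by
  let ε : ∀ p, (replacementSemi F).X p →ₗ[S] c.biX F p 0 := fun p =>
    { toFun := fun s σ _ => s σ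
      map_add' := fun _ _ => rfl
      map_smul' := fun _ _ => rfl }
  refine DoubleComplex.exists_isQuasiIso_ofComm _ _ _ _ _ _ (replacementSemi F).toSeq ε
    (c.biV_exact F) (fun p s s' h => ?_) (fun p s => ?_) (fun p s hs => ?_) (fun p s => ?_)
  · funext σ
    exact congrFun (congrFun h σ) fun _ => c.point _
  · exact ((c.biV F p).altD_zero_eq_zero_iff (ε p s)).2 rfl
  -- A cocycle takes equal values at any two points, so it is constant in the point.
  · have h := ((c.biV F p).altD_zero_eq_zero_iff s).1 hs
    refine ⟨fun σ => s σ fun _ => c.point _, ?_⟩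
    funext σ w
    have h1 := congrFun (congrFun h σ) (Fin.cons (c.point _) w)
    refine Eq.trans ?_ (h1.symm.trans ?_)
    · refine congrArg (s σ) (funext fun k => ?_)
      obtain rfl : k = 0 := Subsingleton.elim (α := Fin 1) _ _
      rfl
    · refine congrArg (s σ) (funext fun k => ?_)
      obtain rfl : k = 0 := Subsingleton.elim (α := Fin 1) _ _
      rfl
  · exact (replacementSemi F).altD_comm (L := c.biH F 0) (ε p) (ε (p + 1)) (fun _ _ => rfl) s

/-- The contraction of the double complex in the first direction. -/
def biContract (n p : ℕ) : c.biX F (p + 1) n →ₗ[S] c.biX F p n where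
  toFun s σ w := s (σ.precomp (c.desc w)) (c.univ n)
  map_add' _ _ := rfl
  map_smul' _ _ := rfl

theorem biContract_zero (n p : ℕ) (s : c.biX F p n) :
    c.biContract F n p (c.biMap F n (cofaceHom 0) s) = s := by
  rw [cofaceHom_zero]
  funext σ w
  -- An identity is inserted so that both sides have the shape required by `map_family_congr`.
  have h : s σ w = (F.map (𝟙 (σ.obj (Fin.last p)))).hom (s σ w) := by
    rw [F.map_id]
    rfl
  rw [h]
  refine c.map_family_congr F s
    (show (show ComposableArrows J p from (succHom p).monotone.functor ⋙
      σ.precomp (c.desc w)) = σ from rfl) _ _ ?_ _ _ fun i => ?_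
  · exact ((σ.precomp (c.desc w)).map_id _).trans (Category.comp_id _).symm
  · refine Eq.symm ((c.push_id _ _).trans ?_)
    have h := (precomp_map_zero_succ σ (c.desc w) 0).trans
      ((congrArg (c.desc w ≫ ·) (σ.map_id 0)).trans (Category.comp_id _))
    exact (congrArg (fun g => c.push g (c.univ n i)) h).trans (c.push_desc w i)

theorem biContract_succ (n p : ℕ) (i : Fin (p + 2)) (s : c.biX F (p + 1) n) :
    c.biContract F n (p + 1) (c.biMap F n (cofaceHom i.succ) s) =
      c.biMap F n (cofaceHom i) (c.biContract F n p s) := by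
  rw [cofaceHom_succ]
  generalize cofaceHom i = f
  funext σ w
  have h := consHom_functor_precomp f σ (c.desc w)
  rw [show (show c.U n ⟶ σ.obj (f 0) from c.desc w ≫ σ.map (homOfLE (Fin.zero_le (f 0)))) =
    c.desc (fun a => c.push (σ.map (homOfLE (Fin.zero_le (f 0)))) (w a)) from
      c.desc_comp w _] at h
  refine c.map_family_congr F s h _ _ ?_ _ _ fun i => ?_
  · exact (Category.id_comp _).symm
  · refine Eq.symm ((c.push_id _ _).trans ?_)
    exact (congrArg (fun g => c.push g (c.univ n i)) ((σ.precomp (c.desc w)).map_id 0)).trans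
      (c.push_id _ _)

/-- A tuple of points of `σ 0` is a morphism from `U n`. Prepending it to the chain and replacing
the tuple by the universal one is an extra codegeneracy. -/
theorem biH_exact (p n : ℕ) (s : c.biX F (p + 1) n) (hs : (c.biH F n).altD (p + 1) s = 0) :
    ∃ y, (c.biH F n).altD p y = s :=
  ⟨c.biContract F n p s, (c.biH F n).exact_of_contraction (c.biContract F n)
    (c.biContract_zero F n) (c.biContract_succ F n) p s hs⟩

/-- The augmentation of the double complex by the Čech complex. -/
def biAug (n : ℕ) : F.obj (c.U n) →ₗ[S] c.biX F 0 n where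
  toFun x _ w := (F.map (c.desc w)).hom x
  map_add' _ _ := funext fun _ => funext fun _ => map_add _ _ _
  map_smul' _ _ := funext fun _ => funext fun _ => map_smul _ _ _

theorem biMap_biAug {p : ℕ} (n : ℕ) (f : Fin 1 →o Fin (p + 1)) (x : F.obj (c.U n))
    (σ : ComposableArrows J p) (w : Fin (n + 1) → c.pts (σ.obj 0)) :
    c.biMap F n f (c.biAug F n x) σ w =
      (F.map (c.desc w ≫ σ.map (homOfLE (Fin.zero_le (Fin.last p))))).hom x := by
  have h : c.desc w ≫ σ.map (homOfLE (Fin.zero_le (Fin.last p))) =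
      c.desc (fun a => c.push (σ.map (homOfLE (Fin.zero_le (f 0)))) (w a)) ≫
        σ.map (homOfLE (Fin.le_last (f 0))) := by
    rw [← c.desc_comp, Category.assoc, ← σ.map_comp]
    rfl
  rw [h, F.map_comp]
  rfl

/-- The coface at index `1` omits the old start of the chain, leaving only `U n` with its universal
points. Together with `biContract_zero` this shows that cocycles for `p = 0` are determined by one
element of `F (U n)`. -/
theorem biContract_one (n : ℕ) (s : c.biX F 0 n) :
    c.biContract F n 0 (c.biMap F n (cofaceHom 1) s) =
      c.biAug F n (s (ComposableArrows.mk₀ (c.U n)) (c.univ n)) := by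
  funext σ w
  have h : (show ComposableArrows J 0 from (cofaceHom (1 : Fin 2)).monotone.functor ⋙
      σ.precomp (c.desc w)) = ComposableArrows.mk₀ (c.U n) := ComposableArrows.ext₀ rfl
  refine c.map_family_congr F s h _ (c.desc w) ?_ _ _ fun i => ?_
  · refine Eq.trans ?_ (Category.id_comp _).symm
    exact (precomp_map_zero_succ σ (c.desc w) 0).trans
      ((congrArg (c.desc w ≫ ·) (σ.map_id 0)).trans (Category.comp_id _))
  · refine Eq.symm ((c.push_id _ _).trans ?_)
    exact (congrArg (fun g => c.push g (c.univ n i)) ((σ.precomp (c.desc w)).map_id 0)).trans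
      (c.push_id _ _)

/-- The Čech complex maps to the double complex by a quasi-isomorphism. -/
theorem exists_isQuasiIso_cech :
    ∃ f, SeqComplex.IsQuasiIso (c.cechSemi F).toSeq (c.biComplex F).flip.total f := by
  refine DoubleComplex.exists_isQuasiIso_flip_ofComm _ _ _ _ _ _ (c.cechSemi F).toSeq (c.biAug F)
    (c.biH_exact F) (fun n x y h => ?_) (fun n x => ?_) (fun n s hs => ?_) (fun n x => ?_)
  · have h1 : ∀ x : F.obj (c.U n), (F.map (c.desc (c.univ n))).hom x = x := by
      intro x
      rw [c.desc_univ, F.map_id]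
      rfl
    rw [← h1 x, ← h1 y]
    exact congrFun (congrFun h (ComposableArrows.mk₀ (c.U n))) (c.univ n)
  · refine ((c.biH F n).altD_zero_eq_zero_iff _).2 (funext fun σ => funext fun w => ?_)
    exact (c.biMap_biAug F n (cofaceHom 0) x σ w).trans
      (c.biMap_biAug F n (cofaceHom 1) x σ w).symm
  · have h := ((c.biH F n).altD_zero_eq_zero_iff s).1 hs
    refine ⟨s (ComposableArrows.mk₀ (c.U n)) (c.univ n), ?_⟩
    exact (c.biContract_one F n s).symm.trans ((congrArg (c.biContract F n 0) h).symm.trans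
      (c.biContract_zero F n 0 s))
  · refine (c.cechSemi F).altD_comm (L := c.biV F 0) (c.biAug F n) (c.biAug F (n + 1))
      (fun i x => funext fun σ => funext fun w => ?_) x
    have h := congrArg F.map (c.θ_desc i.succAbove w)
    rw [F.map_comp] at h
    exact ConcreteCategory.congr_hom h x

end CechCover

end CechCover

/-! ### The Čech cover of `Strat` by polynomial points -/

section StratCover

variable (R : Type u) [CommRing R] {d : ℕ}

/-- The morphism out of a polynomial ring attached to a family of elements of an
`R[q]`-algebra. -/
noncomputable def pointHom {B : Type u} [CommRing B] [Algebra R[X] B] (b : Fin d → B) :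
    MvPolynomial (Fin d) R →+* B :=
  MvPolynomial.eval₂Hom ((algebraMap R[X] B).comp C) b

theorem pointHom_C {B : Type u} [CommRing B] [Algebra R[X] B] (b : Fin d → B) (r : R) :
    pointHom R b (algebraMap R _ r) = algebraMap R[X] B (C r) :=
  MvPolynomial.eval₂Hom_C _ _ r

theorem pointHom_X {B : Type u} [CommRing B] [Algebra R[X] B] (b : Fin d → B) (i : Fin d) :
    pointHom R b (MvPolynomial.X i) = b i :=
  MvPolynomial.eval₂Hom_X' _ _ i

variable (d) in
/-- The ring of functions on `n + 1` points that agree modulo `q - 1`. -/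
abbrev CechRing (n : ℕ) : Type u := QRing R (Prod.snd : Fin n × Fin d → Fin d)

/-- The coordinates of the universal points. -/
noncomputable def CechRing.coord {n : ℕ} (a : Fin (n + 1)) (i : Fin d) : CechRing R d n :=
  Fin.lastCases (motive := fun _ => CechRing R d n) (QRing.base R _ i)
    (fun k => QRing.pt R _ (k, i)) a

theorem CechRing.coord_last {n : ℕ} (i : Fin d) :
    CechRing.coord R (Fin.last n) i = QRing.base R _ i :=
  Fin.lastCases_last

theorem CechRing.coord_castSucc {n : ℕ} (k : Fin n) (i : Fin d) :
    CechRing.coord R k.castSucc i = QRing.pt R _ (k, i) :=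
  Fin.lastCases_castSucc k

/-- With the base placed last, the first of at least two points always has free coordinates `y`, on
which the difference operators act. -/
theorem CechRing.coord_zero {n : ℕ} (i : Fin d) :
    CechRing.coord R (0 : Fin (n + 1 + 1)) i = QRing.pt R _ (0, i) :=
  CechRing.coord_castSucc R 0 i

theorem CechRing.mk_coord {n : ℕ} (a : Fin (n + 1)) (i : Fin d) :
    Ideal.Quotient.mk (qIdeal R (CechRing R d n)) (CechRing.coord R a i) =
      Ideal.Quotient.mk (qIdeal R (CechRing R d n)) (QRing.base R _ i) := by
  cases a using Fin.lastCases with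
  | last => rw [coord_last]
  | cast k =>
    rw [coord_castSucc, Ideal.Quotient.eq]
    obtain ⟨z, hz⟩ := QRing.exists_pt_sub_base (R := R) (c := (Prod.snd : Fin n × Fin d → Fin d))
      (k, i)
    exact Ideal.mem_span_singleton.2 ⟨z, hz⟩

variable [LambdaRing R]

theorem isLambdaHom_pointHom {B : Type u} [CommRing B] [LambdaRing B] [Algebra R[X] B]
    [LambdaAlgebra R[X] B] {b : Fin d → B} (hb : ∀ i, IsRankOne (b i)) :
    IsLambdaHom (pointHom R b) := by
  intro n a
  have h : (pointHom R b).comp (psi n : MvPolynomial (Fin d) R →+* _) =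
      (psi n : B →+* B).comp (pointHom R b) := by
    refine MvPolynomial.ringHom_ext (fun r => ?_) (fun i => ?_)
    · rw [RingHom.comp_apply, RingHom.comp_apply, ← MvPolynomial.algebraMap_eq,
        ← (MvPolynomial.instLambdaAlgebra (R := R)).isLambdaHom n r, pointHom_C, pointHom_C,
        ← LambdaAlgebra.isLambdaHom n (C r)]
      exact congrArg _ ((Polynomial.instLambdaAlgebra (R := R)).isLambdaHom n r)
    · rw [RingHom.comp_apply, RingHom.comp_apply, MvPolynomial.isRankOne_X i n, map_pow,
        pointHom_X, hb i n]
  exact DFunLike.congr_fun h a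

theorem CechRing.isRankOne_coord {n : ℕ} (a : Fin (n + 1)) (i : Fin d) :
    IsRankOne (CechRing.coord R a i) := by
  cases a using Fin.lastCases with
  | last => rw [coord_last]; exact QRing.isRankOne_base i
  | cast k => rw [coord_castSucc]; exact QRing.isRankOne_pt _

variable (d) in
/-- The ring `CechRing` as an object of `Strat`. -/
noncomputable def cechObject (n : ℕ) : Strat R (MvPolynomial (Fin d) R) where
  carrier := CechRing R d n
  toQuotient := (Ideal.Quotient.mk _).comp (pointHom R (QRing.base R _))
  toQuotient_algebraMap r := by rw [RingHom.comp_apply, pointHom_C]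
  toQuotient_psi m a := by
    rw [RingHom.comp_apply, isLambdaHom_pointHom R QRing.isRankOne_base, RingHom.comp_apply,
      psiReduction, Ideal.quotientMap_mk]
  exists_lift := ⟨pointHom R (QRing.base R _), isLambdaHom_pointHom R QRing.isRankOne_base,
    pointHom_C R _, rfl⟩

/-- The rank one lifts of the coordinates to an object of `Strat`. -/
def StratPoint (B : Strat R (MvPolynomial (Fin d) R)) : Type u :=
  {b : Fin d → B.carrier // (∀ i, IsRankOne (b i)) ∧
    ∀ i, Ideal.Quotient.mk (qIdeal R B.carrier) (b i) = B.toQuotient (MvPolynomial.X i)}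

namespace StratPoint

variable {R}

/-- The image of a point under a morphism. -/
noncomputable def push {B B' : Strat R (MvPolynomial (Fin d) R)} (f : B ⟶ B') (b : StratPoint R B) :
    StratPoint R B' :=
  ⟨fun i => f.toAlgHom (b.1 i), fun i n => by
    rw [← map_pow, ← b.2.1 i n]
    exact (f.isLambdaHom n (b.1 i)).symm, fun i => by
    rw [← f.comp_toQuotient, RingHom.comp_apply, ← b.2.2 i]
    rfl⟩

/-- This is where the existence of a lift `A → B` enters: the images of the `x_i` have rank one. -/
theorem nonempty (B : Strat R (MvPolynomial (Fin d) R)) : Nonempty (StratPoint R B) := by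
  obtain ⟨g, hg, _, h⟩ := B.exists_lift
  refine ⟨⟨fun i => g (MvPolynomial.X i), fun i n => ?_, fun i => ?_⟩⟩
  · rw [← hg, MvPolynomial.isRankOne_X i n, map_pow]
  · exact DFunLike.congr_fun h (MvPolynomial.X i)

/-- The universal points. -/
noncomputable def univ (n : ℕ) (a : Fin (n + 1)) : StratPoint R (cechObject R d n) :=
  ⟨CechRing.coord R a, CechRing.isRankOne_coord R a, fun i => by
    refine (CechRing.mk_coord R a i).trans ?_
    change _ = Ideal.Quotient.mk _ (pointHom R (QRing.base R _) (MvPolynomial.X i))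
    rw [pointHom_X]⟩

/-- All points reduce to the same coordinates modulo `q - 1`, so their differences are multiples of
`q - 1`, as `QRing.exists_lift` demands. The last point serves as base. -/
theorem exists_desc {n : ℕ} {B : Strat R (MvPolynomial (Fin d) R)}
    (w : Fin (n + 1) → StratPoint R B) :
    ∃ f : cechObject R d n ⟶ B, ∀ a, push f (univ n a) = w a := by
  have hz : ∀ k : Fin n × Fin d, ∃ z, (w k.1.castSucc).1 k.2 - (w (Fin.last n)).1 k.2 =
      algebraMap R[X] B.carrier (X - 1) * z := by
    intro k
    have h := ((w k.1.castSucc).2.2 k.2).trans ((w (Fin.last n)).2.2 k.2).symm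
    rw [Ideal.Quotient.eq] at h
    exact Ideal.mem_span_singleton.1 h
  choose z hz using hz
  obtain ⟨φ, hφ, hb, hp⟩ := QRing.exists_lift (R := R)
    (c := (Prod.snd : Fin n × Fin d → Fin d)) (fun i => (w (Fin.last n)).2.1 i)
    (fun k : Fin n × Fin d => (w k.1.castSucc).2.1 k.2) hz
  refine ⟨⟨φ, hφ, ?_⟩, fun a => Subtype.ext (funext fun i => ?_)⟩
  · refine MvPolynomial.ringHom_ext (fun r => ?_) (fun i => ?_)
    · rw [RingHom.comp_apply, ← MvPolynomial.algebraMap_eq, Strat.toQuotient_algebraMap,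
        Strat.toQuotient_algebraMap]
      exact congrArg (Ideal.Quotient.mk _) (φ.commutes (C r))
    · rw [RingHom.comp_apply, ← (univ n (Fin.last n)).2.2 i, ← (w (Fin.last n)).2.2 i]
      refine congrArg (Ideal.Quotient.mk _) ?_
      change φ (CechRing.coord R (Fin.last n) i) = _
      rw [CechRing.coord_last, hb]
  · change φ (CechRing.coord R a i) = _
    cases a using Fin.lastCases with
    | last => rw [CechRing.coord_last, hb]
    | cast k => rw [CechRing.coord_castSucc, hp]

theorem hom_ext {n : ℕ} {B : Strat R (MvPolynomial (Fin d) R)} {f g : cechObject R d n ⟶ B}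
    (h : ∀ a, push f (univ n a) = push g (univ n a)) : f = g := by
  have h' : ∀ a i, f.toAlgHom (CechRing.coord R a i) = g.toAlgHom (CechRing.coord R a i) :=
    fun a i => congrFun (congrArg Subtype.val (h a)) i
  refine Strat.Hom.ext (QRing.algHom_ext (fun s hs b =>
    smul_eq_zero_of_flat (qMonoid_le_nonZeroDivisors hs) b) (fun i => ?_) fun k => ?_)
  · rw [← CechRing.coord_last]
    exact h' _ i
  · rw [← CechRing.coord_castSucc R k.1 k.2]
    exact h' _ _

end StratPoint

variable (d) in
/-- The Čech cover of `Strat` by the points of polynomial rings. -/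
noncomputable def stratCover : CechCover.{u + 1, u, u} (Strat R (MvPolynomial (Fin d) R)) where
  pts := StratPoint R
  push := StratPoint.push
  push_id _ _ := rfl
  push_comp _ _ _ := rfl
  point B := (StratPoint.nonempty B).some
  U := cechObject R d
  univ := StratPoint.univ
  desc w := (StratPoint.exists_desc w).choose
  push_desc w := (StratPoint.exists_desc w).choose_spec
  hom_ext := StratPoint.hom_ext

end StratCover

/-! ### The Čech complex and the Aomoto–Jackson complex -/

namespace CechRing

section Theta

variable {R : Type u} [CommRing R] {d : ℕ}

theorem algHom_ext {n : ℕ} {B : Type v} [CommRing B] [Algebra R[X] B] [Module.Flat R[X] B]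
    {f g : CechRing R d n →ₐ[R[X]] B} (h : ∀ a i, f (coord R a i) = g (coord R a i)) : f = g := by
  refine QRing.algHom_ext (fun s hs b =>
    smul_eq_zero_of_flat (qMonoid_le_nonZeroDivisors hs) b) (fun i => ?_) fun k => ?_
  · rw [← coord_last]
    exact h _ i
  · rw [← coord_castSucc R k.1 k.2]
    exact h _ _

theorem coord_zero_mul_eq_zero {n : ℕ} {i : Fin d} {x : CechRing R d (n + 1)}
    (h : coord R 0 i * x = 0) : x = 0 := by
  rw [coord_zero] at h
  exact QRing.pt_mul_eq_zero h

theorem coord_zero_mul_lower {n : ℕ} (i : Fin d) (x : CechRing R d (n + 1)) :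
    coord R 0 i * QRing.lower (0, i) x = QRing.shift (0, i) x - x := by
  rw [coord_zero, QRing.pt_mul_lower]

theorem shift_coord_zero {n : ℕ} (i : Fin d) :
    QRing.shift (0, i) (coord R (0 : Fin (n + 1 + 1)) i) = (X : R[X]) • coord R 0 i := by
  rw [coord_zero, QRing.shift_pt_self]

theorem shift_coord_of_ne {n : ℕ} (i : Fin d) {a : Fin (n + 1 + 1)} {j : Fin d}
    (h : ¬(a = 0 ∧ j = i)) : QRing.shift (0, i) (coord R a j) = coord R a j := by
  cases a using Fin.lastCases with
  | last => rw [coord_last, QRing.shift_base]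
  | cast k =>
    rw [coord_castSucc, QRing.shift_pt_of_ne]
    intro e
    obtain ⟨rfl, rfl⟩ := Prod.mk.inj e
    exact h ⟨rfl, rfl⟩

/-- Functions killed by the difference operators at the first point do not depend on this point. -/
theorem val_of_algHom {n : ℕ} {φ : CechRing R d (n + 1) →ₐ[R[X]] CechRing R d (n + 1)}
    (h0 : ∀ i, φ (coord R 0 i) = coord R (Fin.last (n + 1)) i)
    (h1 : ∀ a i, a ≠ 0 → φ (coord R a i) = coord R a i) {x : CechRing R d (n + 1)}
    (hx : ∀ i, QRing.lower (0, i) x = 0) : φ x = x := by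
  classical
  refine QRing.ext fun m => ?_
  let T : Finset (Fin (n + 1) × Fin d) := Finset.univ.filter fun b => b.1 = 0
  rw [← QRing.val_eq_of_lower_eq_zero T (f := x) (fun b hb => by
    obtain ⟨k, i⟩ := b
    obtain rfl : k = 0 := (Finset.mem_filter.1 hb).2
    exact hx i) m]
  let ev : ∀ m : Fin (n + 1) × Fin d → ℕ,
      CechRing R d (n + 1) →ₐ[R[X]] MvPolynomial (Fin d) R[X] := fun m =>
    ((Pi.evalAlgHom (MvPolynomial (Fin d) R[X]) (fun _ => MvPolynomial (Fin d) R[X]) m).comp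
      (QRing.val R Prod.snd)).restrictScalars R[X]
  have hev : ∀ m x, ev m x = QRing.val R Prod.snd x m := fun _ _ => rfl
  -- Both sides are algebra maps that send the first point to the base and evaluate the others at
  -- `m`.
  have key : (ev m).comp φ = ev fun b => if b ∈ T then 0 else m b := by
    refine algHom_ext fun a i => ?_
    rw [AlgHom.comp_apply]
    by_cases ha : a = 0
    · subst ha
      rw [h0, coord_last, coord_zero, hev, hev, QRing.val_base, QRing.val_pt, if_pos (by simp [T]),
        pow_zero, map_one, one_mul]
    · rw [h1 a i ha]
      cases a using Fin.lastCases with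
      | last => rw [coord_last, hev, hev, QRing.val_base, QRing.val_base]
      | cast k =>
        have hk : k ≠ 0 := fun e => ha (by rw [e]; rfl)
        rw [coord_castSucc, hev, hev, QRing.val_pt, QRing.val_pt, if_neg (by simp [T, hk])]
  exact DFunLike.congr_fun key x

/-- With a single point there are no variables `y`, and functions on the one-element set `ℕ^∅` are
just polynomials. -/
theorem algebraMap_bijective :
    Function.Bijective (algebraMap (MvPolynomial (Fin d) R[X]) (CechRing R d 0)) := by
  have h : ∀ p m, QRing.val R Prod.snd (algebraMap _ (CechRing R d 0) p) m = p := fun p m => by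
    rw [AlgHom.commutes]
    rfl
  refine ⟨fun p p' e => ?_, fun x => ⟨QRing.val R Prod.snd x 0, QRing.ext fun m => ?_⟩⟩
  · rw [← h p 0, e, h]
  · rw [h, Subsingleton.elim m 0]

/-- Polynomials as functions of the first of two points. -/
noncomputable def polyHom : MvPolynomial (Fin d) R[X] →ₐ[R[X]] CechRing R d 1 :=
  MvPolynomial.aeval (coord R 0)

/-- Multiplied by the regular element `y_i`, both sides become `f(…, q y_i, …) - f`: the difference
operator restricts to the scaled Jackson derivative on polynomials. -/
theorem polyHom_jacksonDeriv (i : Fin d) (p : MvPolynomial (Fin d) R[X]) :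
    polyHom (((X - 1 : R[X]) • jacksonDeriv R d i) p) = QRing.lower (0, i) (polyHom p) := by
  refine sub_eq_zero.1 (coord_zero_mul_eq_zero (i := i) ?_)
  have h : (QRing.shift (0, i)).comp polyHom =
      (polyHom : MvPolynomial (Fin d) R[X] →ₐ[R[X]] CechRing R d 1).comp
        (MvPolynomial.aeval (Function.update MvPolynomial.X i
        (MvPolynomial.C X * MvPolynomial.X i) : Fin d → MvPolynomial (Fin d) R[X])) := by
    refine MvPolynomial.algHom_ext fun j => ?_
    rw [AlgHom.comp_apply, AlgHom.comp_apply, polyHom, MvPolynomial.aeval_X, MvPolynomial.aeval_X]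
    rcases eq_or_ne j i with rfl | hj
    · rw [Function.update_self, map_mul, MvPolynomial.aeval_C, MvPolynomial.aeval_X,
        shift_coord_zero, Algebra.smul_def]
    · rw [Function.update_of_ne hj, MvPolynomial.aeval_X, shift_coord_of_ne i fun e => hj e.2]
  have h2 : coord R (0 : Fin 2) i = polyHom (MvPolynomial.X i) :=
    (MvPolynomial.aeval_X _ _).symm
  have h3 := (congrArg polyHom (jacksonDeriv_spec R d i p)).trans (map_sub polyHom _ _)
  have h4 := DFunLike.congr_fun h p
  rw [AlgHom.comp_apply, AlgHom.comp_apply] at h4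
  rw [mul_sub, coord_zero_mul_lower, h4, ← h3, h2, ← map_mul, sub_eq_zero, LinearMap.smul_apply,
    MvPolynomial.smul_eq_C_mul]
  congr 1
  ring

variable [LambdaRing R]

/-- The action of maps of indices on the rings `CechRing`. -/
noncomputable def theta {n m : ℕ} (f : Fin (n + 1) → Fin (m + 1)) :
    CechRing R d n →ₐ[R[X]] CechRing R d m :=
  ((stratCover R d).θ f).toAlgHom

theorem theta_coord {n m : ℕ} (f : Fin (n + 1) → Fin (m + 1)) (a : Fin (n + 1)) (i : Fin d) :
    theta f (coord R a i) = coord R (f a) i :=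
  congrFun (congrArg Subtype.val ((stratCover R d).push_θ f a)) i

theorem theta_theta {n m k : ℕ} (f : Fin (n + 1) → Fin (m + 1)) (g : Fin (m + 1) → Fin (k + 1))
    (x : CechRing R d n) : theta g (theta f x) = theta (g ∘ f) x := by
  have h : (theta g).comp (theta f) = (theta (g ∘ f) : CechRing R d n →ₐ[R[X]] _) :=
    algHom_ext fun a i => by
      rw [AlgHom.comp_apply, theta_coord, theta_coord, theta_coord]
      rfl
  exact DFunLike.congr_fun h x

theorem theta_id {n : ℕ} (x : CechRing R d n) : theta id x = x := by
  have h : theta id = AlgHom.id R[X] (CechRing R d n) :=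
    algHom_ext fun a i => theta_coord id a i
  exact DFunLike.congr_fun h x

theorem shift_theta {n m : ℕ} (f : Fin (n + 1 + 1) → Fin (m + 1 + 1)) (h0 : f 0 = 0)
    (h1 : ∀ a, a ≠ 0 → f a ≠ 0) (i : Fin d) (x : CechRing R d (n + 1)) :
    QRing.shift (0, i) (theta f x) = theta f (QRing.shift (0, i) x) := by
  have h : (QRing.shift (0, i)).comp (theta f) =
      (theta f : CechRing R d (n + 1) →ₐ[R[X]] _).comp (QRing.shift (0, i)) := by
    refine algHom_ext fun a j => ?_
    rw [AlgHom.comp_apply, AlgHom.comp_apply, theta_coord]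
    by_cases ha : a = 0 ∧ j = i
    · obtain ⟨rfl, rfl⟩ := ha
      rw [h0, shift_coord_zero, shift_coord_zero, map_smul, theta_coord, h0]
    · rw [shift_coord_of_ne i ha, shift_coord_of_ne i, theta_coord]
      exact fun e => ha ⟨by_contra fun h => h1 a h e.1, e.2⟩
  exact DFunLike.congr_fun h x

/-- The maps of indices in question fix the first point and send no other point to it, so they
commute with the shift of the first point; then `y_i` is cancelled. -/
theorem lower_theta {n m : ℕ} (f : Fin (n + 1 + 1) → Fin (m + 1 + 1)) (h0 : f 0 = 0)
    (h1 : ∀ a, a ≠ 0 → f a ≠ 0) (i : Fin d) (x : CechRing R d (n + 1)) :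
    QRing.lower (0, i) (theta f x) = theta f (QRing.lower (0, i) x) := by
  refine sub_eq_zero.1 (coord_zero_mul_eq_zero (i := i) ?_)
  have h2 := congrArg (theta f) (coord_zero_mul_lower i x)
  rw [map_mul, theta_coord, h0, map_sub] at h2
  rw [mul_sub, coord_zero_mul_lower, h2, shift_theta f h0 h1, sub_self]

theorem lower_theta_succ {n : ℕ} (i : Fin d) (x : CechRing R d n) :
    QRing.lower (0, i) (theta Fin.succ x) = 0 := by
  refine coord_zero_mul_eq_zero (i := i) ?_
  have h : (QRing.shift (0, i)).comp (theta Fin.succ) =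
      (theta Fin.succ : CechRing R d n →ₐ[R[X]] _) := by
    refine algHom_ext fun a j => ?_
    rw [AlgHom.comp_apply, theta_coord, shift_coord_of_ne]
    exact fun e => Fin.succ_ne_zero a e.1
  rw [coord_zero_mul_lower, sub_eq_zero]
  exact DFunLike.congr_fun h x

/-- The preimage specializes the first point to the base point. Functions killed by all difference
operators at the first point are unaffected by this specialization. -/
theorem exists_theta_succ {n : ℕ} (x : CechRing R d (n + 1))
    (hx : ∀ i, QRing.lower (0, i) x = 0) : ∃ y, theta Fin.succ y = x := by
  refine ⟨theta (Fin.cons (Fin.last n) id : Fin (n + 2) → Fin (n + 1)) x, ?_⟩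
  refine val_of_algHom (φ := (theta Fin.succ).comp
    (theta (Fin.cons (Fin.last n) id : Fin (n + 2) → Fin (n + 1)))) (fun i => ?_)
    (fun a i ha => ?_) hx
  · rw [AlgHom.comp_apply, theta_coord, theta_coord, Fin.cons_zero, Fin.succ_last]
  · obtain ⟨k, rfl⟩ := Fin.exists_succ_eq.2 ha
    rw [AlgHom.comp_apply, theta_coord, theta_coord, Fin.cons_succ]
    rfl

theorem theta_succ_injective {n : ℕ} :
    Function.Injective (theta Fin.succ : CechRing R d n →ₐ[R[X]] CechRing R d (n + 1)) := by
  -- The left inverse merges the first point with the second.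
  refine Function.LeftInverse.injective
    (g := theta (Fin.cons 0 id : Fin (n + 2) → Fin (n + 1))) fun x => ?_
  rw [theta_theta]
  exact theta_id x

theorem polyHom_eq (p : MvPolynomial (Fin d) R[X]) : polyHom p =
    theta (fun _ => (0 : Fin 2)) (algebraMap _ (CechRing R d 0) p) := by
  have h : polyHom = (theta (fun _ => (0 : Fin 2))).comp
      (IsScalarTower.toAlgHom R[X] (MvPolynomial (Fin d) R[X]) (CechRing R d 0)) := by
    refine MvPolynomial.algHom_ext fun i => ?_
    rw [AlgHom.comp_apply, polyHom, MvPolynomial.aeval_X]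
    change _ = theta _ (QRing.base R _ i)
    rw [← coord_last, theta_coord]
  exact DFunLike.congr_fun h p

end Theta

/-! ### The double complex of difference operators: the `q`-Poincaré lemma -/

section Decalage

variable (R : Type u) [CommRing R] (d : ℕ)

/-- The difference operators at the first point. -/
noncomputable def lowerOp (n : ℕ) (i : Fin d) :
    CechRing R d (n + 1) →ₗ[R[X]] CechRing R d (n + 1) :=
  (QRing.lower (0, i)).restrictScalars R[X]

theorem lowerOp_comm (n : ℕ) (i j : Fin d) (x : CechRing R d (n + 1)) :
    lowerOp R d n i (lowerOp R d n j x) = lowerOp R d n j (lowerOp R d n i x) :=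
  QRing.lower_lower _ _ x

theorem jacksonDeriv_scaled_comm (i j : Fin d) (p : MvPolynomial (Fin d) R[X]) :
    ((X - 1 : R[X]) • jacksonDeriv R d i) (((X - 1 : R[X]) • jacksonDeriv R d j) p) =
      ((X - 1 : R[X]) • jacksonDeriv R d j) (((X - 1 : R[X]) • jacksonDeriv R d i) p) := by
  simp only [LinearMap.smul_apply, map_smul, jacksonDeriv_comm R d i j]

theorem formMap_polyHom_koszulD (m : ℕ) (ω : JacksonForm R d m) :
    formMap polyHom.toLinearMap (m + 1)
        (koszulD (fun i => (X - 1 : R[X]) • jacksonDeriv R d i) m ω) =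
      koszulD (lowerOp R d 0) m (formMap polyHom.toLinearMap m ω) :=
  formMap_koszulD polyHom.toLinearMap (fun i => (X - 1 : R[X]) • jacksonDeriv R d i)
    (lowerOp R d 0) (fun i p => polyHom_jacksonDeriv i p) m ω

variable [LambdaRing R]

/-- The Čech complex with one more point, as a semi-cosimplicial module: the cofaces do not
involve the first point. -/
noncomputable def decSemi : SemiCosimplicial.{u, u} R[X] where
  X n := CechRing R d (n + 1)
  δ _ i := (theta i.succ.succAbove).toLinearMap
  δ_δ n i j h x := by
    change theta _ (theta _ x) = theta _ (theta _ x)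
    rw [theta_theta, theta_theta]
    refine congrArg (theta · x) (funext fun k => ?_)
    exact succAbove_succAbove (Fin.succ_le_succ_iff.2 h) k

/-- The contraction of `decSemi`. -/
noncomputable def decContract (n : ℕ) : (decSemi R d).X (n + 1) →ₗ[R[X]] (decSemi R d).X n :=
  (theta (Fin.cons 0 id : Fin (n + 3) → Fin (n + 2))).toLinearMap

theorem decContract_zero (n : ℕ) (x : (decSemi R d).X n) :
    decContract R d n ((decSemi R d).δ n 0 x) = x := by
  refine (theta_theta _ _ (show CechRing R d (n + 1) from x)).trans ?_
  refine Eq.trans (congrArg (theta · x) (funext fun k => ?_)) (theta_id x)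
  cases k using Fin.cases with
  | zero => rw [Function.comp_apply, Fin.succ_succAbove_zero]; rfl
  | succ k => rw [Function.comp_apply, Fin.succ_succAbove_succ, Fin.succAbove_zero]; rfl

theorem decContract_succ (n : ℕ) (i : Fin (n + 2)) (x : (decSemi R d).X (n + 1)) :
    decContract R d (n + 1) ((decSemi R d).δ (n + 1) i.succ x) =
      (decSemi R d).δ n i (decContract R d n x) := by
  refine (theta_theta _ _ (show CechRing R d (n + 2) from x)).trans
    (Eq.trans ?_ (theta_theta _ _ (show CechRing R d (n + 2) from x)).symm)
  refine congrArg (theta · _) (funext fun k => ?_)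
  cases k using Fin.cases with
  | zero =>
    rw [Function.comp_apply, Function.comp_apply, Fin.succ_succAbove_zero, Fin.cons_zero,
      Fin.cons_zero, Fin.succ_succAbove_zero]
  | succ k =>
    rw [Function.comp_apply, Function.comp_apply, Fin.succ_succAbove_succ, Fin.cons_succ,
      Fin.cons_succ]
    rfl

/-- The untouched first point provides an extra codegeneracy, merging the second point with it. -/
theorem exists_decSemi_altD_eq (n : ℕ) (x : (decSemi R d).X (n + 1))
    (hx : (decSemi R d).altD (n + 1) x = 0) : ∃ y, (decSemi R d).altD n y = x :=
  ⟨_, (decSemi R d).exact_of_contraction (decContract R d) (decContract_zero R d)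
    (decContract_succ R d) n x hx⟩

theorem polyHom_injective :
    Function.Injective (polyHom : MvPolynomial (Fin d) R[X] →ₐ[R[X]] CechRing R d 1) := by
  intro p p' h
  have h1 : ∀ p : MvPolynomial (Fin d) R[X], theta (fun _ : Fin 2 => (0 : Fin 1)) (polyHom p) =
      algebraMap _ (CechRing R d 0) p := by
    intro p
    rw [polyHom_eq, theta_theta]
    refine Eq.trans (congrArg (theta · _) (funext fun k => ?_)) (theta_id _)
    exact Subsingleton.elim (α := Fin 1) _ _
  exact algebraMap_bijective.1 (by rw [← h1, h, h1])

theorem altD_polyHom (p : MvPolynomial (Fin d) R[X]) :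
    (decSemi R d).altD 0 (polyHom p) = 0 := by
  refine ((decSemi R d).altD_zero_eq_zero_iff _).2 ?_
  change theta _ (polyHom p) = theta _ (polyHom p)
  rw [polyHom_eq, theta_theta, theta_theta]
  refine congrArg (theta · _) (funext fun k => ?_)
  rw [Function.comp_apply, Function.comp_apply, Fin.succ_succAbove_zero, Fin.succ_succAbove_zero]

theorem exists_polyHom_eq (x : CechRing R d 1) (hx : (decSemi R d).altD 0 x = 0) :
    ∃ p, polyHom p = x := by
  have h := ((decSemi R d).altD_zero_eq_zero_iff x).1 hx
  obtain ⟨p, hp⟩ := algebraMap_bijective.2 (theta (fun _ : Fin 2 => (0 : Fin 1)) x)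
  refine ⟨p, ?_⟩
  rw [polyHom_eq, hp, theta_theta]
  -- Since `δ 0 x = δ 1 x`, the contraction of either is `x`; contracting `δ 1 x` puts both points
  -- at the first one, which gives a polynomial in its coordinates.
  refine Eq.trans ?_ (decContract_zero R d 0 x)
  rw [h]
  change _ = theta _ (theta _ x)
  rw [theta_theta]
  refine congrArg (theta · x) (funext fun k => ?_)
  fin_cases k <;> rfl

theorem lowerOp_altD (n : ℕ) (i : Fin d) (x : CechRing R d (n + 1)) :
    (decSemi R d).altD n (lowerOp R d n i x) = lowerOp R d (n + 1) i ((decSemi R d).altD n x) := by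
  refine ((decSemi R d).altD_comm (L := decSemi R d) (lowerOp R d n i) (lowerOp R d (n + 1) i)
    (fun k y => ?_) x).symm
  refine lower_theta _ (Fin.succ_succAbove_zero k) (fun a ha => ?_) i y
  obtain ⟨b, rfl⟩ := Fin.exists_succ_eq.2 ha
  rw [Fin.succ_succAbove_succ]
  exact Fin.succ_ne_zero _

theorem formMap_altD_altD (n m : ℕ)
    (ω : {I : Finset (Fin d) // I.card = m} → CechRing R d (n + 1)) :
    formMap ((decSemi R d).altD (n + 1)) m (formMap ((decSemi R d).altD n) m ω) = 0 :=
  funext fun I => (decSemi R d).altD_altD n (ω I)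

/-- The double complex comparing the Čech complex and the Aomoto–Jackson complex. -/
noncomputable def jacksonDouble : DoubleComplex.{u, u} R[X] :=
  DoubleComplex.ofComm (fun n m => {I : Finset (Fin d) // I.card = m} → CechRing R d (n + 1))
    (fun n m => formMap ((decSemi R d).altD n) m) (fun n m => koszulD (lowerOp R d n) m)
    (formMap_altD_altD R d)
    (fun n => koszulD_koszulD _ (lowerOp_comm R d n))
    (fun n m => formMap_koszulD _ _ _ (lowerOp_altD R d n) m)

/-- The Čech complex maps to the double complex by a quasi-isomorphism. -/
theorem exists_isQuasiIso_jacksonDouble_of_cech :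
    ∃ f, SeqComplex.IsQuasiIso
      ((stratCover R d).cechSemi (Strat.forgetToModule R (MvPolynomial (Fin d) R))).toSeq
      (jacksonDouble R d).total f := by
  let ε : ∀ n, CechRing R d n →ₗ[R[X]] ({I : Finset (Fin d) // I.card = 0} → CechRing R d (n + 1)) :=
    fun n => constForm ∘ₗ (theta Fin.succ).toLinearMap
  refine DoubleComplex.exists_isQuasiIso_ofComm _ _ _ _ _ _
    ((stratCover R d).cechSemi (Strat.forgetToModule R (MvPolynomial (Fin d) R))).toSeq ε
    (fun n m ω hω => ?_) (fun n x y h => ?_) (fun n x => ?_) (fun n ω hω => ?_) (fun n x => ?_)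
  -- Raising a basis index is a right inverse of lowering it and commutes with the operators in
  -- other directions.
  · refine exists_koszulD_eq (lowerOp R d n) (fun i => (QRing.raise (0, i)).restrictScalars R[X])
      (lowerOp_comm R d n) (fun i x => QRing.lower_raise _ x) (fun i j x hij => ?_) ω hω
    exact QRing.lower_raise_of_ne (fun e => hij (congrArg Prod.snd e).symm) x
  · exact theta_succ_injective (congrFun h ⟨∅, rfl⟩)
  · exact (koszulD_zero_eq_zero_iff (lowerOp R d n) _).2 fun i => lower_theta_succ i x
  · obtain ⟨y, hy⟩ := exists_theta_succ (ω ⟨∅, rfl⟩)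
      ((koszulD_zero_eq_zero_iff (lowerOp R d n) ω).1 hω)
    refine ⟨y, Eq.trans ?_ (constForm_eq (S := R[X]) ω)⟩
    exact congrArg (constForm (S := R[X])) hy
  -- Adding a new first point shifts all cofaces by one, and the cofaces of `decSemi` are the
  -- shifted ones.
  · have h : theta Fin.succ (((stratCover R d).cechSemi
        (Strat.forgetToModule R (MvPolynomial (Fin d) R))).altD n x) =
        (decSemi R d).altD n (theta Fin.succ x) := by
      refine SemiCosimplicial.altD_comm ((stratCover R d).cechSemi
        (Strat.forgetToModule R (MvPolynomial (Fin d) R))) (L := decSemi R d)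
        (theta (Fin.succ : Fin (n + 1) → Fin (n + 2))).toLinearMap
        (theta (Fin.succ : Fin (n + 2) → Fin (n + 3))).toLinearMap (fun i y => ?_) x
      refine (theta_theta _ _ (show CechRing R d n from y)).trans
        (Eq.trans ?_ (theta_theta _ _ (show CechRing R d n from y)).symm)
      exact congrArg (theta · _) (funext fun k => (Fin.succ_succAbove_succ i k).symm)
    exact congrArg (constForm (S := R[X])) h

/-- The scaled Aomoto–Jackson complex, in unbundled form. -/
noncomputable def scaledComplex : SeqComplex.{u, u} R[X] :=
  koszulComplex (fun i => (X - 1 : R[X]) • jacksonDeriv R d i) (jacksonDeriv_scaled_comm R d)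

/-- The scaled Aomoto–Jackson complex maps to the double complex by a quasi-isomorphism. -/
theorem exists_isQuasiIso_jacksonDouble_of_scaled :
    ∃ f, SeqComplex.IsQuasiIso (scaledComplex R d) (jacksonDouble R d).flip.total f := by
  refine DoubleComplex.exists_isQuasiIso_flip_ofComm _ _ _ _ _ _ (scaledComplex R d)
    (fun m => formMap polyHom.toLinearMap m) (fun n m ω hω => ?_) (fun m ω ω' h => ?_)
    (fun m ω => ?_) (fun m ω hω => ?_) (fun m ω => ?_)
  · have h : ∀ I, ∃ y, (decSemi R d).altD n y = ω I := fun I =>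
      exists_decSemi_altD_eq R d n (ω I) (congrFun hω I)
    choose y hy using h
    exact ⟨y, funext hy⟩
  · exact funext fun I => polyHom_injective R d (congrFun h I)
  · exact funext fun I => altD_polyHom R d (ω I)
  · have h : ∀ I, ∃ p, polyHom p = ω I := fun I =>
      exists_polyHom_eq R d (ω I) (congrFun hω I)
    choose y hy using h
    exact ⟨y, funext hy⟩
  · exact formMap_polyHom_koszulD R d m ω

end Decalage

end CechRing

/-! ### Décalage of complexes without torsion -/

section Scale

variable {S : Type u} [CommRing S] (f : S)

/-- Multiplication by `f` is injective in all degrees. -/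
def TorsionFree {ι : Type*} {c : ComplexShape ι} (K : HomologicalComplex (ModuleCat.{v} S) c) :
    Prop :=
  ∀ (i : ι) (x : K.X i), f • x = 0 → x = 0

variable {M N : Type v} [AddCommGroup M] [Module S M] [AddCommGroup N] [Module S N]

theorem smul_pow_injective (n : ℕ) {x y : LocalizedModule (Submonoid.powers f) M}
    (h : f ^ n • x = f ^ n • y) : x = y := by
  have h1 := fun p : LocalizedModule (Submonoid.powers f) M =>
    LocalizedModule.divBy_mul_by (⟨f ^ n, n, rfl⟩ : Submonoid.powers f) p
  rw [← h1 x, ← h1 y]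
  exact congrArg _ h

variable (M) in
/-- The map `x ↦ f^m x` from `M` to `M[1/f]`. -/
noncomputable def fScale (m : ℤ) : M →ₗ[S] LocalizedModule (Submonoid.powers f) M :=
  LocalizedModule.divBy ⟨f ^ (-m).toNat, _, rfl⟩ ∘ₗ
    (f ^ m.toNat • LocalizedModule.mkLinearMap (Submonoid.powers f) M)

theorem smul_fScale (m : ℤ) (y : M) : f ^ (-m).toNat • fScale f M m y =
    f ^ m.toNat • LocalizedModule.mkLinearMap (Submonoid.powers f) M y :=
  LocalizedModule.mul_by_divBy (⟨f ^ (-m).toNat, _, rfl⟩ : Submonoid.powers f)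
    ((f ^ m.toNat • LocalizedModule.mkLinearMap (Submonoid.powers f) M) y)

theorem mem_fPow_iff (m : ℤ) (x : LocalizedModule (Submonoid.powers f) M) :
    x ∈ fPow f M m ↔ ∃ y, fScale f M m y = x := by
  constructor
  · rintro ⟨y, hy⟩
    exact ⟨y, smul_pow_injective f _ ((smul_fScale f m y).trans hy.symm)⟩
  · rintro ⟨y, rfl⟩
    exact ⟨y, smul_fScale f m y⟩

theorem fScale_natCast (n : ℕ) (y : M) : fScale f M n y =
    LocalizedModule.mkLinearMap (Submonoid.powers f) M (f ^ n • y) := by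
  have h := smul_fScale f (n : ℤ) y
  rwa [show (-(n : ℤ)).toNat = 0 by omega, pow_zero, one_smul, Int.toNat_natCast,
    ← map_smul] at h

theorem fScale_succ (m : ℤ) (y : M) : fScale f M (m + 1) y = fScale f M m (f • y) := by
  -- The exponent clears the denominators of both sides, whatever the signs of `m` and `m + 1`.
  refine smul_pow_injective f ((-m).toNat + (-(m + 1)).toNat) ?_
  have h1 := smul_fScale f m (f • y)
  have h2 := smul_fScale f (m + 1) y
  rw [pow_add, mul_smul, h2, mul_comm (f ^ (-m).toNat), mul_smul, h1, map_smul, smul_smul,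
    smul_smul, smul_smul, ← pow_add, ← pow_add, ← pow_succ]
  congr 2
  omega

theorem locMap_mk (g : M →ₗ[S] N) (y : M) :
    locMap f g (LocalizedModule.mkLinearMap (Submonoid.powers f) M y) =
      LocalizedModule.mkLinearMap (Submonoid.powers f) N (g y) :=
  IsLocalizedModule.map_apply _ _ _ g y

theorem locMap_fScale (g : M →ₗ[S] N) (m : ℤ) (y : M) :
    locMap f g (fScale f M m y) = fScale f N m (g y) := by
  refine smul_pow_injective f (-m).toNat ?_
  rw [← map_smul, smul_fScale, smul_fScale, map_smul, locMap_mk]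

theorem mk_injective (hM : ∀ x : M, f • x = 0 → x = 0) :
    Function.Injective (LocalizedModule.mkLinearMap (Submonoid.powers f) M) := by
  have hp : ∀ (n : ℕ) (x : M), f ^ n • x = 0 → x = 0 := by
    intro n
    induction n with
    | zero => intro x h; rwa [pow_zero, one_smul] at h
    | succ n ih => intro x h; rw [pow_succ, mul_smul] at h; exact hM x (ih _ h)
  refine (injective_iff_map_eq_zero _).2 fun x hx => ?_
  obtain ⟨⟨_, n, rfl⟩, hs⟩ := (IsLocalizedModule.eq_zero_iff (Submonoid.powers f) _).1 hx
  exact hp n x hs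

theorem fScale_injective (hM : ∀ x : M, f • x = 0 → x = 0) (m : ℤ) :
    Function.Injective (fScale f M m) := by
  refine (injective_iff_map_eq_zero _).2 fun x hx => ?_
  have h := smul_fScale f m x
  rw [hx, smul_zero] at h
  have h2 := smul_pow_injective f m.toNat (x := 0) ((smul_zero _).trans h)
  exact mk_injective f hM (h2.symm.trans (map_zero _).symm)

end Scale

section Decalage

variable {S : Type u} [CommRing S] (f : S)

theorem decalage_d (K : CochainComplex (ModuleCat.{max u w} S) ℤ) (i : ℤ) :
    (decalage.{u, w} f K).d i (i + 1) = ModuleCat.ofHom (decalageD f K i) :=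
  CochainComplex.of_d (fun i => ModuleCat.of S (decalageX f K i))
    (fun i => ModuleCat.ofHom (decalageD f K i)) i

variable {f} in
-- Without torsion, `f^i` can be cancelled in `f^i dy = f^{i+1} z`, so membership becomes a
-- condition inside `K`: divisibility of `dy` by `f`.
theorem mem_decalageX_iff {K : CochainComplex (ModuleCat.{max u w} S) ℤ} (hK : TorsionFree f K)
    (i : ℤ) (x : LocalizedModule (Submonoid.powers f) (K.X i)) :
    x ∈ decalageX f K i ↔ ∃ y z, fScale f _ i y = x ∧ K.d i (i + 1) y = f • z := by
  constructor
  · rintro ⟨h1, h2⟩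
    obtain ⟨y, rfl⟩ := (mem_fPow_iff f i x).1 h1
    obtain ⟨z, hz⟩ := (mem_fPow_iff f (i + 1) _).1 h2
    refine ⟨y, z, rfl, fScale_injective f (hK (i + 1)) i ?_⟩
    rw [← fScale_succ, hz, locMap_fScale]
  · rintro ⟨y, z, rfl, h⟩
    refine ⟨(mem_fPow_iff f i _).2 ⟨y, rfl⟩, (mem_fPow_iff f (i + 1) _).2 ⟨z, ?_⟩⟩
    rw [locMap_fScale, fScale_succ, ← h]

theorem locMap_comm {K L : CochainComplex (ModuleCat.{max u w} S) ℤ} (φ : K ⟶ L) (i : ℤ)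
    (x : LocalizedModule (Submonoid.powers f) (K.X i)) :
    locMap f (L.d i (i + 1)).hom (locMap f (φ.f i).hom x) =
      locMap f (φ.f (i + 1)).hom (locMap f (K.d i (i + 1)).hom x) := by
  rw [locMap, locMap, locMap, locMap, ← LinearMap.comp_apply, ← LinearMap.comp_apply,
    ← IsLocalizedModule.map_comp', ← IsLocalizedModule.map_comp', ← ModuleCat.hom_comp,
    ← ModuleCat.hom_comp, φ.comm]

/-- The map of décalages induced by a map of complexes. -/
noncomputable def decalageMap {K L : CochainComplex (ModuleCat.{max u w} S) ℤ}
    (φ : K ⟶ L) : decalage.{u, w} f K ⟶ decalage.{u, w} f L :=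
  CochainComplex.ofHom
    (fun i => ModuleCat.ofHom ((locMap f (φ.f i).hom).restrict (p := decalageX f K i)
      (q := decalageX f L i) fun x hx => by
        have hmem : ∀ (i m : ℤ) (x : LocalizedModule (Submonoid.powers f) (K.X i)),
            x ∈ fPow f (K.X i) m → locMap f (φ.f i).hom x ∈ fPow f (L.X i) m := by
          intro i m x hx
          obtain ⟨y, rfl⟩ := (mem_fPow_iff f m x).1 hx
          rw [locMap_fScale]
          exact (mem_fPow_iff f m _).2 ⟨_, rfl⟩
        refine ⟨hmem _ _ _ hx.1, ?_⟩
        change locMap f (L.d i (i + 1)).hom (locMap f (φ.f i).hom x) ∈ fPow f (L.X (i + 1)) (i + 1)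
        rw [locMap_comm]
        exact hmem _ _ _ hx.2))
    (fun i => by
      rw [decalage_d, decalage_d]
      ext x : 2
      exact Subtype.ext (locMap_comm f φ i x.1))

variable {f}

/-- The element `f^i y` of the décalage. -/
noncomputable def decalageMk {K : CochainComplex (ModuleCat.{max u w} S) ℤ}
    (hK : TorsionFree f K) {i : ℤ} (y : K.X i) (hy : ∃ z, K.d i (i + 1) y = f • z) :
    (decalage.{u, w} f K).X i :=
  (⟨fScale f (K.X i) i y, (mem_decalageX_iff hK i _).2 ⟨y, hy.choose, rfl, hy.choose_spec⟩⟩ :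
    decalageX f K i)

theorem exists_eq_decalageMk {K : CochainComplex (ModuleCat.{max u w} S) ℤ}
    (hK : TorsionFree f K) {i : ℤ} (x : (decalage.{u, w} f K).X i) :
    ∃ y hy, x = decalageMk hK y hy := by
  obtain ⟨y, z, h1, h2⟩ := (mem_decalageX_iff hK i _).1 (show decalageX f K i from x).2
  exact ⟨y, ⟨z, h2⟩, Subtype.ext h1.symm⟩

theorem decalageMk_injective {K : CochainComplex (ModuleCat.{max u w} S) ℤ}
    (hK : TorsionFree f K) {i : ℤ} {y y' : K.X i} {hy : ∃ z, K.d i (i + 1) y = f • z}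
    {hy' : ∃ z, K.d i (i + 1) y' = f • z} (h : decalageMk hK y hy = decalageMk hK y' hy') :
    y = y' :=
  fScale_injective f (hK i) i (congrArg Subtype.val h)

theorem decalageMk_sub {K : CochainComplex (ModuleCat.{max u w} S) ℤ}
    (hK : TorsionFree f K) {i : ℤ} {y y' : K.X i} (hy : ∃ z, K.d i (i + 1) y = f • z)
    (hy' : ∃ z, K.d i (i + 1) y' = f • z) (hs : ∃ z, K.d i (i + 1) (y - y') = f • z) :
    decalageMk hK y hy - decalageMk hK y' hy' = decalageMk hK (y - y') hs :=
  Subtype.ext (map_sub (fScale f (K.X i) i) y y').symm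

theorem d_decalageMk {K : CochainComplex (ModuleCat.{max u w} S) ℤ} (hK : TorsionFree f K) {i : ℤ}
    (y : K.X i) (z : K.X (i + 1)) (hy : K.d i (i + 1) y = f • z)
    (hz : ∃ z', K.d (i + 1) (i + 1 + 1) z = f • z') :
    (decalage.{u, w} f K).d i (i + 1) (decalageMk hK y ⟨z, hy⟩) = decalageMk hK z hz := by
  rw [decalage_d]
  refine Subtype.ext ?_
  change locMap f (K.d i (i + 1)).hom (fScale f _ i y) = fScale f _ (i + 1) z
  rw [locMap_fScale, fScale_succ, ← hy]

theorem d_eq_zero_of_d_decalageMk {K : CochainComplex (ModuleCat.{max u w} S) ℤ}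
    (hK : TorsionFree f K) {i : ℤ} (y : K.X i) (hy : ∃ z, K.d i (i + 1) y = f • z)
    (h : (decalage.{u, w} f K).d i (i + 1) (decalageMk hK y hy) = 0) : K.d i (i + 1) y = 0 := by
  rw [decalage_d] at h
  have h' : locMap f (K.d i (i + 1)).hom (fScale f _ i y) = 0 := congrArg Subtype.val h
  rw [locMap_fScale] at h'
  exact fScale_injective f (hK (i + 1)) i (h'.trans (map_zero _).symm)

theorem d_decalageMk_eq_zero {K : CochainComplex (ModuleCat.{max u w} S) ℤ}
    (hK : TorsionFree f K) {i : ℤ} (y : K.X i) (hy : ∃ z, K.d i (i + 1) y = f • z)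
    (h : K.d i (i + 1) y = 0) : (decalage.{u, w} f K).d i (i + 1) (decalageMk hK y hy) = 0 := by
  rw [decalage_d]
  refine Subtype.ext ?_
  change locMap f (K.d i (i + 1)).hom (fScale f _ i y) = 0
  rw [locMap_fScale]
  exact (congrArg _ h).trans (map_zero _)

theorem decalageMap_decalageMk {K L : CochainComplex (ModuleCat.{max u w} S) ℤ}
    (hK : TorsionFree f K) (hL : TorsionFree f L) (φ : K ⟶ L) {i : ℤ} (y : K.X i)
    (hy : ∃ z, K.d i (i + 1) y = f • z) (hy' : ∃ z, L.d i (i + 1) (φ.f i y) = f • z) :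
    (decalageMap.{u, w} f φ).f i (decalageMk hK y hy) = decalageMk hL (φ.f i y) hy' :=
  Subtype.ext (locMap_fScale f (φ.f i).hom i y)

/-- Décalage preserves quasi-isomorphisms between complexes without torsion. -/
theorem quasiIso_decalageMap {K L : CochainComplex (ModuleCat.{max u w} S) ℤ}
    (hK : TorsionFree f K) (hL : TorsionFree f L) (φ : K ⟶ L) (hφ : QuasiIso φ) :
    QuasiIso (decalageMap.{u, w} f φ) := by
  have hcomm : ∀ (i j : ℤ) (y : K.X i), φ.f j (K.d i j y) = L.d i j (φ.f i y) := fun i j y =>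
    ConcreteCategory.congr_hom (φ.comm i j).symm y
  refine ⟨fun i => ?_⟩
  obtain ⟨k, rfl⟩ : ∃ k, i = k + 1 := ⟨i - 1, by omega⟩
  have hprev : (ComplexShape.up ℤ).prev (k + 1) = k := ComplexShape.prev_eq' _ rfl
  have hnext : (ComplexShape.up ℤ).next (k + 1) = k + 1 + 1 := ComplexShape.next_eq' _ rfl
  obtain ⟨hinj, hsurj⟩ := (quasiIsoAt_iff_elements φ hprev hnext).1 (hφ.quasiIsoAt (k + 1))
  refine (quasiIsoAt_iff_elements _ hprev hnext).2 ⟨?_, ?_⟩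
  · rintro x hx ⟨y, hy⟩
    obtain ⟨a, ha, rfl⟩ := exists_eq_decalageMk hK x
    obtain ⟨b, ⟨b', hb'⟩, rfl⟩ := exists_eq_decalageMk hL y
    have hda := d_eq_zero_of_d_decalageMk hK a ha hx
    have hφa : L.d (k + 1) (k + 1 + 1) (φ.f (k + 1) a) = 0 := by
      rw [← hcomm, hda, map_zero]
    have hfb : L.d (k + 1) (k + 1 + 1) b' = 0 := by
      refine hL _ _ ?_
      rw [← map_smul, ← hb']
      exact ConcreteCategory.congr_hom (L.d_comp_d k (k + 1) (k + 1 + 1)) b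
    rw [d_decalageMk hL b b' hb' ⟨0, by rw [hfb, smul_zero]⟩,
      decalageMap_decalageMk hK hL φ a ha ⟨0, by rw [hφa, smul_zero]⟩] at hy
    have hb : b' = φ.f (k + 1) a := decalageMk_injective hL hy
    -- A cycle `f^{k+1} a` bounds in the décalage exactly when `f a` bounds in the complex, and the
    -- latter condition is reflected by `φ`.
    obtain ⟨c, hc⟩ := hinj (f • a) (by rw [map_smul, hda, smul_zero])
      ⟨b, by rw [hb', hb, map_smul]⟩
    exact ⟨decalageMk hK c ⟨a, hc⟩, d_decalageMk hK c a hc ha⟩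
  · intro y hy
    obtain ⟨b, hb, rfl⟩ := exists_eq_decalageMk hL y
    have hdb := d_eq_zero_of_d_decalageMk hL b hb hy
    obtain ⟨a, hda, b', hb'⟩ := hsurj b hdb
    have ha : ∃ z, K.d (k + 1) (k + 1 + 1) a = f • z := ⟨0, by rw [hda, smul_zero]⟩
    have hφa : L.d (k + 1) (k + 1 + 1) (φ.f (k + 1) a) = 0 := by
      rw [← hcomm, hda, map_zero]
    have hs : L.d (k + 1) (k + 1 + 1) (b - φ.f (k + 1) a) = 0 := by
      rw [map_sub, hdb, hφa, sub_zero]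
    -- If `b - φ(a) = d b'`, then `f^{k+1}(b - φ(a))` is the differential of `f^k (f b')`, and `d(f
    -- b')` is divisible by `f`.
    refine ⟨decalageMk hK a ha, d_decalageMk_eq_zero hK a ha hda,
      decalageMk hL (f • b') ⟨L.d k (k + 1) b', map_smul _ _ _⟩, ?_⟩
    rw [d_decalageMk hL (f • b') (L.d k (k + 1) b') (map_smul _ _ _)
        ⟨0, by rw [hb', hs, smul_zero]⟩,
      decalageMap_decalageMk hK hL φ a ha ⟨0, by rw [hφa, smul_zero]⟩,
      decalageMk_sub hL _ _ ⟨0, by rw [hs, smul_zero]⟩]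
    congr 1

/-- A complex `N` is isomorphic to the décalage of `K` if it maps to `K` by maps that are, up to
isomorphism, multiplication by `f^n` in degrees `n ≥ 0`, and both vanish in negative degrees. -/
theorem exists_quasiIso_decalage {N K : CochainComplex (ModuleCat.{max u w} S) ℤ}
    (hK : TorsionFree f K) (ψ : N ⟶ K)
    (hN0 : ∀ i : ℤ, i < 0 → Subsingleton (N.X i)) (hK0 : ∀ i : ℤ, i < 0 → Subsingleton (K.X i))
    (hinj : ∀ n : ℕ, Function.Injective (ψ.f n))
    (hdiv : ∀ (n : ℕ) (x : N.X n), ∃ y, ψ.f n x = f ^ n • y)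
    (hsurj : ∀ (n : ℕ) (y : K.X n), ∃ x, ψ.f n x = f ^ n • y) :
    ∃ g : N ⟶ decalage.{u, w} f K, QuasiIso g := by
  let m : ∀ i, N.X i →ₗ[S] LocalizedModule (Submonoid.powers f) (K.X i) := fun i =>
    LocalizedModule.mkLinearMap (Submonoid.powers f) (K.X i) ∘ₗ (ψ.f i).hom
  have hcomm : ∀ i (x : N.X i), locMap f (K.d i (i + 1)).hom (m i x) =
      m (i + 1) (N.d i (i + 1) x) := fun i x => by
    refine (locMap_mk f _ _).trans (congrArg (LocalizedModule.mkLinearMap _ _) ?_)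
    exact ConcreteCategory.congr_hom (ψ.comm i (i + 1)) x
  have hmem : ∀ i (x : N.X i), m i x ∈ fPow f (K.X i) i := by
    intro i x
    rw [mem_fPow_iff]
    rcases lt_or_ge i 0 with hi | hi
    · have := hN0 i hi
      exact ⟨0, by rw [Subsingleton.elim x 0, map_zero, map_zero]⟩
    · obtain ⟨n, rfl⟩ := Int.eq_ofNat_of_zero_le hi
      obtain ⟨y, hy⟩ := hdiv n x
      exact ⟨y, (fScale_natCast f n y).trans (congrArg (LocalizedModule.mkLinearMap _ _) hy.symm)⟩
  let g : N ⟶ decalage.{u, w} f K :=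
    { f := fun i => ModuleCat.ofHom ((m i).codRestrict (decalageX f K i) fun x =>
        ⟨hmem i x, by
          change locMap f (K.d i (i + 1)).hom (m i x) ∈ fPow f (K.X (i + 1)) (i + 1)
          rw [hcomm]
          exact hmem _ _⟩)
      comm' := fun i j hij => by
        obtain rfl : i + 1 = j := hij
        rw [decalage_d]
        ext x : 2
        exact Subtype.ext (hcomm i x) }
  have hbij : ∀ i, Function.Bijective (g.f i) := by
    intro i
    rcases lt_or_ge i 0 with hi | hi
    · have := hN0 i hi
      have := hK0 i hi
      refine ⟨fun x y _ => Subsingleton.elim x y, fun z => ⟨0, ?_⟩⟩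
      obtain ⟨y, hy, rfl⟩ := exists_eq_decalageMk hK z
      refine (map_zero (g.f i).hom).trans (Subtype.ext ?_)
      change 0 = fScale f (K.X i) i y
      rw [Subsingleton.elim y 0, map_zero]
    · obtain ⟨n, rfl⟩ := Int.eq_ofNat_of_zero_le hi
      refine ⟨fun x y h => hinj n (mk_injective f (hK n) (congrArg Subtype.val h)), fun z => ?_⟩
      obtain ⟨y, hy, rfl⟩ := exists_eq_decalageMk hK z
      -- The element `f^n y` is hit already in `K`, before localization.
      obtain ⟨x, hx⟩ := hsurj n y
      refine ⟨x, Subtype.ext ?_⟩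
      exact (congrArg (LocalizedModule.mkLinearMap _ _) hx).trans (fScale_natCast f n y).symm
  have : ∀ i, IsIso (g.f i) := fun i => (ConcreteCategory.isIso_iff_bijective (g.f i)).2 (hbij i)
  have : IsIso g := HomologicalComplex.Hom.isIso_of_components g
  exact ⟨g, inferInstance⟩

end Decalage

/-! ### Zigzags through complexes without torsion -/

section Link

variable {S : Type u} [CommRing S] (f : S)

/-- Finite zigzags of quasi-isomorphisms through complexes without `f`-torsion. -/
def TorsionFreeLink (K L : CochainComplex (ModuleCat.{v} S) ℤ) : Prop :=
  Relation.EqvGen (fun K L => TorsionFree f K ∧ TorsionFree f L ∧ ∃ φ : K ⟶ L, QuasiIso φ) K L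

variable {f}

theorem TorsionFreeLink.quasiIsomorphic {K L : CochainComplex (ModuleCat.{v} S) ℤ}
    (h : TorsionFreeLink f K L) : QuasiIsomorphic K L := by
  induction h with
  | rel K L h => exact .rel _ _ h.2.2
  | refl K => exact .refl _
  | symm K L _ ih => exact .symm _ _ ih
  | trans K L M _ _ ih ih' => exact .trans _ _ _ ih ih'

/-- The underived décalage is controlled on torsion-free complexes, which is why torsion-freeness is
recorded at every stage of the zigzag. -/
theorem TorsionFreeLink.decalage {K L : CochainComplex (ModuleCat.{max u w} S) ℤ}
    (h : TorsionFreeLink f K L) : QuasiIsomorphic (decalage.{u, w} f K) (decalage.{u, w} f L) := by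
  induction h with
  | rel K L h =>
    obtain ⟨hK, hL, φ, hφ⟩ := h
    exact .rel _ _ ⟨decalageMap f φ, quasiIso_decalageMap hK hL φ hφ⟩
  | refl K => exact .refl _
  | symm K L _ ih => exact .symm _ _ ih
  | trans K L M _ _ ih ih' => exact .trans _ _ _ ih ih'

theorem subsingleton_extend {A : CochainComplex (ModuleCat.{v} S) ℕ} {i : ℤ}
    (hi : ∀ n : ℕ, (n : ℤ) ≠ i) :
    Subsingleton ((A.extend ComplexShape.embeddingUpNat).X i) :=
  ModuleCat.isZero_iff_subsingleton.1 (A.isZero_extend_X ComplexShape.embeddingUpNat i hi)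

theorem TorsionFree.extend {A : CochainComplex (ModuleCat.{v} S) ℕ} (hA : TorsionFree f A) :
    TorsionFree f (A.extend ComplexShape.embeddingUpNat) := by
  intro i x hx
  by_cases hi : ∃ n : ℕ, (n : ℤ) = i
  · obtain ⟨n, hn⟩ := hi
    let e := (A.extendXIso ComplexShape.embeddingUpNat (i' := i) hn).toLinearEquiv
    refine (map_eq_zero_iff e e.injective).1 (hA n _ ?_)
    rw [← map_smul, hx, map_zero]
  · have := subsingleton_extend (A := A) (i := i) fun n hn => hi ⟨n, hn⟩
    exact Subsingleton.elim _ _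

namespace SeqComplex

universe t

variable (f) in
/-- Multiplication by `f` is injective in all degrees. -/
def IsTorsionFree (K : SeqComplex.{u, v} S) : Prop := ∀ n (x : K.X n), f • x = 0 → x = 0

theorem Represents.torsionFree {A : CochainComplex (ModuleCat.{t} S) ℕ} {K : SeqComplex.{u, v} S}
    (h : Represents A K) (hK : K.IsTorsionFree f) : TorsionFree f A := by
  obtain ⟨e, _⟩ := h
  refine fun n x hx => (map_eq_zero_iff (e n) (e n).injective).1 (hK n _ ?_)
  rw [← map_smul, hx, map_zero]

theorem torsionFreeLink {A B : CochainComplex (ModuleCat.{t} S) ℕ} {K : SeqComplex.{u, v} S}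
    {L : SeqComplex.{u, w} S} (hA : Represents A K) (hB : Represents B L)
    (hK : K.IsTorsionFree f) (hL : L.IsTorsionFree f) (h : ∃ g, IsQuasiIso K L g) :
    TorsionFreeLink f (A.extend ComplexShape.embeddingUpNat)
      (B.extend ComplexShape.embeddingUpNat) := by
  obtain ⟨g, hg⟩ := h
  obtain ⟨φ, hφ⟩ := exists_quasiIso hA hB hg
  exact .rel _ _ ⟨(hA.torsionFree hK).extend, (hB.torsionFree hL).extend,
    HomologicalComplex.extendMap φ _, inferInstance⟩

end SeqComplex

theorem DoubleComplex.isTorsionFree_total (K : DoubleComplex.{u, v} S)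
    (h : ∀ p n (x : K.X p n), f • x = 0 → x = 0) : K.total.IsTorsionFree f := fun _ _ hz =>
  Subtype.ext (funext fun p => funext fun n =>
    h p n _ (congrFun (congrFun (congrArg Subtype.val hz) p) n))

end Link

theorem X_sub_one_mem_nonZeroDivisors (R : Type u) [CommRing R] :
    (X - 1 : R[X]) ∈ nonZeroDivisors R[X] :=
  (monic_X_sub_C (1 : R)).mem_nonZeroDivisors

theorem X_sub_one_smul_eq_zero {R : Type u} [CommRing R] {M : Type v} [AddCommGroup M]
    [Module R[X] M] [Module.Flat R[X] M] {x : M} (h : (X - 1 : R[X]) • x = 0) : x = 0 :=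
  smul_eq_zero_of_flat (X_sub_one_mem_nonZeroDivisors R) x h

theorem pi_X_sub_one_smul_eq_zero {R : Type u} [CommRing R] {ι : Type w} {M : ι → Type v}
    [∀ i, AddCommGroup (M i)] [∀ i, Module R[X] (M i)] [∀ i, Module.Flat R[X] (M i)]
    {x : ∀ i, M i} (h : (X - 1 : R[X]) • x = 0) : x = 0 :=
  funext fun i => X_sub_one_smul_eq_zero (congrFun h i)

/-! ### Assembly of the zigzag and the final décalage -/

section Comparison

variable (R : Type u) [CommRing R]

section Omega

variable (d : ℕ)

/-- The unscaled Aomoto–Jackson complex in non-negative degrees. -/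
noncomputable def omegaNat : CochainComplex (ModuleCat.{u} R[X]) ℕ :=
  CochainComplex.of (fun n => ModuleCat.of R[X] (JacksonForm R d n))
    (fun n => ModuleCat.ofHom (nablaq R d n))
    (fun n => by rw [← ModuleCat.ofHom_comp, nablaq_comp_nablaq]; rfl)

/-- The scaled Aomoto–Jackson complex in non-negative degrees. -/
noncomputable def omegaScaledNat : CochainComplex (ModuleCat.{u} R[X]) ℕ :=
  CochainComplex.of (fun n => ModuleCat.of R[X] (JacksonForm R d n))
    (fun n => ModuleCat.ofHom ((X - 1 : R[X]) • nablaq R d n))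
    (fun n => by
      rw [← ModuleCat.ofHom_comp, LinearMap.comp_smul, LinearMap.smul_comp, nablaq_comp_nablaq,
        smul_zero, smul_zero]
      rfl)

theorem omegaNat_d (n : ℕ) : (omegaNat R d).d n (n + 1) = ModuleCat.ofHom (nablaq R d n) :=
  CochainComplex.of_d (fun n => ModuleCat.of R[X] (JacksonForm R d n))
    (fun n => ModuleCat.ofHom (nablaq R d n)) n

theorem omegaScaledNat_d (n : ℕ) : (omegaScaledNat R d).d n (n + 1) =
    ModuleCat.ofHom ((X - 1 : R[X]) • nablaq R d n) :=
  CochainComplex.of_d (fun n => ModuleCat.of R[X] (JacksonForm R d n))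
    (fun n => ModuleCat.ofHom ((X - 1 : R[X]) • nablaq R d n)) n

/-- Multiplication by `(q - 1)^n` in degree `n`, from the Aomoto–Jackson complex to its scaled
version. -/
noncomputable def omegaScaling : omegaNat R d ⟶ omegaScaledNat R d where
  f n := ModuleCat.ofHom ((X - 1 : R[X]) ^ n • (LinearMap.id :
    JacksonForm R d n →ₗ[R[X]] JacksonForm R d n))
  comm' n m hnm := by
    obtain rfl : n + 1 = m := hnm
    rw [omegaNat_d, omegaScaledNat_d]
    refine ModuleCat.hom_ext (LinearMap.ext fun (ω : JacksonForm R d n) => ?_)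
    change (X - 1 : R[X]) • nablaq R d n ((X - 1 : R[X]) ^ n • ω) =
      (X - 1 : R[X]) ^ (n + 1) • nablaq R d n ω
    rw [map_smul, smul_smul, pow_succ, mul_comm]

end Omega

variable (d : ℕ)

theorem represents_omegaScaled [LambdaRing R] : SeqComplex.Represents
    (((ModuleCat.uliftFunctor.{u + 1, u} R[X]).mapHomologicalComplex _).obj (omegaScaledNat R d))
    (CechRing.scaledComplex R d) := by
  refine ⟨fun n => (ULift.moduleEquiv :
    ULift.{u + 1} (JacksonForm R d n) ≃ₗ[R[X]] JacksonForm R d n), fun n x => ?_⟩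
  have h : ((omegaScaledNat R d).d n (n + 1)).hom =
      koszulD (fun i => (X - 1 : R[X]) • jacksonDeriv R d i) n := by
    rw [omegaScaledNat_d, koszulD_jacksonDeriv]
    rfl
  exact DFunLike.congr_fun h (show ULift.{u + 1} (JacksonForm R d n) from x).down

theorem isTorsionFree_scaledComplex :
    (CechRing.scaledComplex R d).IsTorsionFree (X - 1 : R[X]) := fun n _ hx =>
  pi_X_sub_one_smul_eq_zero
    (M := fun _ : {I : Finset (Fin d) // I.card = n} => MvPolynomial (Fin d) R[X]) hx

variable [LambdaRing R]

theorem isTorsionFree_replacement (A : Type u) [CommRing A] [LambdaRing A] [Algebra R A] :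
    (replacementSemi (Strat.forgetToModule R A)).toSeq.IsTorsionFree (X - 1 : R[X]) :=
  fun n _ hx => pi_X_sub_one_smul_eq_zero
    (M := fun σ : ComposableArrows (Strat R A) n => (σ.obj (Fin.last n)).carrier) hx

theorem biComplex_torsionFree (p n : ℕ)
    (x : (stratCover R d).biX (Strat.forgetToModule R (MvPolynomial (Fin d) R)) p n)
    (hx : (X - 1 : R[X]) • x = 0) : x = 0 :=
  funext fun σ => funext fun w =>
    X_sub_one_smul_eq_zero (M := (σ.obj (Fin.last p)).carrier) (congrFun (congrFun hx σ) w)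

theorem isTorsionFree_cech : ((stratCover R d).cechSemi
    (Strat.forgetToModule R (MvPolynomial (Fin d) R))).toSeq.IsTorsionFree (X - 1 : R[X]) :=
  fun n _ hx => X_sub_one_smul_eq_zero (M := CechRing R d n) hx

theorem jacksonDouble_torsionFree (n m : ℕ) (x : (CechRing.jacksonDouble R d).X n m)
    (hx : (X - 1 : R[X]) • x = 0) : x = 0 :=
  pi_X_sub_one_smul_eq_zero
    (M := fun _ : {I : Finset (Fin d) // I.card = m} => CechRing R d (n + 1)) hx

/-- The zigzag is: homotopy limit, total complex over chains and points, Čech complex, total complex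
of difference operators, scaled Aomoto–Jackson complex. Each double complex is entered from both
sides, the flip exchanging rows and columns. -/
theorem qDR_link_qOmegaScaled : TorsionFreeLink (X - 1 : R[X])
    (qDR R (MvPolynomial (Fin d) R)) (qOmegaScaled R d) := by
  let F := Strat.forgetToModule R (MvPolynomial (Fin d) R)
  let B := (stratCover R d).biComplex F
  let D := CechRing.jacksonDouble R d
  have hB := B.isTorsionFree_total (biComplex_torsionFree R d)
  have hB' := B.flip.isTorsionFree_total fun p n => biComplex_torsionFree R d n p
  have hD := D.isTorsionFree_total (jacksonDouble_torsionFree R d)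
  have hD' := D.flip.isTorsionFree_total fun p n => jacksonDouble_torsionFree R d n p
  have rB := SeqComplex.represents_toComplex.{u, u + 1, u + 1} B.total
  have rB' := SeqComplex.represents_toComplex.{u, u + 1, u + 1} B.flip.total
  have rC := SeqComplex.represents_toComplex.{u, u, u + 1} ((stratCover R d).cechSemi F).toSeq
  have rD := SeqComplex.represents_toComplex.{u, u, u + 1} D.total
  have rD' := SeqComplex.represents_toComplex.{u, u, u + 1} D.flip.total
  have h1 := SeqComplex.torsionFreeLink (represents_replacement F) rB
    (isTorsionFree_replacement R _) hB ((stratCover R d).exists_isQuasiIso_replacement F)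
  have h2 := SeqComplex.torsionFreeLink rB' rB hB' hB ⟨_, B.isQuasiIso_swap⟩
  have h3 := SeqComplex.torsionFreeLink rC rB' (isTorsionFree_cech R d) hB'
    ((stratCover R d).exists_isQuasiIso_cech F)
  have h4 := SeqComplex.torsionFreeLink rC rD (isTorsionFree_cech R d) hD
    (CechRing.exists_isQuasiIso_jacksonDouble_of_cech R d)
  have h5 := SeqComplex.torsionFreeLink rD' rD hD' hD ⟨_, D.isQuasiIso_swap⟩
  have h6 := SeqComplex.torsionFreeLink (represents_omegaScaled R d) rD'
    (isTorsionFree_scaledComplex R d) hD'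
    (CechRing.exists_isQuasiIso_jacksonDouble_of_scaled R d)
  have h12 := h1.trans _ _ _ (h2.symm _ _)
  have h34 := (h3.symm _ _).trans _ _ _ h4
  have h56 := (h5.symm _ _).trans _ _ _ (h6.symm _ _)
  exact h12.trans _ _ _ (h34.trans _ _ _ h56)

theorem torsionFree_qDR (A : Type u) [CommRing A] [LambdaRing A] [Algebra R A] :
    TorsionFree (X - 1 : R[X]) (qDR R A) :=
  ((represents_replacement (Strat.forgetToModule R A)).torsionFree
    (isTorsionFree_replacement R A)).extend

/-- The scaled differential is divisible by `q - 1` on every form, so the décalage has the terms `(q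
- 1)^n Ω^n[q]`. After division by these powers the differential becomes `∇_q`. -/
theorem exists_quasiIso_qOmega : ∃ g : qOmega R d ⟶
    decalage.{u, u + 1} (X - 1 : R[X]) (qOmegaScaled R d), QuasiIso g := by
  let U := ModuleCat.uliftFunctor.{u + 1, u} R[X]
  let ψ := (U.mapHomologicalComplex (ComplexShape.up ℕ)).map (omegaScaling R d)
  have hTF := ((represents_omegaScaled R d).torsionFree (isTorsionFree_scaledComplex R d))
  let e := ComplexShape.embeddingUpNat
  let K := (U.mapHomologicalComplex (ComplexShape.up ℕ)).obj (omegaNat R d)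
  let L := (U.mapHomologicalComplex (ComplexShape.up ℕ)).obj (omegaScaledNat R d)
  let eK : ∀ n : ℕ, (K.extend e).X n ≃ₗ[R[X]] ULift.{u + 1} (JacksonForm R d n) := fun n =>
    (K.extendXIso e (i' := (n : ℤ)) rfl).toLinearEquiv
  let eL : ∀ n : ℕ, (L.extend e).X n ≃ₗ[R[X]] ULift.{u + 1} (JacksonForm R d n) := fun n =>
    (L.extendXIso e (i' := (n : ℤ)) rfl).toLinearEquiv
  have key : ∀ (n : ℕ) (x : (K.extend e).X n), (HomologicalComplex.extendMap ψ e).f n x =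
      (eL n).symm ((X - 1 : R[X]) ^ n • eK n x) := fun n x =>
    ConcreteCategory.congr_hom (HomologicalComplex.extendMap_f ψ e (i' := (n : ℤ)) rfl) x
  have hpow : ∀ (n : ℕ) (x : ULift.{u + 1} (JacksonForm R d n)),
      (X - 1 : R[X]) ^ n • x = 0 → x = 0 := fun n x =>
    smul_eq_zero_of_flat (pow_mem (X_sub_one_mem_nonZeroDivisors R) n) x
  refine exists_quasiIso_decalage (K := L.extend e) (N := K.extend e) hTF.extend
    (HomologicalComplex.extendMap ψ e) (fun i hi => subsingleton_extend fun n => by omega)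
    (fun i hi => subsingleton_extend fun n => by omega) (fun n => ?_) (fun n x => ?_) fun n y => ?_
  · refine (injective_iff_map_eq_zero ((HomologicalComplex.extendMap ψ e).f n).hom).2 fun x hx => ?_
    have h1 := (key n x).symm.trans hx
    exact (eK n).injective ((hpow n _ ((map_eq_zero_iff _ (eL n).symm.injective).1 h1)).trans
      (map_zero (eK n)).symm)
  · exact ⟨(eL n).symm (eK n x), (key n x).trans (map_smul _ _ _)⟩
  · refine ⟨(eK n).symm (eL n y), (key n _).trans ?_⟩
    rw [LinearEquiv.apply_symm_apply, map_smul, LinearEquiv.symm_apply_apply]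

end Comparison

theorem mainTheorem1 (R : Type u) [CommRing R] [LambdaRing R] (d : ℕ) :
    QuasiIsomorphic (qDR R (MvPolynomial (Fin d) R)) (qOmegaScaled R d) ∧
    QuasiIsomorphic
      (derivedDecalage.{u, u + 1} (qDR R (MvPolynomial (Fin d) R)) (X - 1 : R[X]))
      (qOmega R d) := by
  have h := qDR_link_qOmegaScaled R d
  -- As a complex of products of flat modules `qDR` is itself torsion-free, so the augmentation of
  -- the resolution is one more link of the zigzag.
  have hπ : TorsionFreeLink (X - 1 : R[X])
      (torsionFreeResolution.{u, u + 1} (qDR R (MvPolynomial (Fin d) R)))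
      (qDR R (MvPolynomial (Fin d) R)) :=
    .rel _ _ ⟨torsionFreeResolution_torsionFree.{u, u + 1} _ (X_sub_one_mem_nonZeroDivisors R),
      torsionFree_qDR R _, torsionFreeResolutionπ.{u, u + 1} _,
      quasiIso_torsionFreeResolutionπ.{u, u + 1} _⟩
  exact ⟨h.quasiIsomorphic, .trans _ _ _ (TorsionFreeLink.decalage (hπ.trans _ _ _ h))
    (.symm _ _ (.rel _ _ (exists_quasiIso_qOmega R d)))⟩
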